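/- Let $\mathcal{C}$ be a (locally small) category enriched in spaces, with mapping spaces $\mathrm{Map}_{\mathcal{C}}(X,Y)$ and homotopy category $h\mathcal{C}$, whose morphism sets are $[X,Y]_{h\mathcal{C}}=\pi_0\mathrm{Map}_{\mathcal{C}}(X,Y)$; here spaces are Kan complexes. Suppose that $\mathcal{C}$ is stable, i.e. (1) there is a homotopy zero object $*$, meaning that all $\mathrm{Map}_{\mathcal{C}}(X,*)$ and $\mathrm{Map}_{\mathcal{C}}(*,X)$ are contractible; (2) $\mathcal{C}$ has homotopy pushouts of diagrams $*\leftarrow X\to Y$ and homotopy pullbacks of diagrams $*\to Y\leftarrow X$; (3) a homotopy coherent square with corners $X, Y, *, Z$ (that is, maps $X\to Y\to Z$ and $X\to *\to Z$ with a homotopy between the two composites $X\to Z$) is a homotopy pushout square if and only if it is a homotopy pullback square. Let $S=\{f_\alpha\colon A_\alpha\to B_\alpha\}$ be a class of maps in $\mathcal{C}$ that is shift-stable, i.e. for every $f\in S$ both the suspension $\Sigma f$ and the desuspension $\Sigma^{-1}f$ are isomorphic, as arrows of $h\mathcal{C}$, to images of elements of $S$. For each $\alpha$ let $B_\alpha/A_\alpha=\mathrm{hocolim}(*\leftarrow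 A_\alpha\to B_\alpha)$ be a cofiber of $f_\alpha$. Then an object $Y$ of $\mathcal{C}$ is $S$-local, i.e. the map $f_\alpha^*\colon \mathrm{Map}_{\mathcal{C}}(B_\alpha,Y)\to\mathrm{Map}_{\mathcal{C}}(A_\alpha,Y)$ is a weak equivalence for every $\alpha$, if and only if for every $\alpha$ the set $[B_\alpha/A_\alpha,Y]_{h\mathcal{C}}$ of homotopy classes of maps is trivial (has exactly one element). -/

import Mathlib

open CategoryTheory MonoidalCategory CartesianMonoidalCategory Simplicial

universe v u

/-! ## Spaces

Spaces are Kan complexes; the notions below are used for Kan complexes only. -/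

namespace SSet

/-- The map `π_n (X, x) → π_n (Y, f x)` of simplicial homotopy groups: elements are maps
`Δ[n] ⟶ X` that are constant at `x` on the boundary, up to homotopy relative to the boundary. -/
def mapHomotopyClass {X Y : SSet.{v}} (f : X ⟶ Y) (n : ℕ) (x : X _⦋0⦌) :
    RelativeMorphism.HomotopyClass (boundary.{v} n) (Subcomplex.ofSimplex x)
        (const ⟨x, Subcomplex.mem_ofSimplex_obj x⟩) →
      RelativeMorphism.HomotopyClass (boundary.{v} n) (Subcomplex.ofSimplex (f.app _ x))
        (const ⟨f.app _ x, Subcomplex.mem_ofSimplex_obj _⟩) :=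
  fun s ↦ s.postcomp (RelativeMorphism.ofSimplex₀ f x (f.app _ x) rfl) rfl

/-- A map of Kan complexes is a weak equivalence if it induces bijections on `π₀` and on the
homotopy groups `π_n`, `n ≥ 1`, at all base points. -/
structure IsWeakEquivalence {X Y : SSet.{v}} (f : X ⟶ Y) : Prop where
  bijective_π₀ : Function.Bijective (mapπ₀ f)
  bijective_πn : ∀ (n : ℕ) (x : X _⦋0⦌), Function.Bijective (mapHomotopyClass f (n + 1) x)

/-- A space is (weakly) contractible if its map to the point is a weak equivalence. -/
def IsWeaklyContractible (X : SSet.{v}) : Prop := IsWeakEquivalence (toUnit X)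

/-- The space of paths `Δ[1] ⟶ X`. -/
noncomputable abbrev pathSpace (X : SSet.{v}) : SSet.{v} := (ihom (Δ[1] : SSet.{v})).obj X

/-- Evaluation of paths at the vertex `k` of `Δ[1]`. -/
noncomputable def pathEval (X : SSet.{v}) (k : Fin 2) : pathSpace X ⟶ X :=
  lift (const (stdSimplex.obj₀Equiv.{v}.symm k)) (𝟙 _) ≫ (ihom.ev (Δ[1] : SSet.{v})).app X

/-- The homotopy pullback `holim (X ⟶ Z ⟵ Y)`: the space of triples `(γ, (x, y))` where `γ` is a
path in `Z` from `u x` to `w y`. -/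
noncomputable abbrev homotopyPullback {X Y Z : SSet.{v}} (u : X ⟶ Z) (w : Y ⟶ Z) : SSet.{v} :=
  Limits.pullback (lift (pathEval Z 0) (pathEval Z 1)) (u ⊗ₘ w)

lemma curry_pathEval {K X : SSet.{v}} (H : Δ[1] ⊗ K ⟶ X) (k : Fin 2) :
    MonoidalClosed.curry H ≫ pathEval X k =
      lift (const (stdSimplex.obj₀Equiv.{v}.symm k)) (𝟙 K) ≫ H := by
  have h : MonoidalClosed.curry H ≫ lift (const (stdSimplex.obj₀Equiv.{v}.symm k)) (𝟙 _) =
      lift (const (stdSimplex.obj₀Equiv.{v}.symm k)) (𝟙 K) ≫ Δ[1] ◁ MonoidalClosed.curry H := rfl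
  rw [pathEval, reassoc_of% h, ← MonoidalClosed.uncurry_eq, MonoidalClosed.uncurry_curry]

/-- The map to the homotopy pullback given by two maps `a`, `b` and a homotopy `H` from `a ≫ u`
to `b ≫ w`. -/
noncomputable def homotopyPullbackLift {K X Y Z : SSet.{v}} {u : X ⟶ Z} {w : Y ⟶ Z}
    (a : K ⟶ X) (b : K ⟶ Y) (H : Δ[1] ⊗ K ⟶ Z)
    (h₀ : lift (const (stdSimplex.obj₀Equiv.{v}.symm 0)) (𝟙 K) ≫ H = a ≫ u)
    (h₁ : lift (const (stdSimplex.obj₀Equiv.{v}.symm 1)) (𝟙 K) ≫ H = b ≫ w) :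
    K ⟶ homotopyPullback u w :=
  Limits.pullback.lift (MonoidalClosed.curry H) (lift a b) (by
    ext1
    · rw [Category.assoc, lift_fst, curry_pathEval, h₀, Category.assoc, tensorHom_fst,
        lift_fst_assoc]
    · rw [Category.assoc, lift_snd, curry_pathEval, h₁, Category.assoc, tensorHom_snd,
        lift_snd_assoc])

lemma const_comp_edge {X : SSet.{v}} {x₀ x₁ : X _⦋0⦌} (e : Edge x₀ x₁) (K : SSet.{v}) :
    (const (stdSimplex.obj₀Equiv.{v}.symm 0) : K ⟶ Δ[1]) ≫ SSet.yonedaEquiv.symm e.edge =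
        const x₀ ∧
      (const (stdSimplex.obj₀Equiv.{v}.symm 1) : K ⟶ Δ[1]) ≫ SSet.yonedaEquiv.symm e.edge =
        const x₁ := by
  have h₀ : (SSet.yonedaEquiv.symm e.edge).app _ (stdSimplex.obj₀Equiv.{v}.symm 0) = x₀ := by
    refine (?_ : _ = X.δ 1 e.edge).trans e.src_eq
    exact congrArg (fun φ : ⦋0⦌ ⟶ ⦋1⦌ ↦ X.map φ.op e.edge) (by ext i; fin_cases i; rfl)
  have h₁ : (SSet.yonedaEquiv.symm e.edge).app _ (stdSimplex.obj₀Equiv.{v}.symm 1) = x₁ := by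
    refine (?_ : _ = X.δ 0 e.edge).trans e.tgt_eq
    exact congrArg (fun φ : ⦋0⦌ ⟶ ⦋1⦌ ↦ X.map φ.op e.edge) (by ext i; fin_cases i; rfl)
  exact ⟨(const_comp _ _).trans (congrArg const h₀), (const_comp _ _).trans (congrArg const h₁)⟩

/-- Functoriality of the homotopy pullback in strictly commutative diagrams. -/
noncomputable def homotopyPullbackMap {X Y Z X' Y' Z' : SSet.{v}} {u : X ⟶ Z} {w : Y ⟶ Z}
    {u' : X' ⟶ Z'} {w' : Y' ⟶ Z'} (a : X ⟶ X') (b : Y ⟶ Y') (c : Z ⟶ Z')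
    (hu : u ≫ c = a ≫ u') (hw : w ≫ c = b ≫ w') :
    homotopyPullback u w ⟶ homotopyPullback u' w' :=
  Limits.pullback.map _ _ _ _ ((ihom (Δ[1] : SSet.{v})).map c) (a ⊗ₘ b) (c ⊗ₘ c)
    (by
      have h (k : Fin 2) : pathEval Z k ≫ c = (ihom (Δ[1] : SSet.{v})).map c ≫ pathEval Z' k := by
        simp only [pathEval, Category.assoc]
        rfl
      ext1 <;> simp [h])
    (by rw [tensorHom_comp_tensorHom, tensorHom_comp_tensorHom, hu, hw])

end SSet

/-! ## Categories enriched in spaces -/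

namespace CategoryTheory.SimplicialCategory

open SSet

variable {C : Type u} [Category.{v} C] [SimplicialCategory C]

/-- The restriction map `Map(B, Y) ⟶ Map(A, Y)` along `f : A ⟶ B`. -/
noncomputable abbrev mapPre {A B : C} (f : A ⟶ B) (Y : C) : sHom B Y ⟶ sHom A Y :=
  eHomWhiskerRight SSet f Y

/-- The map `Map(T, X) ⟶ Map(T, Y)` given by composition with `g : X ⟶ Y`. -/
noncomputable abbrev mapPost (T : C) {X Y : C} (g : X ⟶ Y) : sHom T X ⟶ sHom T Y :=
  eHomWhiskerLeft SSet T g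

lemma comp_homEquiv' {X Y Z : C} (f : X ⟶ Y) (g : Y ⟶ Z) :
    homEquiv' X Z (f ≫ g) = (sHomComp X Y Z).app _ (homEquiv' X Y f, homEquiv' Y Z g) := by
  change (eHomEquiv SSet (f ≫ g)).app _ _ = _
  rw [eHomEquiv_comp]
  rfl

lemma mapPre_app {X Y Z : C} (f : X ⟶ Y) (g : Y ⟶ Z) :
    (mapPre f Z).app _ (homEquiv' Y Z g) = homEquiv' X Z (f ≫ g) := by
  rw [comp_homEquiv']
  rfl

lemma mapPost_app {X Y Z : C} (f : X ⟶ Y) (g : Y ⟶ Z) :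
    (mapPost X g).app _ (homEquiv' X Y f) = homEquiv' X Z (f ≫ g) := by
  rw [comp_homEquiv']
  rfl

lemma toUnit_eHomEquiv {X Y : C} (f : X ⟶ Y) (K : SSet.{v}) :
    toUnit K ≫ eHomEquiv SSet f = const (homEquiv' X Y f) := by
  rw [← (sHom X Y).unitHomEquiv.symm_apply_apply (eHomEquiv SSet f)]
  rfl

lemma mapPre_eq {X Y : C} (f : X ⟶ Y) (T : C) :
    mapPre f T = lift (const (homEquiv' X Y f)) (𝟙 _) ≫ sHomComp X Y T := by
  rw [← toUnit_eHomEquiv]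
  rfl

lemma mapPost_eq (T : C) {X Y : C} (g : X ⟶ Y) :
    mapPost T g = lift (𝟙 _) (const (homEquiv' X Y g)) ≫ sHomComp T X Y := by
  rw [← toUnit_eHomEquiv]
  rfl

/-- The homotopy category `hC`: it has the objects of `C`, and its morphisms are
the homotopy classes `[X, Y] = π₀ Map(X, Y)`. -/
structure HoCat (C : Type u) where
  /-- An object of `C`, as an object of `hC`. -/
  of ::
  /-- The underlying object of `C`. -/
  as : C

namespace HoCat

/-- Composition of homotopy classes of maps. -/
noncomputable def comp {X Y Z : C} (a : π₀ (sHom X Y)) (b : π₀ (sHom Y Z)) : π₀ (sHom X Z) :=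
  π₀.lift (fun x ↦ mapπ₀ (mapPre ((homEquiv' X Y).symm x) Z) b) (fun x x' e ↦ by
    induction b with
    | mk y =>
      obtain ⟨g, rfl⟩ := (homEquiv' Y Z).surjective y
      obtain ⟨f, rfl⟩ := (homEquiv' X Y).surjective x
      obtain ⟨f', rfl⟩ := (homEquiv' X Y).surjective x'
      simp only [Equiv.symm_apply_apply, mapπ₀_mk, mapPre_app, ← mapPost_app]
      exact π₀.sound (e.map (mapPost X g))) a

/-- The homotopy class of a map. -/
def cls {X Y : C} (f : X ⟶ Y) : π₀ (sHom X Y) := π₀.mk (homEquiv' X Y f)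

lemma cls_surjective {X Y : C} : Function.Surjective (cls : (X ⟶ Y) → π₀ (sHom X Y)) :=
  π₀.mk_surjective.comp (homEquiv' X Y).surjective

lemma comp_cls {X Y Z : C} (f : X ⟶ Y) (g : Y ⟶ Z) : comp (cls f) (cls g) = cls (f ≫ g) := by
  simp [comp, cls, mapPre_app]

noncomputable instance : Category.{v} (HoCat C) where
  Hom X Y := π₀ (sHom X.as Y.as)
  id X := cls (𝟙 X.as)
  comp := comp
  id_comp a := by
    obtain ⟨f, rfl⟩ := cls_surjective a
    rw [comp_cls, Category.id_comp]
  comp_id a := by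
    obtain ⟨f, rfl⟩ := cls_surjective a
    rw [comp_cls, Category.comp_id]
  assoc a b c := by
    obtain ⟨f, rfl⟩ := cls_surjective a
    obtain ⟨g, rfl⟩ := cls_surjective b
    obtain ⟨h, rfl⟩ := cls_surjective c
    rw [comp_cls, comp_cls, comp_cls, comp_cls, Category.assoc]

/-- The image of a map of `C` in the homotopy category. -/
def map {X Y : C} (f : X ⟶ Y) : of X ⟶ of Y := cls f

end HoCat

/-- Homotopy coherent squares with top side `i : X ⟶ Y`, left side `j : X ⟶ Z`,
right side `p : Y ⟶ W` and bottom side `q : Z ⟶ W`: a homotopy from `i ≫ p` to `j ≫ q`,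
i.e. an edge of `Map(X, W)`. -/
abbrev HoSquare {X Y Z W : C} (i : X ⟶ Y) (j : X ⟶ Z) (p : Y ⟶ W) (q : Z ⟶ W) : Type v :=
  Edge (homEquiv' X W (i ≫ p)) (homEquiv' X W (j ≫ q))

namespace HoSquare

variable {X Y Z W : C} {i : X ⟶ Y} {j : X ⟶ Z} {p : Y ⟶ W} {q : Z ⟶ W}

/-- The map `Map(W, T) ⟶ holim (Map(Y, T) ⟶ Map(X, T) ⟵ Map(Z, T))` given by a homotopy coherent
square. -/
noncomputable def fromMap (h : HoSquare i j p q) (T : C) :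
    sHom W T ⟶ homotopyPullback (mapPre i T) (mapPre j T) :=
  homotopyPullbackLift (mapPre p T) (mapPre q T)
    (SSet.yonedaEquiv.symm h.edge ▷ sHom W T ≫ sHomComp X W T)
    (by
      rw [← eHomWhiskerRight_comp]
      exact (congrArg (fun c ↦ lift c (𝟙 (sHom W T)) ≫ sHomComp X W T)
        (const_comp_edge h _).1).trans (mapPre_eq _ _).symm)
    (by
      rw [← eHomWhiskerRight_comp]
      exact (congrArg (fun c ↦ lift c (𝟙 (sHom W T)) ≫ sHomComp X W T)
        (const_comp_edge h _).2).trans (mapPre_eq _ _).symm)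

/-- The map `Map(T, X) ⟶ holim (Map(T, Y) ⟶ Map(T, W) ⟵ Map(T, Z))` given by a homotopy coherent
square. -/
noncomputable def toMap (h : HoSquare i j p q) (T : C) :
    sHom T X ⟶ homotopyPullback (mapPost T p) (mapPost T q) :=
  homotopyPullbackLift (mapPost T i) (mapPost T j)
    ((β_ _ _).hom ≫ sHom T X ◁ SSet.yonedaEquiv.symm h.edge ≫ sHomComp T X W)
    (by
      rw [← eHomWhiskerLeft_comp]
      exact (congrArg (fun c ↦ lift (𝟙 (sHom T X)) c ≫ sHomComp T X W)
        (const_comp_edge h _).1).trans (mapPost_eq _ _).symm)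
    (by
      rw [← eHomWhiskerLeft_comp]
      exact (congrArg (fun c ↦ lift (𝟙 (sHom T X)) c ≫ sHomComp T X W)
        (const_comp_edge h _).2).trans (mapPost_eq _ _).symm)

/-- The square exhibits `W` as `hocolim (Y ⟵ X ⟶ Z)`. -/
def IsHomotopyPushout (h : HoSquare i j p q) : Prop :=
  ∀ T : C, IsWeakEquivalence (h.fromMap T)

/-- The square exhibits `X` as `holim (Y ⟶ W ⟵ Z)`. -/
def IsHomotopyPullback (h : HoSquare i j p q) : Prop :=
  ∀ T : C, IsWeakEquivalence (h.toMap T)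

end HoSquare

/-- Homotopy zero objects. -/
structure IsHomotopyZero (Z : C) : Prop where
  from_zero : ∀ X : C, IsWeaklyContractible (sHom Z X)
  to_zero : ∀ X : C, IsWeaklyContractible (sHom X Z)

variable (C) in
/-- Stable categories (enriched in Kan complexes). -/
structure IsStable : Prop where
  exists_zero : ∃ Z : C, IsHomotopyZero Z
  exists_pushout : ∀ {X Y Z : C} (i : X ⟶ Y) (j : X ⟶ Z), IsHomotopyZero Z →
    ∃ (W : C) (p : Y ⟶ W) (q : Z ⟶ W) (h : HoSquare i j p q), h.IsHomotopyPushout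
  exists_pullback : ∀ {Y Z W : C} (p : Y ⟶ W) (q : Z ⟶ W), IsHomotopyZero Z →
    ∃ (X : C) (i : X ⟶ Y) (j : X ⟶ Z) (h : HoSquare i j p q), h.IsHomotopyPullback
  pushout_iff_pullback : ∀ {X Y Z W : C} {i : X ⟶ Y} {j : X ⟶ Z} {p : Y ⟶ W} {q : Z ⟶ W}
    (h : HoSquare i j p q), IsHomotopyZero Z → (h.IsHomotopyPushout ↔ h.IsHomotopyPullback)

/-- `Q` is a cofiber `B/A = hocolim (* ⟵ A ⟶ B)` of the map `f : A ⟶ B`. -/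
def IsCofiber {A B : C} (f : A ⟶ B) (Q : C) : Prop :=
  ∃ (Z : C) (j : A ⟶ Z) (p : B ⟶ Q) (q : Z ⟶ Q) (h : HoSquare f j p q),
    IsHomotopyZero Z ∧ h.IsHomotopyPushout

/-- Precomposition with `f : A ⟶ B` on spaces of cocones
`holim (Map(Y, T) ⟶ Map(B, T) ⟵ Map(Z, T))`. -/
noncomputable def precompCocones {A B Y Z : C} (f : A ⟶ B) (i : B ⟶ Y) (j : B ⟶ Z) (T : C) :
    homotopyPullback (mapPre i T) (mapPre j T) ⟶
      homotopyPullback (mapPre (f ≫ i) T) (mapPre (f ≫ j) T) :=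
  homotopyPullbackMap (𝟙 _) (𝟙 _) (mapPre f T) (by simp) (by simp)

/-- `g : A' ⟶ B'` is a suspension of `f : A ⟶ B`: there are homotopy pushout squares exhibiting
`A'` as `ΣA = hocolim (* ⟵ A ⟶ *)` and `B'` as `ΣB = hocolim (* ⟵ B ⟶ *)`, and `g` is,
up to homotopy, the map `ΣA ⟶ ΣB` induced by `f`, i.e. the cocone under `* ⟵ A ⟶ *` obtained from
that of `A'` by composition with `g` is homotopic to the one obtained
from that of `B'` by precomposition with `f`. -/
def IsSuspension {A B A' B' : C} (f : A ⟶ B) (g : A' ⟶ B') : Prop :=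
  ∃ (Z₁ Z₂ : C) (i : B ⟶ Z₁) (j : B ⟶ Z₂)
    (p : Z₁ ⟶ A') (q : Z₂ ⟶ A') (h : HoSquare (f ≫ i) (f ≫ j) p q)
    (p' : Z₁ ⟶ B') (q' : Z₂ ⟶ B') (h' : HoSquare i j p' q'),
    IsHomotopyZero Z₁ ∧ IsHomotopyZero Z₂ ∧ h.IsHomotopyPushout ∧ h'.IsHomotopyPushout ∧
    mapπ₀ (h.fromMap B') (HoCat.cls g) =
      mapπ₀ (precompCocones f i j B') (mapπ₀ (h'.fromMap B') (HoCat.cls (𝟙 B')))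

/-- Maps of `C` whose images in `hC` are isomorphic (as arrows). -/
def HoIsomorphic {A B A' B' : C} (f : A ⟶ B) (g : A' ⟶ B') : Prop :=
  Nonempty (Arrow.mk (HoCat.map f) ≅ Arrow.mk (HoCat.map g))

/-- `S` is shift-stable: its image in `hC` is closed under suspension and
desuspension, up to isomorphism. Here `g` is a desuspension of `f` when `f` is a suspension
of `g`. -/
structure IsShiftStable (S : MorphismProperty C) : Prop where
  suspension : ∀ {A B : C} (f : A ⟶ B), S f →
    ∃ (A₁ B₁ A₂ B₂ : C) (g : A₁ ⟶ B₁) (g' : A₂ ⟶ B₂),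
      IsSuspension f g ∧ S g' ∧ HoIsomorphic g' g
  desuspension : ∀ {A B : C} (f : A ⟶ B), S f →
    ∃ (A₁ B₁ A₂ B₂ : C) (g : A₁ ⟶ B₁) (g' : A₂ ⟶ B₂),
      IsSuspension g f ∧ S g' ∧ HoIsomorphic g' g

/-- `Y` is `S`-local: `Map(B, Y) ⟶ Map(A, Y)` is a weak equivalence for all `f : A ⟶ B` in `S`. -/
def IsLocal (S : MorphismProperty C) (Y : C) : Prop :=
  ∀ ⦃A B : C⦄ (f : A ⟶ B), S f → IsWeakEquivalence (mapPre f Y)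

end CategoryTheory.SimplicialCategory

open CategoryTheory.SimplicialCategory

/-! For a cofiber `Q` of `f : A ⟶ B`, the space `Map(Q, Y)` is the homotopy fiber of `f^* : Map(B,
Y) ⟶ Map(A, Y)` over the component of null maps. If `f^*` is a weak equivalence, this fiber is
connected, which gives one implication.

For the converse, the fiber sequence `[B, ΩY] → [A, ΩY] → [Q, Y] → [B, Y] → [A, Y]` shows that `[Q,
Y]` is trivial exactly when the last map has trivial kernel and the first one is surjective. These
two conditions for all `f` in `S` form `IsOrthogonal S Y`. They depend only on the image of `f` in
`hC`, and the bijection `[ΣA, Y] ≅ [A, ΩY]` (`SuspensionLoop`) trades a suspension of `f` for a loop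
object of `Y`. Hence shift-stability of `S` lets orthogonality pass from `Y` to `ΩY` and back
(`IsOrthogonal.loop`, `IsOrthogonal.of_loop`).

Two consequences are drawn. Since `Map(Q, ΩY)` is the loop space of `Map(Q, Y)`, all iterated loop
spaces of `Map(Q, Y)` are connected, so `Map(Q, Y)` is contractible
(`IsOrthogonal.trivialFibration`, by `exists_extension_succ`). This controls `f^*` only over the
null component of `Map(A, Y)`. Stability removes the restriction: `Y` is a loop object of some `Y'`,
again orthogonal to `S`, and `Map(B, Y) ⟶ Map(A, Y)` is the map of loop spaces of `Map(B, Y') ⟶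
Map(A, Y')` at null maps, which sees only the null component
(`isWeakEquivalence_homotopyPullbackMap`, `IsOrthogonal.isLocal`).

The simplicial input is phrased with lifting problems (`Solves`). A map of Kan complexes is replaced
by the Kan fibration `mappingPathEnd`, which is trivial when the map is a weak equivalence
(`trivialFibration_mappingPathEnd`, resting on `solves_of_piInjective_of_piSurjective`). Homotopy
fibers are taken along maps `r : V ⟶ M` from contractible spaces instead of points, because the
mapping spaces of a zero object are only contractible; connectedness or contractibility of such a
fiber means solvability of lifting problems over the component of `V`
(`solves_of_exists_extension`). -/

namespace SSet

open Limits HomotopicalAlgebra modelCategoryQuillen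

/-! ### Path spaces -/

/-- The map of path spaces induced by a map. -/
noncomputable abbrev pathMap {X Y : SSet.{v}} (f : X ⟶ Y) : pathSpace X ⟶ pathSpace Y :=
  (ihom (Δ[1] : SSet.{v})).map f

lemma pathMap_eval {X Y : SSet.{v}} (f : X ⟶ Y) (k : Fin 2) :
    pathMap f ≫ pathEval Y k = pathEval X k ≫ f := by
  simp only [pathEval, Category.assoc]
  rfl

/-- The map sending a point to the constant path at this point. -/
noncomputable def pathRefl (X : SSet.{v}) : X ⟶ pathSpace X :=
  MonoidalClosed.curry (snd (Δ[1] : SSet.{v}) X)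

@[simp]
lemma pathRefl_eval (X : SSet.{v}) (k : Fin 2) : pathRefl X ≫ pathEval X k = 𝟙 X := by
  rw [pathRefl, curry_pathEval, lift_snd]

@[simp]
lemma pathRefl_eval_assoc {X T : SSet.{v}} (k : Fin 2) (g : X ⟶ T) :
    pathRefl X ≫ pathEval X k ≫ g = g := by
  rw [← Category.assoc, pathRefl_eval, Category.id_comp]

lemma pathRefl_map {X Y : SSet.{v}} (f : X ⟶ Y) :
    pathRefl X ≫ pathMap f = f ≫ pathRefl Y := by
  rw [pathRefl, pathRefl, ← MonoidalClosed.curry_natural_right,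
    ← MonoidalClosed.curry_natural_left, whiskerLeft_snd]

/-- This identifies evaluation of paths at an endpoint with restriction along a horn inclusion, so
that lifting homotopies becomes an anodyne extension problem. -/
lemma horn_one_eq_ofSimplex (k : Fin 2)  :
   (Λ[1, k] : (Δ[1] : SSet.{v}).Subcomplex) = Subcomplex.ofSimplex (stdSimplex.obj₀Equiv.{v}.symm k) := by
  have h := horn_eq_iSup.{v} 1 k
  fin_cases k
  · trans stdSimplex.face {(1 : Fin 2)}ᶜ
    · rw [h]
      apply le_antisymm
      · rw [iSup_le_iff]
        rintro ⟨j, hj⟩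
        fin_cases j
        · simp at hj
        · exact le_refl _
      · exact le_iSup (fun j : ({0}ᶜ : Set (Fin 2)) ↦ stdSimplex.face.{v} {j.1}ᶜ) ⟨1, by simp⟩
    · rw [stdSimplex.face_singleton_compl, ← yonedaEquiv_map]
      change Subcomplex.ofSimplex (yonedaEquiv (stdSimplex.δ (1 : Fin 2))) = _
      rw [stdSimplex.δ_one_eq_const]; rfl
  · trans stdSimplex.face {(0 : Fin 2)}ᶜ
    · rw [h]
      apply le_antisymm
      · rw [iSup_le_iff]
        rintro ⟨j, hj⟩
        fin_cases j
        · exact le_refl _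
        · simp at hj
      · exact le_iSup (fun j : ({1}ᶜ : Set (Fin 2)) ↦ stdSimplex.face.{v} {j.1}ᶜ) ⟨0, by simp⟩
    · rw [stdSimplex.face_singleton_compl, ← yonedaEquiv_map]
      change Subcomplex.ofSimplex (yonedaEquiv (stdSimplex.δ (0 : Fin 2))) = _
      rw [stdSimplex.δ_zero_eq_const]; rfl

/-! ### Lifting problems for homotopies -/

/-- A map is a trivial Kan fibration if it has the right lifting property with respect to all
monomorphisms. -/
abbrev TrivialFibration {X Y : SSet.{v}} (p : X ⟶ Y) : Prop :=
  (MorphismProperty.monomorphisms SSet.{v}).rlp p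

/-- The lifting problem given by `a` and `b` has a solution. -/
def Solves {K L E X : SSet.{v}} (i : K ⟶ L) (p : E ⟶ X) (a : K ⟶ E) (b : L ⟶ X) : Prop :=
  ∃ c : L ⟶ E, i ≫ c = a ∧ c ≫ p = b

variable {K L E X : SSet.{v}} {i : K ⟶ L} {p : E ⟶ X} 
lemma solves_of_hasLiftingProperty (i : K ⟶ L) (p : E ⟶ X) [HasLiftingProperty i p] {a : K ⟶ E} {b : L ⟶ X} (h : i ≫ b = a ≫ p) : Solves i p a b :=
   have sq : CommSq a i p b := ⟨h.symm⟩
   ⟨sq.lift, sq.fac_left, sq.fac_right⟩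

/-- Transposition along the path space adjunction. It serves for `B` a horn (one end of the homotopy
prescribed) and for `B` the boundary (both ends prescribed). Solvability is assumed only for the
square that arises, since some fibrations below have lifts only over one component. -/
lemma pushoutProduct_lift {B : SSet.{v}} {j : B ⟶ Δ[1]} (sq : (curriedTensor _).PushoutObjObj j i)
    (a : B ⊗ L ⟶ E) (v : K ⟶ pathSpace E) (w : L ⟶ pathSpace X)
    (h₁ : j ▷ K ≫ MonoidalClosed.uncurry v = B ◁ i ≫ a)
    (h₂ : a ≫ p = j ▷ L ≫ MonoidalClosed.uncurry w)
    (h₃ : v ≫ (ihom (Δ[1] : SSet.{v})).map p = i ≫ w)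
    (hs : ∀ β : sq.pt ⟶ E, sq.inl ≫ β = MonoidalClosed.uncurry v → sq.inr ≫ β = a →
      sq.ι ≫ MonoidalClosed.uncurry w = β ≫ p → Solves sq.ι p β (MonoidalClosed.uncurry w)) :
    ∃ c : L ⟶ pathSpace E, j ▷ L ≫ MonoidalClosed.uncurry c = a ∧ i ≫ c = v ∧ 
      c ≫ (ihom (Δ[1] : SSet.{v})).map p = w := by
  have e : Δ[1] ◁ i ≫ MonoidalClosed.uncurry w = MonoidalClosed.uncurry v ≫ p := by
    rw [← MonoidalClosed.uncurry_natural_left, ← h₃, MonoidalClosed.uncurry_natural_right]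
  obtain ⟨c, hc₁, hc₂⟩ := hs (sq.isPushout.desc (MonoidalClosed.uncurry v) a h₁)
    (sq.isPushout.inl_desc _ _ _) (sq.isPushout.inr_desc _ _ _)
    (sq.hom_ext (by
      rw [sq.inl_ι_assoc, sq.isPushout.inl_desc_assoc]
      exact e) (by
      rw [sq.inr_ι_assoc, sq.isPushout.inr_desc_assoc, h₂]
      rfl))
  refine ⟨MonoidalClosed.curry c, ?_, ?_, ?_⟩
  · rw [MonoidalClosed.uncurry_curry]
    have := sq.inr ≫= hc₁
    rw [sq.inr_ι_assoc, sq.isPushout.inr_desc] at this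
    exact this
  · apply MonoidalClosed.uncurry_injective
    rw [MonoidalClosed.uncurry_natural_left, MonoidalClosed.uncurry_curry]
    have := sq.inl ≫= hc₁
    rw [sq.inl_ι_assoc, sq.isPushout.inl_desc] at this
    exact this
  · apply MonoidalClosed.uncurry_injective
    rw [MonoidalClosed.uncurry_natural_right, MonoidalClosed.uncurry_curry, hc₂]

lemma horn_one_ι (k : Fin 2) :
    (Λ[1, k] : (Δ[1] : SSet.{v}).Subcomplex).ι = const (stdSimplex.obj₀Equiv.{v}.symm k) := by
  rw [horn_one_eq_ofSimplex, Subcomplex.ofSimplex_ι]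

lemma vertex_mem_horn_one (k : Fin 2) :
    stdSimplex.obj₀Equiv.{v}.symm k ∈ (Λ[1, k] : (Δ[1] : SSet.{v}).Subcomplex).obj _ := by
  rw [horn_one_eq_ofSimplex]
  exact Subcomplex.mem_ofSimplex_obj _

lemma uncurry_eval (c : L ⟶ pathSpace E) (k : Fin 2) :
    lift (const (stdSimplex.obj₀Equiv.{v}.symm k)) (𝟙 L) ≫ MonoidalClosed.uncurry c =
      c ≫ pathEval E k := by
  rw [← curry_pathEval, MonoidalClosed.curry_uncurry]

/-- Homotopies can be lifted along a Kan fibration, extending a given lift on a subobject and at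
one end. -/
lemma path_lift (k : Fin 2) [Fibration p] [Mono i] (c₀ : L ⟶ E) (v : K ⟶ pathSpace E)
    (w : L ⟶ pathSpace X) (h₁ : v ≫ pathEval E k = i ≫ c₀) (h₂ : w ≫ pathEval X k = c₀ ≫ p)
    (h₃ : v ≫ pathMap p = i ≫ w) :
    ∃ c : L ⟶ pathSpace E, c ≫ pathEval E k = c₀ ∧ i ≫ c = v ∧ c ≫ pathMap p = w := by
  let sq := Functor.PushoutObjObj.ofHasPushout (curriedTensor SSet) Λ[1, k].ι i
  have hι : ∀ {M Y : SSet.{v}} (c : M ⟶ pathSpace Y),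
      Λ[1, k].ι ▷ M ≫ MonoidalClosed.uncurry c = snd _ _ ≫ c ≫ pathEval Y k := by
    intro M Y c
    rw [← uncurry_eval, ← Category.assoc]
    congr 1
    ext1
    · simp [horn_one_ι, comp_const]
    · simp
  have hs : anodyneExtensions sq.ι :=
    anodyneExtensions_pushoutObjObjι' sq (anodyneExtensions.horn_ι k)
  obtain ⟨c, hc₁, hc₂, hc₃⟩ := pushoutProduct_lift sq (snd _ _ ≫ c₀) v w
    (by rw [hι, h₁, whiskerLeft_snd_assoc]) (by rw [hι, h₂, Category.assoc]) h₃
    (fun β _ _ hβ ↦ by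
      have := hs p (by rwa [← HomotopicalAlgebra.fibration_iff])
      exact solves_of_hasLiftingProperty _ _ hβ)
  refine ⟨c, ?_, hc₂, hc₃⟩
  rw [hι] at hc₁
  have h := lift (const (Y := (Λ[1, k] : SSet.{v})) ⟨_, vertex_mem_horn_one k⟩) (𝟙 L) ≫= hc₁
  rw [lift_snd_assoc, lift_snd_assoc, Category.id_comp, Category.id_comp] at h
  exact h

/-- A map to a two-element set that is not surjective is constant. Hence `∂Δ[1] ⊗ L` consists of two
copies of `L`. -/
lemma asOrderHom_boundary_one {n : SimplexCategoryᵒᵖ} (x : (∂Δ[1] : SSet.{v}).obj n)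
    (j : Fin (n.unop.len + 1)) :
    stdSimplex.asOrderHom x.1 j = stdSimplex.asOrderHom x.1 0 := by
  by_contra h
  refine x.2 (fun k ↦ ?_)
  by_cases hk : stdSimplex.asOrderHom x.1 0 = k
  · exact ⟨0, hk⟩
  · exact ⟨j, by omega⟩

/-- The map out of `∂Δ[1] ⊗ L` given by its values on the two copies of `L`. -/
noncomputable def boundaryOneDesc (c₀ c₁ : L ⟶ E) : (∂Δ[1] : SSet.{v}) ⊗ L ⟶ E where
  app n := ↾fun x ↦ if stdSimplex.asOrderHom x.1.1 0 = 0 then c₀.app n x.2 else c₁.app n x.2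
  naturality m n f := by
    ext ⟨x, y⟩
    have h : stdSimplex.asOrderHom ((∂Δ[1] : SSet.{v}).map f x).1 0 =
        stdSimplex.asOrderHom x.1 0 := asOrderHom_boundary_one x _
    change (if stdSimplex.asOrderHom ((∂Δ[1] : SSet.{v}).map f x).1 0 = 0 then
      c₀.app n (L.map f y) else c₁.app n (L.map f y)) =
      E.map f (if stdSimplex.asOrderHom x.1 0 = 0 then c₀.app m y else c₁.app m y)
    rw [h]
    split_ifs
    · exact NatTrans.naturality_apply c₀ f y
    · exact NatTrans.naturality_apply c₁ f y

/-- The inclusion of a copy of `L` in `∂Δ[1] ⊗ L`. -/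
noncomputable def boundaryOneι (L : SSet.{v}) (k : Fin 2) : L ⟶ (∂Δ[1] : SSet.{v}) ⊗ L :=
  lift (const ⟨stdSimplex.obj₀Equiv.{v}.symm k, by
    rw [boundary_obj_eq_univ 0 1]; exact Set.mem_univ _⟩) (𝟙 L)

lemma boundaryOne_hom_ext {f g : (∂Δ[1] : SSet.{v}) ⊗ L ⟶ E}
    (h : ∀ k, boundaryOneι L k ≫ f = boundaryOneι L k ≫ g) : f = g := by
  ext n ⟨x, y⟩
  have hx : (boundaryOneι L (stdSimplex.asOrderHom x.1 0)).app n y = (x, y) := by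
    refine Prod.ext (Subtype.ext (stdSimplex.objEquiv.injective
      (SimplexCategory.Hom.ext _ _ (OrderHom.ext _ _ (funext fun j ↦ ?_))))) rfl
    exact (asOrderHom_boundary_one x j).symm
  rw [← hx]
  exact ConcreteCategory.congr_hom (congr_app (h _) n) y

@[simp]
lemma boundaryOneι_zero_desc (c₀ c₁ : L ⟶ E) :
    boundaryOneι L 0 ≫ boundaryOneDesc c₀ c₁ = c₀ := rfl

@[simp]
lemma boundaryOneι_one_desc (c₀ c₁ : L ⟶ E) :
    boundaryOneι L 1 ≫ boundaryOneDesc c₀ c₁ = c₁ := rfl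

lemma boundaryOneι_uncurry (c : L ⟶ pathSpace E) (k : Fin 2) :
    boundaryOneι L k ≫ ∂Δ[1].ι ▷ L ≫ MonoidalClosed.uncurry c = c ≫ pathEval E k :=
  uncurry_eval c k

lemma path_box (sq : (curriedTensor _).PushoutObjObj ∂Δ[1].ι i) (c₀ c₁ : L ⟶ E)
    (v : K ⟶ pathSpace E) (w : L ⟶ pathSpace X)
    (hv₀ : v ≫ pathEval E 0 = i ≫ c₀) (hv₁ : v ≫ pathEval E 1 = i ≫ c₁)
    (hw₀ : w ≫ pathEval X 0 = c₀ ≫ p) (hw₁ : w ≫ pathEval X 1 = c₁ ≫ p)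
    (h : v ≫ pathMap p = i ≫ w)
    (hs : ∀ β : sq.pt ⟶ E, sq.inl ≫ β = MonoidalClosed.uncurry v →
      sq.inr ≫ β = boundaryOneDesc c₀ c₁ → sq.ι ≫ MonoidalClosed.uncurry w = β ≫ p →
      Solves sq.ι p β (MonoidalClosed.uncurry w)) :
    ∃ c : L ⟶ pathSpace E, c ≫ pathEval E 0 = c₀ ∧ c ≫ pathEval E 1 = c₁ ∧ i ≫ c = v ∧
      c ≫ pathMap p = w := by
  have hi (k : Fin 2) : boundaryOneι K k ≫ (∂Δ[1] : SSet.{v}) ◁ i = i ≫ boundaryOneι L k := rfl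
  obtain ⟨c, hc₁, hc₂, hc₃⟩ := pushoutProduct_lift sq (boundaryOneDesc c₀ c₁) v w
    (boundaryOne_hom_ext (fun k ↦ by
      rw [boundaryOneι_uncurry, reassoc_of% hi]
      fin_cases k
      · simpa using hv₀
      · simpa using hv₁))
    (boundaryOne_hom_ext (fun k ↦ by
      rw [boundaryOneι_uncurry]
      fin_cases k
      · exact hw₀.symm
      · exact hw₁.symm)) h hs
  refine ⟨c, ?_, ?_, hc₂, hc₃⟩
  · rw [← boundaryOneι_uncurry, hc₁, boundaryOneι_zero_desc]
  · rw [← boundaryOneι_uncurry, hc₁, boundaryOneι_one_desc]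

/-- Homotopies can be lifted along a Kan fibration, relatively to both ends and to a subobject
whose inclusion is anodyne. -/
lemma path_box_of_anodyne [Fibration p] (hi : anodyneExtensions i) (c₀ c₁ : L ⟶ E)
    (v : K ⟶ pathSpace E) (w : L ⟶ pathSpace X)
    (hv₀ : v ≫ pathEval E 0 = i ≫ c₀) (hv₁ : v ≫ pathEval E 1 = i ≫ c₁)
    (hw₀ : w ≫ pathEval X 0 = c₀ ≫ p) (hw₁ : w ≫ pathEval X 1 = c₁ ≫ p)
    (h : v ≫ pathMap p = i ≫ w) :
    ∃ c : L ⟶ pathSpace E, c ≫ pathEval E 0 = c₀ ∧ c ≫ pathEval E 1 = c₁ ∧ i ≫ c = v ∧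
      c ≫ pathMap p = w := by
  let sq := Functor.PushoutObjObj.ofHasPushout (curriedTensor SSet) ∂Δ[1].ι i
  exact path_box sq c₀ c₁ v w hv₀ hv₁ hw₀ hw₁ h (fun β _ _ hβ ↦ by
    have := anodyneExtensions_pushoutObjObjι sq hi p (by
      rwa [← HomotopicalAlgebra.fibration_iff])
    exact solves_of_hasLiftingProperty _ _ hβ)

/-- After moving `∂Δ[1]` to the side of `p`, the monomorphism `i` may be replaced by a boundary
inclusion `∂Δ[n]`; its pushout-product with `∂Δ[1]` is the inclusion of a subcomplex of `Δ[1] ⊗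
Δ[n]`, so it is a monomorphism. -/
lemma TrivialFibration.hasLiftingProperty_pushoutProduct (hp : TrivialFibration p) [Mono i]
    (sq : (curriedTensor _).PushoutObjObj ∂Δ[1].ι i) : HasLiftingProperty sq.ι p := by
  let sq' := Functor.PullbackObjObj.ofHasPullback MonoidalClosed.internalHom ∂Δ[1].ι p
  rw [MonoidalClosed.internalHomAdjunction₂.hasLiftingProperty_iff _ sq']
  suffices (MorphismProperty.monomorphisms _).rlp sq'.π from this _ inferInstance
  rw [rlp_monomorphisms]
  rintro _ _ _ ⟨n⟩
  rw [← MonoidalClosed.internalHomAdjunction₂.hasLiftingProperty_iff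
    (Subcomplex.unionProd.pushoutObjObj.{v} _ _),
    Subcomplex.unionProd.pushoutObjObj_ι]
  have : Mono (Subcomplex.unionProd.{v} ∂Δ[1] ∂Δ[n]).ι := inferInstance
  exact hp _ this

/-- Homotopies can be lifted along a trivial Kan fibration, relatively to both ends and to a
subobject. -/
lemma TrivialFibration.path_box (hp : TrivialFibration p) [Mono i] (c₀ c₁ : L ⟶ E)
    (v : K ⟶ pathSpace E) (w : L ⟶ pathSpace X)
    (hv₀ : v ≫ pathEval E 0 = i ≫ c₀) (hv₁ : v ≫ pathEval E 1 = i ≫ c₁)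
    (hw₀ : w ≫ pathEval X 0 = c₀ ≫ p) (hw₁ : w ≫ pathEval X 1 = c₁ ≫ p)
    (h : v ≫ pathMap p = i ≫ w) :
    ∃ c : L ⟶ pathSpace E, c ≫ pathEval E 0 = c₀ ∧ c ≫ pathEval E 1 = c₁ ∧ i ≫ c = v ∧
      c ≫ pathMap p = w := by
  let sq := Functor.PushoutObjObj.ofHasPushout (curriedTensor SSet) ∂Δ[1].ι i
  exact SSet.path_box sq c₀ c₁ v w hv₀ hv₁ hw₀ hw₁ h (fun β _ _ hβ ↦ by
    have := hp.hasLiftingProperty_pushoutProduct sq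
    exact solves_of_hasLiftingProperty _ _ hβ)

lemma TrivialFibration.solves (hp : TrivialFibration p) [Mono i] {a : K ⟶ E} {b : L ⟶ X}
    (h : i ≫ b = a ≫ p) : Solves i p a b := by
  have := hp i inferInstance
  exact solves_of_hasLiftingProperty _ _ h

lemma trivialFibration_of_solves
    (h : ∀ (n : ℕ) (a : (∂Δ[n] : SSet.{v}) ⟶ E) (b : Δ[n] ⟶ X), ∂Δ[n].ι ≫ b = a ≫ p →
      Solves ∂Δ[n].ι p a b) : TrivialFibration p := by
  rw [TrivialFibration, rlp_monomorphisms]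
  rintro _ _ _ ⟨n⟩
  refine ⟨fun {a b} sq ↦ ?_⟩
  obtain ⟨c, hc₁, hc₂⟩ := h n a b sq.w.symm
  exact ⟨⟨c, hc₁, hc₂⟩⟩

/-- Solvability of lifting problems against a Kan fibration is homotopy invariant. -/
lemma Solves.of_path [Fibration p] [Mono i] {k k' : Fin 2} {v : K ⟶ pathSpace E}
    {w : L ⟶ pathSpace X} (h : v ≫ pathMap p = i ≫ w)
    (hs : Solves i p (v ≫ pathEval E k) (w ≫ pathEval X k)) :
    Solves i p (v ≫ pathEval E k') (w ≫ pathEval X k') := by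
  obtain ⟨c, hc₁, hc₂⟩ := hs
  obtain ⟨d, -, hd₂, hd₃⟩ := path_lift k c v w hc₁.symm hc₂.symm h
  exact ⟨d ≫ pathEval E k', by rw [reassoc_of% hd₂], by
    rw [Category.assoc, ← pathMap_eval, reassoc_of% hd₃]⟩

end SSet

/-! ### Relative homotopies and homotopy classes in Kan complexes -/

namespace SSet

open Limits HomotopicalAlgebra modelCategoryQuillen

variable {K L E X Y : SSet.{v}} {i : K ⟶ L} {p : E ⟶ X}

/-- The homotopy extension property, which is `path_lift` over the terminal object. -/
lemma exists_path_extension (k : Fin 2) [KanComplex X] [Mono i] (c₀ : L ⟶ X)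
    (v : K ⟶ pathSpace X) (h : v ≫ pathEval X k = i ≫ c₀) :
    ∃ c : L ⟶ pathSpace X, c ≫ pathEval X k = c₀ ∧ i ≫ c = v := by
  have ht {M : SSet.{v}} (f g : M ⟶ pathSpace (⊤_ SSet.{v})) : f = g := by
    apply MonoidalClosed.uncurry_injective
    subsingleton
  obtain ⟨c, h₁, h₂, -⟩ := path_lift (p := terminal.from X) k c₀ v
    (terminal.from L ≫ pathRefl _) h (by subsingleton) (ht _ _)
  exact ⟨c, h₁, h₂⟩

lemma exists_extension_of_anodyne [KanComplex X] (hi : anodyneExtensions i) (a : K ⟶ X) :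
    ∃ c : L ⟶ X, i ≫ c = a := by
  have := hi (terminal.from X) (by
    rw [← HomotopicalAlgebra.fibration_iff]; infer_instance)
  obtain ⟨c, hc, -⟩ := solves_of_hasLiftingProperty i (terminal.from X) (a := a)
    (b := terminal.from L) (by subsingleton)
  exact ⟨c, hc⟩

/-- The evaluation of paths at an endpoint is a trivial Kan fibration. -/
lemma trivialFibration_pathEval (X : SSet.{v}) [KanComplex X] (k : Fin 2) :
    TrivialFibration (pathEval X k) := by
  intro K L i hi
  have : Mono i := hi
  refine ⟨fun {a b} sq ↦ ?_⟩
  obtain ⟨c, hc₁, hc₂⟩ := exists_path_extension k b a sq.w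
  exact ⟨⟨c, hc₂, hc₁⟩⟩

/-- Homotopy of maps relatively to a subobject. -/
def HomotopicRel (i : K ⟶ L) (f g : L ⟶ X) : Prop :=
  ∃ c : L ⟶ pathSpace X, c ≫ pathEval X 0 = f ∧ c ≫ pathEval X 1 = g ∧
    i ≫ c = i ≫ f ≫ pathRefl X

namespace HomotopicRel

lemma refl (i : K ⟶ L) (f : L ⟶ X) : HomotopicRel i f f :=
  ⟨f ≫ pathRefl X, by simp, by simp, rfl⟩

/-- Two homotopies with the same start are two lifts of `f` along the trivial fibration `pathEval X
0`, so they are joined by a path of paths over the constant homotopy of `f`. Its other end is the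
required homotopy. Symmetry and transitivity both follow from this. -/
lemma euclidean [KanComplex X] [Mono i] {f g h : L ⟶ X} (H : HomotopicRel i f g)
    (H' : HomotopicRel i f h) : HomotopicRel i g h := by
  obtain ⟨c, hc₀, hc₁, hc⟩ := H
  obtain ⟨d, hd₀, hd₁, hd⟩ := H'
  obtain ⟨e, he₀, he₁, he₂, he₃⟩ := (trivialFibration_pathEval X 0).path_box (i := i) c d
    (i ≫ c ≫ pathRefl _) (f ≫ pathRefl _) (by simp) (by simp [hc, hd]) (by simp [hc₀])
    (by simp [hd₀]) (by simp [pathRefl_map, reassoc_of% hc₀])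
  refine ⟨e ≫ pathMap (pathEval X 1), ?_, ?_, ?_⟩
  · rw [Category.assoc, pathMap_eval, reassoc_of% he₀, hc₁]
  · rw [Category.assoc, pathMap_eval, reassoc_of% he₁, hd₁]
  · rw [reassoc_of% he₂, pathRefl_map, reassoc_of% hc₁]

lemma symm [KanComplex X] [Mono i] {f g : L ⟶ X} (H : HomotopicRel i f g) :
    HomotopicRel i g f := H.euclidean (refl i f)

lemma trans [KanComplex X] [Mono i] {f g h : L ⟶ X} (H : HomotopicRel i f g)
    (H' : HomotopicRel i g h) : HomotopicRel i f h := H.symm.euclidean H'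

lemma comp {f g : L ⟶ X} (H : HomotopicRel i f g) (q : X ⟶ Y) :
    HomotopicRel i (f ≫ q) (g ≫ q) := by
  obtain ⟨c, hc₀, hc₁, hc⟩ := H
  refine ⟨c ≫ pathMap q, ?_, ?_, ?_⟩
  · rw [Category.assoc, pathMap_eval, reassoc_of% hc₀]
  · rw [Category.assoc, pathMap_eval, reassoc_of% hc₁]
  · rw [reassoc_of% hc, pathRefl_map, Category.assoc]

end HomotopicRel

@[simp]
lemma const_app_zero (x : X _⦋0⦌) (y : K _⦋0⦌) : (const x : K ⟶ X).app _ y = x := by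
  change X.map _ x = x
  rw [show (SimplexCategory.const ⦋0⦌ ⦋0⦌ 0) = 𝟙 _ from by subsingleton, op_id]
  exact X.map_id_apply _ x

lemma eq_const_of_zero (f : (Δ[0] : SSet.{v}) ⟶ X) :
    f = const (f.app _ (stdSimplex.obj₀Equiv.symm 0)) := by
  rw [← const_comp, show (const (stdSimplex.obj₀Equiv.symm 0) : (Δ[0] : SSet.{v}) ⟶ _) = 𝟙 _ from
    stdSimplex.ext₀, Category.id_comp]

lemma const_injective {x y : X _⦋0⦌} (h : (const x : (Δ[0] : SSet.{v}) ⟶ X) = const y) :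
    x = y := by
  simpa using ConcreteCategory.congr_hom (congr_app h _) (stdSimplex.obj₀Equiv.symm 0)

/-- A vertex of the path space defines an edge between the endpoints. -/
lemma nonempty_edge_of_path (γ : pathSpace X _⦋0⦌) :
    Nonempty (Edge ((pathEval X 0).app _ γ) ((pathEval X 1).app _ γ)) := by
  let φ : Δ[1] ⟶ X := lift (𝟙 _) (const γ) ≫ (ihom.ev (Δ[1] : SSet.{v})).app X
  have h (k : Fin 2) : (const (stdSimplex.obj₀Equiv.{v}.symm k) : Δ[0] ⟶ Δ[1]) ≫ φ =
      const ((pathEval X k).app _ γ) := by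
    rw [← const_comp, pathEval, ← Category.assoc, ← Category.assoc]
    congr 1
  refine ⟨.mk (SSet.yonedaEquiv φ) ?_ ?_⟩
  · rw [← stdSimplex.yonedaEquiv_δ_comp, stdSimplex.δ_one_eq_const, h]
    exact const_app_zero (K := Δ[0]) _ (stdSimplex.obj₀Equiv.symm 0)
  · rw [← stdSimplex.yonedaEquiv_δ_comp, stdSimplex.δ_zero_eq_const, h]
    exact const_app_zero (K := Δ[0]) _ (stdSimplex.obj₀Equiv.symm 0)

lemma exists_path_of_edge {x y : X _⦋0⦌} (e : Edge x y) :
    ∃ γ : pathSpace X _⦋0⦌, (pathEval X 0).app _ γ = x ∧ (pathEval X 1).app _ γ = y := by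
  let c : (Δ[0] : SSet.{v}) ⟶ pathSpace X :=
    MonoidalClosed.curry (fst _ _ ≫ SSet.yonedaEquiv.symm e.edge)
  refine ⟨c.app _ (stdSimplex.obj₀Equiv.symm 0), ?_, ?_⟩
  · change (c ≫ pathEval X 0).app _ _ = _
    rw [curry_pathEval, lift_fst_assoc, (const_comp_edge e _).1, const_app_zero]
  · change (c ≫ pathEval X 1).app _ _ = _
    rw [curry_pathEval, lift_fst_assoc, (const_comp_edge e _).2, const_app_zero]

lemma homotopicRel_const_iff {x y : X _⦋0⦌} :
    HomotopicRel ∂Δ[0].ι (const x : Δ[0] ⟶ X) (const y) ↔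
      ∃ γ : pathSpace X _⦋0⦌, (pathEval X 0).app _ γ = x ∧ (pathEval X 1).app _ γ = y := by
  constructor
  · rintro ⟨c, h₀, h₁, -⟩
    rw [eq_const_of_zero c, const_comp] at h₀ h₁
    exact ⟨_, const_injective h₀, const_injective h₁⟩
  · rintro ⟨γ, rfl, rfl⟩
    exact ⟨const γ, by simp, by simp, boundary.hom_ext₀⟩

/-- `π₀` is the quotient by the relation generated by edges; in a Kan complex being joined by a path
is already an equivalence relation. -/
lemma π₀_mk_eq_iff [KanComplex X] {x y : X _⦋0⦌} :
    π₀.mk x = π₀.mk y ↔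
      ∃ γ : pathSpace X _⦋0⦌, (pathEval X 0).app _ γ = x ∧ (pathEval X 1).app _ γ = y := by
  constructor
  · intro h
    rw [← homotopicRel_const_iff]
    rw [π₀.mk_eq_mk_iff] at h
    induction h with
    | rel _ _ h => exact homotopicRel_const_iff.2 (exists_path_of_edge h.some)
    | refl x => exact .refl _ _
    | symm _ _ _ h => exact h.symm
    | trans _ _ _ _ _ h h' => exact h.trans h'
  · rintro ⟨γ, rfl, rfl⟩
    exact π₀.sound (nonempty_edge_of_path γ).some

lemma homotopyClass_eq_iff [KanComplex X] {A : L.Subcomplex} {x : X _⦋0⦌}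
    {φ : (A : SSet.{v}) ⟶ (Subcomplex.ofSimplex x : SSet.{v})}
    {s t : RelativeMorphism A (Subcomplex.ofSimplex x) φ} :
    s.homotopyClass = t.homotopyClass ↔ HomotopicRel A.ι s.map t.map := by
  constructor
  · intro h
    replace h : Relation.EqvGen _ s t := Quot.eqvGen_exact h
    induction h with
    | rel s t h =>
      obtain ⟨h⟩ := h
      -- The braiding accounts for the interval being the right factor in
      -- `RelativeMorphism.Homotopy` and the left factor for path spaces.
      refine ⟨MonoidalClosed.curry ((β_ _ _).hom ≫ h.h), ?_, ?_, ?_⟩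
      · rw [curry_pathEval]
        exact h.h₀
      · rw [curry_pathEval]
        exact h.h₁
      · apply MonoidalClosed.uncurry_injective
        rw [MonoidalClosed.uncurry_natural_left, MonoidalClosed.uncurry_curry,
          MonoidalClosed.uncurry_natural_left, MonoidalClosed.uncurry_natural_left, pathRefl,
          MonoidalClosed.uncurry_curry, whiskerLeft_snd, whiskerLeft_snd_assoc, s.comm]
        have := (β_ (Δ[1] : SSet.{v}) (A : SSet.{v})).hom ≫= h.rel
        exact this
    | refl x => exact .refl _ _
    | symm _ _ _ h => exact h.symm
    | trans _ _ _ _ _ h h' => exact h.trans h'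
  · rintro ⟨c, h₀, h₁, h⟩
    refine RelativeMorphism.Homotopy.eq
      { h := (β_ _ _).hom ≫ MonoidalClosed.uncurry c
        h₀ := ?_
        h₁ := ?_
        rel := ?_ }
    · exact (uncurry_eval c 0).trans h₀
    · exact (uncurry_eval c 1).trans h₁
    · have := (β_ (A : SSet.{v}) (Δ[1] : SSet.{v})).hom ≫= congr_arg MonoidalClosed.uncurry h
      rw [MonoidalClosed.uncurry_natural_left, MonoidalClosed.uncurry_natural_left,
        MonoidalClosed.uncurry_natural_left, pathRefl, MonoidalClosed.uncurry_curry,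
        whiskerLeft_snd, whiskerLeft_snd_assoc, s.comm] at this
      exact this

end SSet

/-! ### Weak equivalences of Kan complexes -/

namespace SSet

open Limits HomotopicalAlgebra modelCategoryQuillen

variable {K L E X Y Z : SSet.{v}} {i : K ⟶ L} {p : E ⟶ X}

/-- Surjectivity of `π_n (X, x) → π_n (Y, f x)`. -/
def PiSurjective (f : X ⟶ Y) (n : ℕ) (x : X _⦋0⦌) : Prop :=
  ∀ β : Δ[n] ⟶ Y, ∂Δ[n].ι ≫ β = const (f.app _ x) →
    ∃ σ : Δ[n] ⟶ X, ∂Δ[n].ι ≫ σ = const x ∧ HomotopicRel ∂Δ[n].ι (σ ≫ f) β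

/-- Injectivity of `π_n (X, x) → π_n (Y, f x)`. -/
def PiInjective (f : X ⟶ Y) (n : ℕ) (x : X _⦋0⦌) : Prop :=
  ∀ σ τ : Δ[n] ⟶ X, ∂Δ[n].ι ≫ σ = const x → ∂Δ[n].ι ≫ τ = const x →
    HomotopicRel ∂Δ[n].ι (σ ≫ f) (τ ≫ f) → HomotopicRel ∂Δ[n].ι σ τ

lemma const_comp_ofSimplex_ι (K : SSet.{v}) (x : X _⦋0⦌) :
    (const ⟨x, Subcomplex.mem_ofSimplex_obj x⟩ : K ⟶ (Subcomplex.ofSimplex x : SSet.{v})) ≫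
      (Subcomplex.ofSimplex x).ι = const x := by
  exact const_comp _ _

lemma bijective_mapHomotopyClass_iff [KanComplex X] [KanComplex Y] (f : X ⟶ Y) (n : ℕ)
    (x : X _⦋0⦌) :
    Function.Bijective (mapHomotopyClass f n x) ↔ PiSurjective f n x ∧ PiInjective f n x := by
  have mk {Z : SSet.{v}} (z : Z _⦋0⦌) (σ : Δ[n] ⟶ Z) (hσ : ∂Δ[n].ι ≫ σ = const z) :
      ∃ s : Z.PtSimplex n z, s.map = σ := ⟨⟨σ, by rw [hσ, const_comp_ofSimplex_ι]⟩, rfl⟩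
  have mk' {Z : SSet.{v}} {z : Z _⦋0⦌} (s : Z.PtSimplex n z) : ∂Δ[n].ι ≫ s.map = const z := by
    rw [s.comm, const_comp_ofSimplex_ι]
  constructor
  · rintro ⟨h₁, h₂⟩
    refine ⟨fun β hβ ↦ ?_, fun σ τ hσ hτ h ↦ ?_⟩
    · obtain ⟨b, rfl⟩ := mk _ β hβ
      obtain ⟨s, hs⟩ := h₂ b.homotopyClass
      obtain ⟨s, rfl⟩ := s.eq_homotopyClass
      exact ⟨s.map, mk' s, homotopyClass_eq_iff.1 hs⟩
    · obtain ⟨s, rfl⟩ := mk _ σ hσ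
      obtain ⟨t, rfl⟩ := mk _ τ hτ
      exact homotopyClass_eq_iff.1 (h₁ (homotopyClass_eq_iff.2 h))
  · rintro ⟨h₁, h₂⟩
    refine ⟨fun s t h ↦ ?_, fun b ↦ ?_⟩
    · obtain ⟨s, rfl⟩ := s.eq_homotopyClass
      obtain ⟨t, rfl⟩ := t.eq_homotopyClass
      exact homotopyClass_eq_iff.2 (h₂ _ _ (mk' s) (mk' t) (homotopyClass_eq_iff.1 h))
    · obtain ⟨b, rfl⟩ := b.eq_homotopyClass
      obtain ⟨σ, hσ, h⟩ := h₁ b.map (mk' b)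
      obtain ⟨s, rfl⟩ := mk _ σ hσ
      exact ⟨s.homotopyClass, homotopyClass_eq_iff.2 h⟩

lemma isWeakEquivalence_iff [KanComplex X] [KanComplex Y] (f : X ⟶ Y) :
    IsWeakEquivalence f ↔ Function.Bijective (mapπ₀ f) ∧
      ∀ n x, PiSurjective f (n + 1) x ∧ PiInjective f (n + 1) x := by
  simp only [← bijective_mapHomotopyClass_iff]
  exact ⟨fun h ↦ ⟨h.1, h.2⟩, fun h ↦ ⟨h.1, h.2⟩⟩

/-- The boundary of `Δ[0]` is empty, so the base point plays no role in degree zero. -/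
lemma piInjective_zero [KanComplex X] [KanComplex Y] {f : X ⟶ Y}
    (hf : Function.Injective (mapπ₀ f)) (x : X _⦋0⦌) : PiInjective f 0 x := by
  intro σ τ _ _ h
  rw [eq_const_of_zero σ, eq_const_of_zero τ] at h ⊢
  rw [const_comp, const_comp, homotopicRel_const_iff, ← π₀_mk_eq_iff] at h
  rw [homotopicRel_const_iff, ← π₀_mk_eq_iff]
  exact hf h

lemma mapπ₀_comp (f : X ⟶ Y) (g : Y ⟶ Z) : mapπ₀ (f ≫ g) = mapπ₀ g ∘ mapπ₀ f :=
  funext (mapπ₀_comp_apply f g)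

namespace IsWeakEquivalence

lemma id (X : SSet.{v}) [KanComplex X] : IsWeakEquivalence (𝟙 X) := by
  rw [isWeakEquivalence_iff]
  refine ⟨?_, fun n x ↦ ⟨fun β hβ ↦ ⟨β, hβ, ?_⟩, fun σ τ _ _ h ↦ ?_⟩⟩
  · convert Function.bijective_id
    ext x
    simp
  · rw [Category.comp_id]
    exact .refl _ _
  · simpa using h

lemma comp [KanComplex X] [KanComplex Y] [KanComplex Z] {f : X ⟶ Y} {g : Y ⟶ Z}
    (hf : IsWeakEquivalence f) (hg : IsWeakEquivalence g) : IsWeakEquivalence (f ≫ g) := by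
  rw [isWeakEquivalence_iff] at hf hg ⊢
  refine ⟨?_, fun n x ↦ ⟨fun β hβ ↦ ?_, fun σ τ hσ hτ h ↦ ?_⟩⟩
  · rw [mapπ₀_comp]
    exact hg.1.comp hf.1
  · obtain ⟨ρ, hρ, h⟩ := (hg.2 n (f.app _ x)).1 β hβ
    obtain ⟨σ, hσ, h'⟩ := (hf.2 n x).1 ρ hρ
    exact ⟨σ, hσ, by simpa using (h'.comp g).trans h⟩
  · refine (hf.2 n x).2 _ _ hσ hτ ((hg.2 n (f.app _ x)).2 _ _ ?_ ?_ (by simpa using h))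
    · rw [reassoc_of% hσ, const_comp]
    · rw [reassoc_of% hτ, const_comp]

/-- This case of two-out-of-three involves `g` only at base points in the image of `f`, so no change
of base point is needed. -/
lemma of_comp_right [KanComplex X] [KanComplex Y] [KanComplex Z] {f : X ⟶ Y} {g : Y ⟶ Z}
    (hg : IsWeakEquivalence g) (hfg : IsWeakEquivalence (f ≫ g)) : IsWeakEquivalence f := by
  rw [isWeakEquivalence_iff] at hfg hg ⊢
  refine ⟨?_, fun n x ↦ ⟨fun β hβ ↦ ?_, fun σ τ hσ hτ h ↦ ?_⟩⟩
  · have := hfg.1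
    rw [mapπ₀_comp] at this
    exact (Function.Bijective.of_comp_iff' hg.1 _).1 this
  · obtain ⟨σ, hσ, h⟩ := (hfg.2 n x).1 (β ≫ g) (by rw [reassoc_of% hβ, const_comp]; rfl)
    refine ⟨σ, hσ, (hg.2 n (f.app _ x)).2 _ _ ?_ hβ (by simpa using h)⟩
    rw [reassoc_of% hσ, const_comp]
  · exact (hfg.2 n x).2 _ _ hσ hτ (by simpa using h.comp g)

end IsWeakEquivalence

/-- Maps which lift extensions up to homotopy. -/
def IsRelativeEquivalence (f : X ⟶ Y) : Prop :=
  ∀ ⦃K L : SSet.{v}⦄ (i : K ⟶ L) [Mono i] (a : K ⟶ X) (b : L ⟶ Y), i ≫ b = a ≫ f →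
    ∃ c : L ⟶ X, i ≫ c = a ∧ HomotopicRel i (c ≫ f) b

lemma TrivialFibration.isRelativeEquivalence {f : X ⟶ Y} (hf : TrivialFibration f) :
    IsRelativeEquivalence f := by
  intro K L i _ a b h
  obtain ⟨c, h₁, rfl⟩ := hf.solves h
  exact ⟨c, h₁, .refl _ _⟩

/-- A relative homotopy in `Y` is an extension problem along the pushout-product of `∂Δ[1]` and
`∂Δ[n]`. The lift to `X` is strict on that subobject, which contains all the prescribed data; its
agreement with `w` up to homotopy is not needed. -/
lemma IsRelativeEquivalence.piInjective {f : X ⟶ Y} (hf : IsRelativeEquivalence f) (n : ℕ)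
    (x : X _⦋0⦌) : PiInjective f n x := by
  rintro σ τ hσ hτ ⟨w, hw₀, hw₁, hw⟩
  let sq := Subcomplex.unionProd.pushoutObjObj.{v} ∂Δ[1] ∂Δ[n]
  have ht {M : SSet.{v}} (f g : M ⟶ pathSpace (⊤_ SSet.{v})) : f = g := by
    apply MonoidalClosed.uncurry_injective
    subsingleton
  obtain ⟨c, h₀, h₁, h, -⟩ := path_box (p := terminal.from X) sq σ τ
    (const x ≫ pathRefl X) (terminal.from _ ≫ pathRefl _) 
    (by rw [Category.assoc, pathRefl_eval, Category.comp_id, hσ])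
    (by rw [Category.assoc, pathRefl_eval, Category.comp_id, hτ])
    (by subsingleton) (by subsingleton) (ht _ _) (fun β hβ₁ hβ₂ _ ↦ by
      have : Mono sq.ι := (inferInstance : Mono (Subcomplex.unionProd.{v} ∂Δ[1] ∂Δ[n]).ι)
      obtain ⟨c, hc, -⟩ := hf sq.ι β (MonoidalClosed.uncurry w) (sq.hom_ext (by
        rw [sq.inl_ι_assoc, reassoc_of% hβ₁, ← MonoidalClosed.uncurry_natural_right,
          Category.assoc, pathRefl_map, ← reassoc_of% hσ]
        rw [Category.assoc] at hw
        rw [← hw, MonoidalClosed.uncurry_natural_left]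
        rfl) (by
        rw [sq.inr_ι_assoc, reassoc_of% hβ₂]
        refine boundaryOne_hom_ext (fun k ↦ ?_)
        refine (boundaryOneι_uncurry w k).trans ?_
        fin_cases k
        · exact hw₀
        · exact hw₁))
      exact ⟨c, hc, by subsingleton⟩)
  exact ⟨c, h₀, h₁, by rw [h, reassoc_of% hσ]⟩

lemma IsRelativeEquivalence.isWeakEquivalence [KanComplex X] [KanComplex Y] {f : X ⟶ Y}
    (hf : IsRelativeEquivalence f) : IsWeakEquivalence f := by
  rw [isWeakEquivalence_iff]
  refine ⟨⟨fun x x' h ↦ ?_, fun y ↦ ?_⟩, fun n x ↦ ⟨fun β hβ ↦ ?_, hf.piInjective _ _⟩⟩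
  · induction x with | mk x =>
    induction x' with | mk x' =>
    rw [mapπ₀_mk, mapπ₀_mk, π₀_mk_eq_iff, ← homotopicRel_const_iff] at h
    rw [π₀_mk_eq_iff, ← homotopicRel_const_iff]
    exact hf.piInjective 0 x _ _ boundary.hom_ext₀ boundary.hom_ext₀ (by simpa using h)
  · induction y with | mk y =>
    obtain ⟨c, -, hc⟩ := hf (initial.to (Δ[0] : SSet.{v})) (initial.to _) (const y) (by subsingleton)
    obtain ⟨d, h₀, h₁, -⟩ := hc
    rw [eq_const_of_zero c, eq_const_of_zero d, const_comp, const_comp] at h₀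
    rw [eq_const_of_zero d, const_comp] at h₁
    exact ⟨π₀.mk _, π₀_mk_eq_iff.2 ⟨_, const_injective h₀, const_injective h₁⟩⟩
  · exact hf ∂Δ[n + 1].ι (const x) β (by rw [hβ, const_comp])

lemma TrivialFibration.isWeakEquivalence [KanComplex X] [KanComplex Y] {f : X ⟶ Y}
    (hf : TrivialFibration f) : IsWeakEquivalence f :=
  hf.isRelativeEquivalence.isWeakEquivalence

lemma isWeakEquivalence_of_section [KanComplex X] [KanComplex Y] {s : X ⟶ Y} {r : Y ⟶ X}
    (hr : TrivialFibration r) (h : s ≫ r = 𝟙 X) : IsWeakEquivalence s :=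
  hr.isWeakEquivalence.of_comp_right (h ▸ .id X)

end SSet

namespace SSet

open Limits HomotopicalAlgebra modelCategoryQuillen

variable {K L E X Y Z : SSet.{v}} {i : K ⟶ L} {p : E ⟶ X}

/-! ### Contractions -/

/-- The simplicial set `L` contracts to the vertex `ℓ`. -/
def ContractsTo (L : SSet.{v}) (ℓ : L _⦋0⦌) : Prop :=
  ∃ G : L ⟶ pathSpace L, G ≫ pathEval L 0 = const ℓ ∧ G ≫ pathEval L 1 = 𝟙 L

/-- The contraction of the simplex `Δ[n]` to its first vertex. -/
noncomputable def stdSimplexContraction (n : ℕ) : (Δ[1] : SSet.{v}) ⊗ Δ[n] ⟶ Δ[n] where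
  app m := ↾fun x ↦ stdSimplex.objEquiv.symm (SimplexCategory.Hom.mk
    { toFun := fun j ↦ if stdSimplex.asOrderHom x.1 j = 0 then 0 else stdSimplex.asOrderHom x.2 j
      monotone' := fun j j' h ↦ by
        have h₁ := (stdSimplex.asOrderHom x.1).monotone h
        have h₂ := (stdSimplex.asOrderHom x.2).monotone h
        dsimp only
        split_ifs with h₃ h₄
        · exact le_refl _
        · exact Fin.zero_le _
        · rename_i h₄
          rw [h₄] at h₁
          exact (h₃ (Fin.le_zero_iff.1 h₁)).elim
        · exact h₂ })
  naturality m m' f := rfl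

lemma contractsTo_stdSimplex (n : ℕ) :
    ContractsTo (Δ[n] : SSet.{v}) (stdSimplex.obj₀Equiv.symm 0) := by
  refine ⟨MonoidalClosed.curry (stdSimplexContraction n), ?_, ?_⟩ <;> rw [curry_pathEval]
  · rfl
  · ext m x
    refine stdSimplex.objEquiv.injective
      (SimplexCategory.Hom.ext _ _ (OrderHom.ext _ _ (funext fun j ↦ ?_)))
    change (if (1 : Fin 2) = 0 then (0 : Fin (n + 1)) else stdSimplex.asOrderHom x j) = _
    rw [if_neg one_ne_zero]
    rfl

/-- The map to the path space of a product given by its components. -/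
noncomputable def pathLift (f : K ⟶ pathSpace X) (g : K ⟶ pathSpace Y) : K ⟶ pathSpace (X ⊗ Y) :=
  MonoidalClosed.curry (lift (MonoidalClosed.uncurry f) (MonoidalClosed.uncurry g))

lemma pathLift_eval (f : K ⟶ pathSpace X) (g : K ⟶ pathSpace Y) (k : Fin 2) :
    pathLift f g ≫ pathEval _ k = lift (f ≫ pathEval X k) (g ≫ pathEval Y k) := by
  rw [pathLift, curry_pathEval, comp_lift, uncurry_eval, uncurry_eval]

lemma pathLift_map_fst (f : K ⟶ pathSpace X) (g : K ⟶ pathSpace Y) :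
    pathLift f g ≫ pathMap (fst X Y) = f := by
  rw [pathLift, ← MonoidalClosed.curry_natural_right, lift_fst, MonoidalClosed.curry_uncurry]

lemma pathLift_map_snd (f : K ⟶ pathSpace X) (g : K ⟶ pathSpace Y) :
    pathLift f g ≫ pathMap (snd X Y) = g := by
  rw [pathLift, ← MonoidalClosed.curry_natural_right, lift_snd, MonoidalClosed.curry_uncurry]

lemma path_tensor_hom_ext {f g : K ⟶ pathSpace (X ⊗ Y)}
    (h₁ : f ≫ pathMap (fst X Y) = g ≫ pathMap (fst X Y))
    (h₂ : f ≫ pathMap (snd X Y) = g ≫ pathMap (snd X Y)) : f = g := by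
  apply MonoidalClosed.uncurry_injective
  ext1
  · rw [← MonoidalClosed.uncurry_natural_right, h₁, MonoidalClosed.uncurry_natural_right]
  · rw [← MonoidalClosed.uncurry_natural_right, h₂, MonoidalClosed.uncurry_natural_right]

lemma ContractsTo.tensor {ℓ : L _⦋0⦌} {k : K _⦋0⦌} (hL : ContractsTo L ℓ)
    (hK : ContractsTo K k) : ContractsTo (L ⊗ K) (ℓ, k) := by
  obtain ⟨G, h₀, h₁⟩ := hL
  obtain ⟨H, h₂, h₃⟩ := hK
  refine ⟨pathLift (fst _ _ ≫ G) (snd _ _ ≫ H), ?_, ?_⟩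
  · rw [pathLift_eval, Category.assoc, Category.assoc, h₀, h₂, comp_const, comp_const]
    rfl
  · rw [pathLift_eval, Category.assoc, Category.assoc, h₁, h₃, Category.comp_id,
      Category.comp_id, lift_fst_snd]

/-! ### Gluing along the first face of a simplex -/

/-- The first face misses exactly the vertex `0`, so its simplices together with `0` cover all
vertices iff they cover those of the face. -/
lemma δ_zero_mem_horn_iff {n : ℕ} {m : SimplexCategoryᵒᵖ} (y : (Δ[n] : SSet.{v}).obj m) :
    (stdSimplex.δ 0).app m y ∈ (horn.{v} (n + 1) 0).obj m ↔ y ∈ (boundary.{v} n).obj m := by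
  have h : (stdSimplex.asOrderHom ((stdSimplex.δ 0).app m y) : _ → _) =
    Fin.succ ∘ stdSimplex.asOrderHom y := rfl
  rw [mem_horn_iff, h, Set.range_comp]
  change _ ↔ ¬ Function.Surjective (stdSimplex.asOrderHom y)
  rw [not_iff_not, ← Set.range_eq_univ]
  constructor
  · intro h
    rw [Set.eq_univ_iff_forall] at h ⊢
    intro j
    obtain ⟨j', hj', e⟩ | h' := h j.succ
    · rwa [← Fin.succ_injective _ e]
    · exact (Fin.succ_ne_zero _ h').elim
  · intro h
    rw [h, Set.image_univ, Fin.range_succ]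
    exact Set.compl_union_self _

lemma horn_le_boundary (n : ℕ) (i : Fin (n + 1)) : horn.{v} n i ≤ boundary.{v} n := by
  intro m x hx h
  exact hx (by rw [Function.Surjective.range_eq h, Set.univ_union])

/-- The inclusion of a horn in the boundary. -/
noncomputable def hornToBoundary (n : ℕ) (i : Fin (n + 1)) :
    (Λ[n, i] : SSet.{v}) ⟶ (∂Δ[n] : SSet.{v}) :=
  Subcomplex.homOfLE (horn_le_boundary n i)

instance (n : ℕ) (i : Fin (n + 1)) : Mono (hornToBoundary.{v} n i) := by
  dsimp [hornToBoundary]; infer_instance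

@[simp]
lemma hornToBoundary_ι (n : ℕ) (i : Fin (n + 1)) :
    hornToBoundary n i ≫ ∂Δ[n].ι = (Λ[n, i] : (Δ[n] : SSet.{v}).Subcomplex).ι := rfl

/-- The inclusion of the boundary of the first face in the opposite horn. -/
noncomputable def boundaryToHorn (n : ℕ) :
    (∂Δ[n] : SSet.{v}) ⟶ (Λ[n + 1, 0] : SSet.{v}) :=
  Subcomplex.lift (∂Δ[n].ι ≫ stdSimplex.δ 0) (by
    rintro m _ ⟨y, rfl⟩
    exact (δ_zero_mem_horn_iff _).2 y.2)

lemma boundaryToHorn_comp (n : ℕ) : boundaryToHorn.{v} n ≫ hornToBoundary (n + 1) 0 =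
    ∂Δ[n].ι ≫ boundary.ι 0 := rfl

lemma boundary_hom_ext_horn {n : ℕ} {f g : (∂Δ[n + 1] : SSet.{v}) ⟶ X}
    (h : hornToBoundary _ 0 ≫ f = hornToBoundary _ 0 ≫ g)
    (h' : boundary.ι 0 ≫ f = boundary.ι 0 ≫ g) : f = g := by
  refine boundary.hom_ext (fun j ↦ ?_)
  by_cases hj : j = 0
  · rw [hj, h']
  · have : boundary.ι j = horn.ι.{v} 0 j hj ≫ hornToBoundary _ _ := by
      rw [← cancel_mono ∂Δ[n + 1].ι, Category.assoc, hornToBoundary_ι, horn.ι_ι, boundary.ι_ι]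
    rw [this, Category.assoc, h, Category.assoc]

/-- The boundary is the union of the horn and the face opposite to `0`, glued along the boundary of
that face. -/
lemma exists_boundary_hom {n : ℕ} (a : (Λ[n + 1, 0] : SSet.{v}) ⟶ X) (c : Δ[n] ⟶ X)
    (h : boundaryToHorn n ≫ a = ∂Δ[n].ι ≫ c) :
    ∃ f : (∂Δ[n + 1] : SSet.{v}) ⟶ X, hornToBoundary _ 0 ≫ f = a ∧ boundary.ι 0 ≫ f = c := by
  have sq : Subcomplex.BicartSq (horn.{v} (n + 1) 0 ⊓ stdSimplex.face {0}ᶜ) (horn (n + 1) 0)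
      (stdSimplex.face {0}ᶜ) (boundary (n + 1)) := ⟨by
    refine le_antisymm (sup_le (horn_le_boundary _ _) (face_singleton_compl_le_boundary _)) ?_
    rw [boundary_eq_iSup, iSup_le_iff]
    intro j
    by_cases hj : j = 0
    · rw [hj]
      exact le_sup_right
    · exact (face_le_horn _ _ hj).trans le_sup_left, rfl⟩
  let e := stdSimplex.faceSingletonComplIso.{v} (0 : Fin (n + 2))
  have he : Subcomplex.homOfLE sq.le₁₂ ≫ a = Subcomplex.homOfLE sq.le₁₃ ≫ e.inv ≫ c := by
    ext m ⟨x, hx⟩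
    obtain ⟨y, hy⟩ : ∃ y, e.hom.app m y = ⟨x, hx.2⟩ :=
      ⟨e.inv.app m ⟨x, hx.2⟩, ConcreteCategory.congr_hom (congr_app e.inv_hom_id m) _⟩
    have hy' : (stdSimplex.δ 0).app m y = x := congr_arg Subtype.val hy
    have hy₁ : y ∈ (boundary.{v} n).obj m := by
      rw [← δ_zero_mem_horn_iff, hy']
      exact hx.1
    trans a.app m ((boundaryToHorn n).app m ⟨y, hy₁⟩)
    · exact congr_arg (a.app m) (Subtype.ext hy'.symm :
        (⟨x, hx.1⟩ : (Λ[n + 1, 0] : SSet.{v}).obj m) = (boundaryToHorn n).app m ⟨y, hy₁⟩)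
    · refine (ConcreteCategory.congr_hom (congr_app h m) ⟨y, hy₁⟩).trans ?_
      change c.app m y = c.app m (e.inv.app m ⟨x, hx.2⟩)
      rw [← hy]
      congr 1
      exact (ConcreteCategory.congr_hom (congr_app e.hom_inv_id m) _).symm
  refine ⟨sq.isPushout.desc a (e.inv ≫ c) he, sq.isPushout.inl_desc _ _ _, ?_⟩
  have : boundary.ι 0 = e.hom ≫ Subcomplex.homOfLE sq.le₃₄ := rfl
  rw [this, Category.assoc, sq.isPushout.inr_desc, Iso.hom_inv_id_assoc]

/-- Changing the first face of a lifting problem by a fiberwise homotopy. -/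
lemma Solves.of_face_homotopy [Fibration p] {n : ℕ} {k k' : Fin 2}
    {a a' : (∂Δ[n + 1] : SSet.{v}) ⟶ E} {b : Δ[n + 1] ⟶ X} (α : Δ[n] ⟶ pathSpace E)
    (ha : hornToBoundary _ 0 ≫ a = hornToBoundary _ 0 ≫ a')
    (hb : ∂Δ[n + 1].ι ≫ b = a ≫ p)
    (hα : α ≫ pathEval E k = boundary.ι 0 ≫ a) (hα' : α ≫ pathEval E k' = boundary.ι 0 ≫ a')
    (h₁ : ∂Δ[n].ι ≫ α = ∂Δ[n].ι ≫ boundary.ι 0 ≫ a ≫ pathRefl E)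
    (h₂ : α ≫ pathMap p = stdSimplex.δ 0 ≫ b ≫ pathRefl X)
    (hs : Solves ∂Δ[n + 1].ι p a b) : Solves ∂Δ[n + 1].ι p a' b := by
  -- The homotopy `α` on the first face and the constant homotopy on the horn glue to a homotopy
  -- from `a` to `a'` over the constant homotopy of `b`.
  obtain ⟨v, hv₁, hv₂⟩ := exists_boundary_hom (hornToBoundary _ 0 ≫ a ≫ pathRefl E) α (by
    rw [h₁, ← Category.assoc, boundaryToHorn_comp, Category.assoc])
  have h₃ : v ≫ pathEval E k = a := boundary_hom_ext_horn
    (by rw [reassoc_of% hv₁, pathRefl_eval, Category.comp_id]) (by rw [reassoc_of% hv₂, hα])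
  have h₄ : v ≫ pathEval E k' = a' := boundary_hom_ext_horn
    (by rw [reassoc_of% hv₁, pathRefl_eval, Category.comp_id, ha]) (by rw [reassoc_of% hv₂, hα'])
  have h₅ (k : Fin 2) : (b ≫ pathRefl X) ≫ pathEval X k = b := by simp
  rw [← h₄, ← h₅ k']
  refine Solves.of_path (k := k) (boundary_hom_ext_horn ?_ ?_) (by rwa [h₃, h₅])
  · rw [reassoc_of% hv₁, pathRefl_map, ← reassoc_of% hb]
  · rw [reassoc_of% hv₂, h₂, boundary.ι_ι_assoc]

lemma path_hom_terminal_ext (f g : K ⟶ pathSpace (⊤_ SSet.{v})) : f = g := by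
  apply MonoidalClosed.uncurry_injective
  subsingleton

end SSet

/-! ### Lifting against Kan fibrations from conditions on homotopy groups -/

namespace SSet

open Limits HomotopicalAlgebra modelCategoryQuillen

variable {K L E X Y Z : SSet.{v}} {i : K ⟶ L} {p : E ⟶ X}

lemma comp_const_assoc (f : K ⟶ L) (x : X _⦋0⦌) (g : X ⟶ Y) :
    f ≫ const x ≫ g = const x ≫ g := by
  rw [← Category.assoc, comp_const]

lemma const_comp_assoc (x : X _⦋0⦌) (g : X ⟶ Y) (h : Y ⟶ Z) :
    (const x : K ⟶ X) ≫ g ≫ h = const (g.app _ x) ≫ h := by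
  rw [← Category.assoc, const_comp]

/-- Transport of a lifting problem along homotopies which are prescribed on a subobject of the
source. -/
lemma exists_solves_of_path_extension [KanComplex E] [KanComplex X] [Fibration p] [Mono i]
    {M : SSet.{v}} (j : M ⟶ K) [Mono j] (a : K ⟶ E) (b : L ⟶ X) (h : i ≫ b = a ≫ p)
    (u : M ⟶ pathSpace E) (hu : u ≫ pathEval E 1 = j ≫ a) :
    ∃ (a' : K ⟶ E) (b' : L ⟶ X), j ≫ a' = u ≫ pathEval E 0 ∧ i ≫ b' = a' ≫ p ∧
      (Solves i p a' b' → Solves i p a b) := by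
  -- The homotopy is extended to `K` in `E`, then its image in `X` is extended to `L`.
  obtain ⟨v, hv₁, hv₂⟩ := exists_path_extension 1 a u hu
  obtain ⟨w, hw₁, hw₂⟩ := exists_path_extension 1 b (v ≫ pathMap p) (i := i) (by
    rw [Category.assoc, pathMap_eval, reassoc_of% hv₁, h])
  refine ⟨v ≫ pathEval E 0, w ≫ pathEval X 0, by rw [reassoc_of% hv₂], ?_, fun hs ↦ ?_⟩
  · rw [reassoc_of% hw₂, pathMap_eval, Category.assoc]
  · rw [← hv₁, ← hw₁]
    exact hs.of_path hw₂.symm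

/-- The horn extends to the simplex because `E` is a Kan complex, and the simplex contracts to its
first vertex. -/
lemma exists_horn_path [KanComplex E] {n : ℕ} {k : Fin (n + 2)}
    (a : (Λ[n + 1, k] : SSet.{v}) ⟶ E) :
    ∃ (x : E _⦋0⦌) (v : (Λ[n + 1, k] : SSet.{v}) ⟶ pathSpace E),
      v ≫ pathEval E 0 = const x ∧ v ≫ pathEval E 1 = a := by
  obtain ⟨c, hc⟩ := exists_extension_of_anodyne (anodyneExtensions.horn_ι k) a
  obtain ⟨G, h₀, h₁⟩ := contractsTo_stdSimplex.{v} (n + 1)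
  refine ⟨c.app _ (stdSimplex.obj₀Equiv.symm 0), Λ[n + 1, k].ι ≫ G ≫ pathMap c, ?_, ?_⟩
  · rw [Category.assoc, Category.assoc, pathMap_eval, reassoc_of% h₀, const_comp, comp_const]
  · rw [Category.assoc, Category.assoc, pathMap_eval, reassoc_of% h₁, hc]

/-- A lifting problem against a Kan fibration can be replaced by a lifting problem whose data are
constant except on the first face. -/
lemma solves_of_solves_const [KanComplex E] [KanComplex X] [Fibration p] {n : ℕ}
    (D : Set (E _⦋0⦌)) (hD : ∀ x, ∃ d ∈ D, π₀.mk d = π₀.mk x)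
    (hs : ∀ d ∈ D, ∀ a : (∂Δ[n + 1] : SSet.{v}) ⟶ E, hornToBoundary _ 0 ≫ a = const d →
      a ≫ p = const (p.app _ d) → Solves ∂Δ[n + 1].ι p a (const (p.app _ d)))
    (a : (∂Δ[n + 1] : SSet.{v}) ⟶ E) (b : Δ[n + 1] ⟶ X) (h : ∂Δ[n + 1].ι ≫ b = a ≫ p) :
    Solves ∂Δ[n + 1].ι p a b := by
  obtain ⟨x, u, hu₀, hu₁⟩ := exists_horn_path (hornToBoundary _ 0 ≫ a)
  obtain ⟨a₁, b₁, ha₁, h₁, hs₁⟩ := exists_solves_of_path_extension _ a b h u hu₁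
  -- The horn is now constant at `x`; it is moved within its component to a base point of `D`.
  obtain ⟨d, hd, hd'⟩ := hD x
  obtain ⟨γ, rfl, rfl⟩ := π₀_mk_eq_iff.1 hd'
  obtain ⟨a₂, b₂, ha₂, h₂, hs₂⟩ := exists_solves_of_path_extension (hornToBoundary _ 0) a₁ b₁ h₁
    (const γ) (by rw [ha₁, hu₀, const_comp])
  rw [const_comp] at ha₂
  -- Since the horn inclusion is anodyne, maps from the simplex to `X` that agree on the horn are
  -- homotopic relative to it. Thus `b₂` is deformed to a constant map, and lifting this deformation
  -- keeps the horn at `d`.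
  obtain ⟨w, hw₀, hw₁, hw, -⟩ := path_box_of_anodyne (p := terminal.from X)
    (anodyneExtensions.horn_ι (0 : Fin (n + 2))) (const (p.app _ ((pathEval E 0).app _ γ))) b₂
    (const (p.app _ ((pathEval E 0).app _ γ)) ≫ pathRefl X) (terminal.from _ ≫ pathRefl _)
    (by rw [Category.assoc, pathRefl_eval, Category.comp_id, comp_const])
    (by rw [Category.assoc, pathRefl_eval, Category.comp_id, ← hornToBoundary_ι, Category.assoc,
      h₂, reassoc_of% ha₂, const_comp]) (by subsingleton) (by subsingleton)
    (path_hom_terminal_ext _ _)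
  obtain ⟨v, hv₁, hv, hv₂⟩ := path_lift (p := p) (i := hornToBoundary (n + 1) 0) 1 a₂
    (const ((pathEval E 0).app _ γ) ≫ pathRefl E) (∂Δ[n + 1].ι ≫ w)
    (by rw [Category.assoc, pathRefl_eval, Category.comp_id, ha₂])
    (by rw [Category.assoc, hw₁, h₂])
    (by rw [Category.assoc, pathRefl_map, const_comp_assoc, ← Category.assoc,
      hornToBoundary_ι, hw])
  refine hs₁ (hs₂ ?_)
  rw [← hw₁, ← hv₁]
  refine Solves.of_path (k := 0) hv₂ ?_
  rw [hw₀]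
  refine hs _ hd _ ?_ ?_
  · rw [reassoc_of% hv, pathRefl_eval, Category.comp_id]
  · rw [Category.assoc, ← pathMap_eval, reassoc_of% hv₂, hw₀, comp_const]

/-- The lifting problem for a Kan fibration which is injective on `π_n` and surjective on
`π_{n+1}`. -/
lemma solves_of_piInjective_of_piSurjective [KanComplex E] [KanComplex X] [Fibration p] {n : ℕ}
    (D : Set (E _⦋0⦌)) (hD : ∀ x, ∃ d ∈ D, π₀.mk d = π₀.mk x)
    (hp : ∀ d ∈ D, PiInjective p n d) (hp' : ∀ d ∈ D, PiSurjective p (n + 1) d)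
    (a : (∂Δ[n + 1] : SSet.{v}) ⟶ E) (b : Δ[n + 1] ⟶ X) (h : ∂Δ[n + 1].ι ≫ b = a ≫ p) :
    Solves ∂Δ[n + 1].ι p a b := by
  refine solves_of_solves_const D hD (fun d hd a ha hap ↦ ?_) a b h
  have hα : ∂Δ[n].ι ≫ boundary.ι 0 ≫ a = const d := by
    rw [← Category.assoc, ← boundaryToHorn_comp, Category.assoc, ha, comp_const]
  -- The first face of `a` represents an element of `π_n` with trivial image, so it is null.
  obtain ⟨α, hα₀, hα₁, hα₂⟩ := hp d hd (boundary.ι 0 ≫ a) (const d) hα (comp_const _ _) (by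
    rw [Category.assoc, hap, comp_const, const_comp]
    exact .refl _ _)
  -- the map `a` extends to `E`
  obtain ⟨c₂, hc₂, -⟩ : Solves ∂Δ[n + 1].ι (terminal.from E) a (terminal.from _) := by
    refine Solves.of_face_homotopy (k := 1) (k' := 0) (a := const d) α (by rw [ha, comp_const])
      (by subsingleton) (by rw [hα₁, comp_const]) hα₀ ?_ (path_hom_terminal_ext _ _)
      ⟨const d, comp_const _ _, by subsingleton⟩
    rw [hα₂, Category.assoc, reassoc_of% hα, comp_const_assoc, comp_const_assoc]
  -- The extension `c₂` need not lie over the constant map: its image is an element of `π_{n+1}` of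
  -- the base, which `σ` realizes.
  obtain ⟨σ, hσ, w, hw₀, hw₁, hw⟩ := hp' d hd (c₂ ≫ p) (by rw [reassoc_of% hc₂, hap])
  have hσp : ∂Δ[n + 1].ι ≫ σ ≫ p = const (p.app _ d) := by rw [reassoc_of% hσ, const_comp]
  rw [Category.assoc, reassoc_of% hσ, const_comp_assoc] at hw
  -- this extension is corrected using `σ`
  obtain ⟨H, hH₁, hH, hHp⟩ := path_lift (p := p) (i := Λ[n + 1, 0].ι) 1 c₂
    (const d ≫ pathRefl E) w
    (by rw [Category.assoc, pathRefl_eval, Category.comp_id, ← hornToBoundary_ι, Category.assoc,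
      hc₂, ha]) hw₁
    (by rw [Category.assoc, pathRefl_map, ← hornToBoundary_ι, Category.assoc, hw, const_comp_assoc,
      comp_const_assoc])
  have hH₀ : (H ≫ pathEval E 0) ≫ p = σ ≫ p := by
    rw [Category.assoc, ← pathMap_eval, reassoc_of% hHp, hw₀]
  -- The start of `H` and `σ` have the same image in `X` and agree on the horn, so they are
  -- fiberwise homotopic relative to the horn.
  obtain ⟨F, hF₀, hF₁, hF, hFp⟩ := path_box_of_anodyne (p := p)
    (anodyneExtensions.horn_ι (0 : Fin (n + 2))) (H ≫ pathEval E 0) σ (const d ≫ pathRefl E)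
    (σ ≫ p ≫ pathRefl X) (by rw [reassoc_of% hH, Category.assoc])
    (by rw [Category.assoc, pathRefl_eval, Category.comp_id, ← hornToBoundary_ι, Category.assoc,
      hσ, comp_const])
    (by rw [hH₀, Category.assoc, Category.assoc, pathRefl_eval, Category.comp_id])
    (by rw [Category.assoc, Category.assoc, pathRefl_eval, Category.comp_id])
    (by rw [Category.assoc, pathRefl_map, ← hornToBoundary_ι, Category.assoc, reassoc_of% hσp,
      const_comp_assoc, comp_const_assoc])
  have hδ {T : SSet.{v}} (f : Δ[n + 1] ⟶ T) :
      stdSimplex.δ 0 ≫ f = boundary.ι 0 ≫ ∂Δ[n + 1].ι ≫ f := rfl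
  have hδ' {T : SSet.{v}} (f : Δ[n + 1] ⟶ T) :
      ∂Δ[n].ι ≫ stdSimplex.δ 0 ≫ f = boundaryToHorn n ≫ Λ[n + 1, 0].ι ≫ f := rfl
  -- On the first face `σ` is constant, so `F` is there a homotopy inside a fiber to the constant
  -- map, whose lifting problem is trivial.
  have h₁ : Solves ∂Δ[n + 1].ι p (∂Δ[n + 1].ι ≫ H ≫ pathEval E 0) (const (p.app _ d)) := by
    refine Solves.of_face_homotopy (k := 1) (k' := 0) (a := const d) (stdSimplex.δ 0 ≫ F)
      ?_ ?_ ?_ ?_ ?_ ?_ ⟨const d, comp_const _ _, const_comp _ _⟩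
    · rw [← Category.assoc, hornToBoundary_ι, reassoc_of% hH, pathRefl_eval, Category.comp_id,
        comp_const]
    · rw [comp_const, const_comp]
    · rw [Category.assoc, hF₁, hδ, hσ]
    · rw [Category.assoc, hF₀, hδ]
    · rw [hδ', hF, comp_const_assoc, comp_const_assoc, comp_const_assoc]
    · rw [Category.assoc, hFp, hδ, reassoc_of% hσp, comp_const_assoc, comp_const_assoc]
  -- On the first face `H` also stays in a fiber, because `w` is constant on the boundary; it ends
  -- at the face of `a`.
  refine Solves.of_face_homotopy (k := 0) (k' := 1) (stdSimplex.δ 0 ≫ H) ?_ ?_ ?_ ?_ ?_ ?_ h₁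
  · rw [← Category.assoc, hornToBoundary_ι, reassoc_of% hH, pathRefl_eval, Category.comp_id, ha]
  · rw [comp_const, Category.assoc, hH₀, hσp]
  · rw [Category.assoc, hδ]
  · rw [Category.assoc, hH₁, hδ, hc₂]
  · rw [hδ', hH, Category.assoc, Category.assoc]
    rw [← reassoc_of% boundaryToHorn_comp, reassoc_of% hornToBoundary_ι, reassoc_of% hH,
      pathRefl_eval_assoc]
  · rw [Category.assoc, hHp, hδ, hw, comp_const_assoc, comp_const_assoc]

end SSet

namespace SSet

open Limits HomotopicalAlgebra modelCategoryQuillen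

variable {K L E X Y Z : SSet.{v}} {i : K ⟶ L} {p : E ⟶ X}

/-! ### Homotopy pullbacks -/

lemma fibration_of_solves (h : ∀ ⦃K L : SSet.{v}⦄ (i : K ⟶ L), anodyneExtensions i →
    ∀ (a : K ⟶ E) (b : L ⟶ X), i ≫ b = a ≫ p → Solves i p a b) : Fibration p := by
  rw [fibration_iff]
  intro K L i hi
  refine ⟨fun {a b} sq ↦ ?_⟩
  obtain ⟨c, hc₁, hc₂⟩ := h i (MorphismProperty.le_llp_rlp _ _ hi) a b sq.w.symm
  exact ⟨⟨c, hc₁, hc₂⟩⟩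

lemma kanComplex_of_exists_extension (h : ∀ ⦃K L : SSet.{v}⦄ (i : K ⟶ L), anodyneExtensions i →
    ∀ (a : K ⟶ X), ∃ c : L ⟶ X, i ≫ c = a) : KanComplex X := by
  rw [KanComplex, isFibrant_iff]
  refine fibration_of_solves (fun K L i hi a b _ ↦ ?_)
  obtain ⟨c, hc⟩ := h i hi a
  exact ⟨c, hc, by subsingleton⟩

lemma solves_of_anodyne [Fibration p] (hi : anodyneExtensions i) {a : K ⟶ E} {b : L ⟶ X}
    (h : i ≫ b = a ≫ p) : Solves i p a b := by
  have := hi p (by rwa [← HomotopicalAlgebra.fibration_iff])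
  exact solves_of_hasLiftingProperty _ _ h

lemma TrivialFibration.exists_extension [Mono i] (hX : TrivialFibration (terminal.from X))
    (a : K ⟶ X) : ∃ c : L ⟶ X, i ≫ c = a := by
  obtain ⟨c, hc, -⟩ := hX.solves (i := i) (a := a) (b := terminal.from L) (by subsingleton)
  exact ⟨c, hc⟩

lemma TrivialFibration.homotopicRel [Mono i] (hX : TrivialFibration (terminal.from X))
    {f g : L ⟶ X} (h : i ≫ f = i ≫ g) : HomotopicRel i f g := by
  obtain ⟨c, h₀, h₁, h, -⟩ := hX.path_box (i := i) f g (i ≫ f ≫ pathRefl X)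
    (terminal.from _ ≫ pathRefl _) (by simp) (by simp [h]) (by subsingleton) (by subsingleton)
    (path_hom_terminal_ext _ _)
  exact ⟨c, h₀, h₁, h⟩

instance kanComplex_tensor [KanComplex X] [KanComplex Y] : KanComplex (X ⊗ Y) :=
  kanComplex_of_exists_extension (fun K L i hi a ↦ by
    obtain ⟨c, hc⟩ := exists_extension_of_anodyne hi (a ≫ fst _ _)
    obtain ⟨d, hd⟩ := exists_extension_of_anodyne hi (a ≫ snd _ _)
    exact ⟨lift c d, by rw [comp_lift, hc, hd, lift_comp_fst_snd]⟩)

lemma TrivialFibration.tensor (hX : TrivialFibration (terminal.from X))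
    (hY : TrivialFibration (terminal.from Y)) : TrivialFibration (terminal.from (X ⊗ Y)) := by
  intro K L i hi
  have : Mono i := hi
  refine ⟨fun {a b} _ ↦ ?_⟩
  obtain ⟨c, hc⟩ := hX.exists_extension (i := i) (a ≫ fst _ _)
  obtain ⟨d, hd⟩ := hY.exists_extension (i := i) (a ≫ snd _ _)
  exact ⟨⟨lift c d, by rw [comp_lift, hc, hd, lift_comp_fst_snd], by subsingleton⟩⟩

/-- The evaluation of paths at both ends is a Kan fibration. -/
instance fibration_pathEval [KanComplex X] : Fibration (lift (pathEval X 0) (pathEval X 1)) :=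
  fibration_of_solves (fun K L i hi a b h ↦ by
    have h₀ := h =≫ fst _ _
    have h₁ := h =≫ snd _ _
    simp only [Category.assoc, lift_fst, lift_snd] at h₀ h₁
    obtain ⟨c, hc₀, hc₁, hc, -⟩ := path_box_of_anodyne (p := terminal.from X) hi (b ≫ fst _ _)
      (b ≫ snd _ _) a (terminal.from _ ≫ pathRefl _) h₀.symm h₁.symm (by subsingleton)
      (by subsingleton) (path_hom_terminal_ext _ _)
    exact ⟨c, hc, by rw [comp_lift, hc₀, hc₁, lift_comp_fst_snd]⟩)

section

variable {X' Y' Z' : SSet.{v}} (u : X ⟶ Z) (w : Y ⟶ Z)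

/-- The path which is part of a point of the homotopy pullback. -/
noncomputable def hpbPath : homotopyPullback u w ⟶ pathSpace Z := pullback.fst _ _

/-- The projection to the first factor of the homotopy pullback. -/
noncomputable def hpbFst : homotopyPullback u w ⟶ X := pullback.snd _ _ ≫ fst _ _

/-- The projection to the second factor of the homotopy pullback. -/
noncomputable def hpbSnd : homotopyPullback u w ⟶ Y := pullback.snd _ _ ≫ snd _ _

lemma hpbPath_eval_zero : hpbPath u w ≫ pathEval Z 0 = hpbFst u w ≫ u := by
  have := pullback.condition (f := lift (pathEval Z 0) (pathEval Z 1)) (g := u ⊗ₘ w) =≫ fst _ _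
  simpa [hpbPath, hpbFst] using this

lemma hpbPath_eval_one : hpbPath u w ≫ pathEval Z 1 = hpbSnd u w ≫ w := by
  have := pullback.condition (f := lift (pathEval Z 0) (pathEval Z 1)) (g := u ⊗ₘ w) =≫ snd _ _
  simpa [hpbPath, hpbSnd] using this

variable {u w}

/-- Constructor for maps to homotopy pullbacks. -/
noncomputable def hpbMk (γ : L ⟶ pathSpace Z) (x : L ⟶ X) (y : L ⟶ Y)
    (h₀ : γ ≫ pathEval Z 0 = x ≫ u) (h₁ : γ ≫ pathEval Z 1 = y ≫ w) :
    L ⟶ homotopyPullback u w :=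
  pullback.lift γ (lift x y) (by
    ext1
    · simpa using h₀
    · simpa using h₁)

section

variable (γ : L ⟶ pathSpace Z) (x : L ⟶ X) (y : L ⟶ Y)
    (h₀ : γ ≫ pathEval Z 0 = x ≫ u) (h₁ : γ ≫ pathEval Z 1 = y ≫ w)

@[simp] lemma hpbMk_path : hpbMk γ x y h₀ h₁ ≫ hpbPath u w = γ := pullback.lift_fst _ _ _

@[simp] lemma hpbMk_fst : hpbMk γ x y h₀ h₁ ≫ hpbFst u w = x :=
  (pullback.lift_snd_assoc _ _ _ _).trans (lift_fst _ _)

@[simp] lemma hpbMk_snd : hpbMk γ x y h₀ h₁ ≫ hpbSnd u w = y :=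
  (pullback.lift_snd_assoc _ _ _ _).trans (lift_snd _ _)

@[simp] lemma hpbMk_path_assoc {T : SSet.{v}} (g : pathSpace Z ⟶ T) :
    hpbMk γ x y h₀ h₁ ≫ hpbPath u w ≫ g = γ ≫ g := by
  rw [← Category.assoc, hpbMk_path]

@[simp] lemma hpbMk_fst_assoc {T : SSet.{v}} (g : X ⟶ T) :
    hpbMk γ x y h₀ h₁ ≫ hpbFst u w ≫ g = x ≫ g := by
  rw [← Category.assoc, hpbMk_fst]

@[simp] lemma hpbMk_snd_assoc {T : SSet.{v}} (g : Y ⟶ T) :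
    hpbMk γ x y h₀ h₁ ≫ hpbSnd u w ≫ g = y ≫ g := by
  rw [← Category.assoc, hpbMk_snd]

end

lemma hpb_hom_ext {f g : L ⟶ homotopyPullback u w} (h : f ≫ hpbPath u w = g ≫ hpbPath u w)
    (h₁ : f ≫ hpbFst u w = g ≫ hpbFst u w) (h₂ : f ≫ hpbSnd u w = g ≫ hpbSnd u w) : f = g := by
  refine pullback.hom_ext h ?_
  ext1
  · simpa [hpbFst] using h₁
  · simpa [hpbSnd] using h₂

section

variable {u' : X' ⟶ Z'} {w' : Y' ⟶ Z'} (a : X ⟶ X') (b : Y ⟶ Y') (c : Z ⟶ Z')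
    (hu : u ≫ c = a ≫ u') (hw : w ≫ c = b ≫ w')

@[simp]
lemma homotopyPullbackMap_path : homotopyPullbackMap a b c hu hw ≫ hpbPath u' w' =
    hpbPath u w ≫ pathMap c :=
  pullback.lift_fst _ _ _

@[simp]
lemma homotopyPullbackMap_fst : homotopyPullbackMap a b c hu hw ≫ hpbFst u' w' =
    hpbFst u w ≫ a := by
  refine (pullback.lift_snd_assoc _ _ _ _).trans ?_
  simp [hpbFst]

@[simp]
lemma homotopyPullbackMap_snd : homotopyPullbackMap a b c hu hw ≫ hpbSnd u' w' =
    hpbSnd u w ≫ b := by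
  refine (pullback.lift_snd_assoc _ _ _ _).trans ?_
  simp [hpbSnd]

end

section

variable (a : L ⟶ X) (b : L ⟶ Y) (H : Δ[1] ⊗ L ⟶ Z)
    (h₀ : lift (const (stdSimplex.obj₀Equiv.{v}.symm 0)) (𝟙 L) ≫ H = a ≫ u)
    (h₁ : lift (const (stdSimplex.obj₀Equiv.{v}.symm 1)) (𝟙 L) ≫ H = b ≫ w)

@[simp]
lemma homotopyPullbackLift_path :
    homotopyPullbackLift a b H h₀ h₁ ≫ hpbPath u w = MonoidalClosed.curry H :=
  pullback.lift_fst _ _ _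

@[simp]
lemma homotopyPullbackLift_fst : homotopyPullbackLift a b H h₀ h₁ ≫ hpbFst u w = a :=
  (pullback.lift_snd_assoc _ _ _ _).trans (lift_fst _ _)

@[simp]
lemma homotopyPullbackLift_snd : homotopyPullbackLift a b H h₀ h₁ ≫ hpbSnd u w = b :=
  (pullback.lift_snd_assoc _ _ _ _).trans (lift_snd _ _)

end

/-- The projection of the homotopy pullback to the product of both factors is a Kan fibration. -/
instance fibration_hpb [KanComplex Z] : Fibration (lift (hpbFst u w) (hpbSnd u w)) := by
  have : lift (hpbFst u w) (hpbSnd u w) =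
      pullback.snd (lift (pathEval Z 0) (pathEval Z 1)) (u ⊗ₘ w) := by
    ext1 <;> simp [hpbFst, hpbSnd]
  rw [this, fibration_iff]
  exact MorphismProperty.pullback_snd (P := J.rlp) _ _ ((fibration_iff _).1 inferInstance)

lemma kanComplex_of_fibration (p : E ⟶ X) [Fibration p] [KanComplex X] : KanComplex E :=
  kanComplex_of_exists_extension (fun K L i hi a ↦ by
    obtain ⟨b, hb⟩ := exists_extension_of_anodyne hi (a ≫ p)
    obtain ⟨c, hc, -⟩ := solves_of_anodyne hi hb
    exact ⟨c, hc⟩)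

instance kanComplex_hpb [KanComplex X] [KanComplex Y] [KanComplex Z] :
    KanComplex (homotopyPullback u w) :=
  kanComplex_of_fibration (lift (hpbFst u w) (hpbSnd u w))

instance kanComplex_pathSpace [KanComplex X] : KanComplex (pathSpace X) :=
  kanComplex_of_fibration (lift (pathEval X 0) (pathEval X 1))

/-- The lifting property of the map of homotopy pullbacks `holim (X ⟶ E ⟵ Y) ⟶ holim (X ⟶ Z ⟵ Y)`
induced by `q : E ⟶ Z`. -/
lemma solves_homotopyPullbackMap {q : E ⟶ Z} {u' : X ⟶ E} {w' : Y ⟶ E} (hu : u' ≫ q = 𝟙 _ ≫ u)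
    (hw : w' ≫ q = 𝟙 _ ≫ w) (a : K ⟶ homotopyPullback u' w') (b : L ⟶ homotopyPullback u w)
    (h : i ≫ b = a ≫ homotopyPullbackMap (𝟙 _) (𝟙 _) q hu hw)
    (hc : a ≫ hpbPath u' w' ≫ pathMap q = i ≫ b ≫ hpbPath u w →
      a ≫ hpbPath u' w' ≫ pathEval E 0 = i ≫ b ≫ hpbFst u w ≫ u' →
      a ≫ hpbPath u' w' ≫ pathEval E 1 = i ≫ b ≫ hpbSnd u w ≫ w' →
      (b ≫ hpbPath u w) ≫ pathEval Z 0 = b ≫ hpbFst u w ≫ u' ≫ q →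
      (b ≫ hpbPath u w) ≫ pathEval Z 1 = b ≫ hpbSnd u w ≫ w' ≫ q →
      ∃ c : L ⟶ pathSpace E, c ≫ pathEval E 0 = b ≫ hpbFst u w ≫ u' ∧
      c ≫ pathEval E 1 = b ≫ hpbSnd u w ≫ w' ∧ i ≫ c = a ≫ hpbPath u' w' ∧
      c ≫ pathMap q = b ≫ hpbPath u w) :
    Solves i (homotopyPullbackMap (𝟙 _) (𝟙 _) q hu hw) a b := by
  have h₁ := h =≫ hpbPath _ _
  have h₂ := h =≫ hpbFst _ _
  have h₃ := h =≫ hpbSnd _ _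
  simp only [Category.assoc, homotopyPullbackMap_path, homotopyPullbackMap_fst,
    homotopyPullbackMap_snd, Category.comp_id] at h₁ h₂ h₃
  obtain ⟨c, hc₀, hc₁, hc, hcq⟩ := hc h₁.symm
    (by rw [hpbPath_eval_zero, reassoc_of% h₂]) (by rw [hpbPath_eval_one, reassoc_of% h₃])
    (by rw [Category.assoc, hpbPath_eval_zero, hu, Category.id_comp])
    (by rw [Category.assoc, hpbPath_eval_one, hw, Category.id_comp])
  refine ⟨hpbMk c (b ≫ hpbFst u w) (b ≫ hpbSnd u w) (by simpa using hc₀) (by simpa using hc₁),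
    hpb_hom_ext ?_ ?_ ?_, hpb_hom_ext ?_ ?_ ?_⟩
  · simp [hc]
  · simp [h₂]
  · simp [h₃]
  · simp [← hcq]
  · simp
  · simp

end

end SSet

namespace SSet

open Limits HomotopicalAlgebra modelCategoryQuillen

variable {K L E X Y Z : SSet.{v}} {i : K ⟶ L} {p : E ⟶ X}

lemma fibration_homotopyPullbackMap {q : E ⟶ Z} [Fibration q] {u : X ⟶ Z} {w : Y ⟶ Z}
    {u' : X ⟶ E} {w' : Y ⟶ E} (hu : u' ≫ q = 𝟙 _ ≫ u) (hw : w' ≫ q = 𝟙 _ ≫ w) :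
    Fibration (homotopyPullbackMap (𝟙 _) (𝟙 _) q hu hw) :=
  fibration_of_solves (fun K L i hi a b h ↦
    solves_homotopyPullbackMap hu hw a b h (fun h₁ h₂ h₃ h₄ h₅ ↦
      path_box_of_anodyne hi _ _ _ _ (by simpa using h₂) (by simpa using h₃) (by simpa using h₄)
        (by simpa using h₅) (by simpa using h₁)))

lemma TrivialFibration.homotopyPullbackMap {q : E ⟶ Z} (hq : TrivialFibration q) {u : X ⟶ Z}
    {w : Y ⟶ Z} {u' : X ⟶ E} {w' : Y ⟶ E} (hu : u' ≫ q = 𝟙 _ ≫ u) (hw : w' ≫ q = 𝟙 _ ≫ w) :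
    TrivialFibration (homotopyPullbackMap (𝟙 _) (𝟙 _) q hu hw) :=
  trivialFibration_of_solves (fun n a b h ↦
    solves_homotopyPullbackMap hu hw a b h (fun h₁ h₂ h₃ h₄ h₅ ↦
      hq.path_box _ _ _ _ (by simpa using h₂) (by simpa using h₃) (by simpa using h₄)
        (by simpa using h₅) (by simpa using h₁)))

/-! ### Replacing a map by a Kan fibration -/

/-- The space of pairs consisting of a point of `X` and a path in `Y` starting at its image. -/
noncomputable abbrev mappingPathSpace (f : X ⟶ Y) : SSet.{v} := homotopyPullback f (𝟙 Y)

/-- The inclusion of the constant paths. -/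
noncomputable def mappingPathι (f : X ⟶ Y) : X ⟶ mappingPathSpace f :=
  hpbMk (f ≫ pathRefl Y) (𝟙 X) f (by simp) (by simp)

/-- The starting point. -/
noncomputable abbrev mappingPathFst (f : X ⟶ Y) : mappingPathSpace f ⟶ X := hpbFst _ _

/-- The endpoint. -/
noncomputable abbrev mappingPathEnd (f : X ⟶ Y) : mappingPathSpace f ⟶ Y := hpbSnd _ _

@[simp]
lemma mappingPathι_fst (f : X ⟶ Y) : mappingPathι f ≫ mappingPathFst f = 𝟙 X := hpbMk_fst ..

@[simp]
lemma mappingPathι_end (f : X ⟶ Y) : mappingPathι f ≫ mappingPathEnd f = f := hpbMk_snd ..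

/-- The endpoint of the path is free, so the homotopy extension property at the starting end is all
that is required. -/
lemma trivialFibration_mappingPathFst [KanComplex Y] (f : X ⟶ Y) :
    TrivialFibration (mappingPathFst f) := by
  intro K L i hi
  have : Mono i := hi
  refine ⟨fun {a b} sq ↦ ?_⟩
  obtain ⟨c, hc₀, hc⟩ := exists_path_extension 0 (b ≫ f) (a ≫ hpbPath _ _) (i := i) (by
    rw [Category.assoc, hpbPath_eval_zero, reassoc_of% sq.w])
  refine ⟨⟨hpbMk c b (c ≫ pathEval Y 1) hc₀ (by simp), hpb_hom_ext ?_ ?_ ?_, by simp⟩⟩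
  · simp [hc]
  · simp [← sq.w]
  · simp [reassoc_of% hc, hpbPath_eval_one]

instance fibration_mappingPathEnd [KanComplex X] [KanComplex Y] (f : X ⟶ Y) :
    Fibration (mappingPathEnd f) :=
  fibration_of_solves (fun K L i hi a b h ↦ by
    obtain ⟨x, hx⟩ := exists_extension_of_anodyne hi (a ≫ hpbFst _ _)
    obtain ⟨c, hc₁, hc₂⟩ := solves_of_anodyne (p := lift (hpbFst f (𝟙 Y)) (hpbSnd f (𝟙 Y))) hi
      (a := a) (b := lift x b) (by rw [comp_lift, comp_lift, hx, h])
    exact ⟨c, hc₁, by simpa using hc₂ =≫ snd _ _⟩)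

lemma isWeakEquivalence_mappingPathι [KanComplex X] [KanComplex Y] (f : X ⟶ Y) :
    IsWeakEquivalence (mappingPathι f) :=
  isWeakEquivalence_of_section (trivialFibration_mappingPathFst f) (mappingPathι_fst f)

lemma exists_const_eq (x : (Δ[0] : SSet.{v}) ⟶ X) : ∃ y, x = const y := ⟨_, eq_const_of_zero x⟩

/-- A Kan fibration which is surjective on connected components is surjective on vertices. -/
lemma exists_lift_vertex [KanComplex X] [Fibration p] (hp : Function.Surjective (mapπ₀ p))
    (b : (Δ[0] : SSet.{v}) ⟶ X) : ∃ c, c ≫ p = b := by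
  obtain ⟨x, rfl⟩ := exists_const_eq b
  obtain ⟨y, hy⟩ := hp (π₀.mk x)
  obtain ⟨e, rfl⟩ := π₀.mk_surjective y
  obtain ⟨γ, h₀, h₁⟩ := π₀_mk_eq_iff.1 hy
  obtain ⟨c, hc₀, -, hc⟩ := path_lift (i := ∂Δ[0].ι) (p := p) 0 (const e)
    (const e ≫ pathRefl E) (const γ) boundary.hom_ext₀ (by rw [const_comp, const_comp, h₀])
    boundary.hom_ext₀
  exact ⟨c ≫ pathEval E 1, by rw [Category.assoc, ← pathMap_eval, reassoc_of% hc, const_comp, h₁]⟩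

/-- Since `f` factors as the weak equivalence `mappingPathι f` followed by this fibration, the
latter inherits from `f` the conditions on homotopy groups, at base points in the image of
`mappingPathι f`. The criterion `solves_of_piInjective_of_piSurjective` then gives the lifts. -/
lemma trivialFibration_mappingPathEnd [KanComplex X] [KanComplex Y] {f : X ⟶ Y}
    (hf : IsWeakEquivalence f) : TrivialFibration (mappingPathEnd f) := by
  have hs := isWeakEquivalence_mappingPathι f
  have hbij : Function.Bijective (mapπ₀ (mappingPathEnd f)) := by
    have := hf.1
    rw [← mappingPathι_end f, mapπ₀_comp] at this
    exact (Function.Bijective.of_comp_iff _ hs.1).1 this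
  rw [isWeakEquivalence_iff] at hf hs
  have hf' (n : ℕ) (x : X _⦋0⦌) : PiInjective f n x := by
    cases n with
    | zero => exact piInjective_zero hf.1.1 x
    | succ n => exact (hf.2 n x).2
  refine trivialFibration_of_solves (fun n a b h ↦ ?_)
  cases n with
  | zero =>
    obtain ⟨c, hc⟩ := exists_lift_vertex hbij.2 b
    exact ⟨c, boundary.hom_ext₀, hc⟩
  | succ n =>
    -- Base points coming from `X` are enough, as they meet every component.
    refine solves_of_piInjective_of_piSurjective (Set.range ((mappingPathι f).app _))
      (fun y ↦ ?_) ?_ ?_ a b h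
    · obtain ⟨x, hx⟩ := hs.1.2 (π₀.mk y)
      obtain ⟨x, rfl⟩ := π₀.mk_surjective x
      exact ⟨_, ⟨x, rfl⟩, hx⟩
    · rintro _ ⟨x, rfl⟩
      cases n with
      | zero => exact piInjective_zero hbij.1 _
      | succ n =>
        intro σ τ hσ hτ h
        obtain ⟨σ', hσ', hσσ'⟩ := (hs.2 n x).1 σ hσ
        obtain ⟨τ', hτ', hττ'⟩ := (hs.2 n x).1 τ hτ
        have : HomotopicRel ∂Δ[n + 1].ι (σ' ≫ f) (τ' ≫ f) := by
          have := ((hσσ'.comp (mappingPathEnd f)).trans h).trans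
            (hττ'.comp (mappingPathEnd f)).symm
          simpa using this
        exact (hσσ'.symm.trans (((hf.2 n x).2 σ' τ' hσ' hτ' this).comp _)).trans hττ'
    · rintro _ ⟨x, rfl⟩ β hβ
      have hx : (mappingPathEnd f).app _ ((mappingPathι f).app _ x) = f.app _ x :=
        ConcreteCategory.congr_hom (congr_app (mappingPathι_end f) _) x
      obtain ⟨σ, hσ, h⟩ := (hf.2 n x).1 β (by rw [hβ, hx])
      exact ⟨σ ≫ mappingPathι f, by rw [reassoc_of% hσ, const_comp], by simpa using h⟩

/-- Extension properties are invariant under weak equivalences. -/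
lemma exists_extension_iff_of_isWeakEquivalence [KanComplex X] [KanComplex Y] {f : X ⟶ Y}
    (hf : IsWeakEquivalence f) (i : K ⟶ L) [Mono i] :
    (∀ a : K ⟶ X, ∃ c : L ⟶ X, i ≫ c = a) ↔ (∀ a : K ⟶ Y, ∃ c : L ⟶ Y, i ≫ c = a) := by
  have tf {A B : SSet.{v}} {q : A ⟶ B} (hq : TrivialFibration q) :
      (∀ a : K ⟶ A, ∃ c : L ⟶ A, i ≫ c = a) ↔ (∀ a : K ⟶ B, ∃ c : L ⟶ B, i ≫ c = a) := by
    constructor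
    · intro h a
      obtain ⟨a', -, rfl⟩ := hq.solves (i := initial.to K) (a := initial.to A) (b := a)
        (by subsingleton)
      obtain ⟨c, rfl⟩ := h a'
      exact ⟨c ≫ q, by simp⟩
    · intro h a
      obtain ⟨b, hb⟩ := h (a ≫ q)
      obtain ⟨c, hc, -⟩ := hq.solves hb
      exact ⟨c, hc⟩
  -- `X` and `Y` are joined by the span of trivial fibrations out of `mappingPathSpace f`.
  rw [← tf (trivialFibration_mappingPathFst f), tf (trivialFibration_mappingPathEnd hf)]

lemma trivialFibration_terminal_iff :
    TrivialFibration (terminal.from X) ↔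
      ∀ n, ∀ a : (∂Δ[n] : SSet.{v}) ⟶ X, ∃ c : Δ[n] ⟶ X, ∂Δ[n].ι ≫ c = a := by
  refine ⟨fun h n a ↦ h.exists_extension a, fun h ↦ trivialFibration_of_solves (fun n a b _ ↦ ?_)⟩
  obtain ⟨c, hc⟩ := h n a
  exact ⟨c, hc, by subsingleton⟩

lemma trivialFibration_terminal_iff_of_isWeakEquivalence [KanComplex X] [KanComplex Y] {f : X ⟶ Y}
    (hf : IsWeakEquivalence f) :
    TrivialFibration (terminal.from X) ↔ TrivialFibration (terminal.from Y) := by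
  simp only [trivialFibration_terminal_iff, exists_extension_iff_of_isWeakEquivalence hf]

instance kanComplex_unit : KanComplex (𝟙_ SSet.{v}) :=
  kanComplex_of_exists_extension (fun _ _ _ _ _ ↦ ⟨toUnit _, toUnit_unique _ _⟩)

lemma IsWeaklyContractible.trivialFibration [KanComplex X] (hX : IsWeaklyContractible X) :
    TrivialFibration (terminal.from X) := by
  rw [trivialFibration_terminal_iff_of_isWeakEquivalence hX, trivialFibration_terminal_iff]
  exact fun _ _ ↦ ⟨toUnit _, toUnit_unique _ _⟩

end SSet

namespace SSet

open Limits HomotopicalAlgebra modelCategoryQuillen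

variable {K L E X Y Z : SSet.{v}} {i : K ⟶ L} {p : E ⟶ X}

/-! ### Lifting problems over a component -/

/-- The homotopy `w` of the base map lifts on `K` starting from `a`, but its other end is not under
control; hence all problems over that end are assumed solvable. -/
lemma Solves.of_base_path [Fibration p] [Mono i] {k k' : Fin 2} (w : L ⟶ pathSpace X) {a : K ⟶ E}
    (h : i ≫ w ≫ pathEval X k' = a ≫ p)
    (hs : ∀ a' : K ⟶ E, i ≫ w ≫ pathEval X k = a' ≫ p → Solves i p a' (w ≫ pathEval X k)) :
    Solves i p a (w ≫ pathEval X k') := by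
  obtain ⟨v, rfl, -, hv⟩ := path_lift (p := p) (i := initial.to K) k' a (initial.to _) (i ≫ w)
    (by subsingleton) (by rw [Category.assoc, h]) (by subsingleton)
  refine Solves.of_path (k := k) hv (hs _ ?_)
  rw [Category.assoc, ← pathMap_eval, reassoc_of% hv]

/-- If the restriction of a Kan fibration to a contractible space `V` has the extension property
for `i : K ⟶ L`, with `L` contractible, then lifting problems for `i` over the component of `V` can
be solved. -/
lemma solves_of_exists_extension [KanComplex X] [Fibration p] [Mono i] {V : SSet.{v}}
    (hV : TrivialFibration (terminal.from V)) (r : V ⟶ X) {ℓ : L _⦋0⦌} (hL : ContractsTo L ℓ)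
    (hi : ∀ (a : K ⟶ E) (v : K ⟶ V), a ≫ p = v ≫ r →
      ∃ (c : L ⟶ E) (v' : L ⟶ V), i ≫ c = a ∧ i ≫ v' = v ∧ c ≫ p = v' ≫ r)
    {a : K ⟶ E} {b : L ⟶ X} (h : i ≫ b = a ≫ p)
    (hb : ∃ x : V _⦋0⦌, π₀.mk (r.app _ x) = π₀.mk (b.app _ ℓ)) : Solves i p a b := by
  obtain ⟨G, h₀, h₁⟩ := hL
  obtain ⟨x, hx⟩ := hb
  obtain ⟨γ, hγ₀, hγ₁⟩ := π₀_mk_eq_iff.1 hx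
  -- The base map is deformed to the constant map at the image of `ℓ`, then along `γ` to the
  -- constant map at the image of `x`.
  have e₀ : (G ≫ pathMap b) ≫ pathEval X 0 = const (b.app _ ℓ) := by
    rw [Category.assoc, pathMap_eval, reassoc_of% h₀, const_comp]
  have e₁ : (G ≫ pathMap b) ≫ pathEval X 1 = b := by
    rw [Category.assoc, pathMap_eval, reassoc_of% h₁]
  rw [← e₁]
  refine Solves.of_base_path (k := 0) _ (by rw [e₁, h]) (fun a ha ↦ ?_)
  have e₂ : (const γ : L ⟶ _) ≫ pathEval X 0 = const (r.app _ x) := by rw [const_comp, hγ₀]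
  have e₃ : (const γ : L ⟶ _) ≫ pathEval X 1 = const (b.app _ ℓ) := by rw [const_comp, hγ₁]
  rw [e₀, ← e₃] at ha ⊢
  refine Solves.of_base_path (k := 0) _ ha (fun a ha ↦ ?_)
  rw [e₂] at ha ⊢
  obtain ⟨c, v, hc, hv, hcv⟩ := hi a (const x) (by rw [← ha, const_comp, comp_const])
  -- The extension `c` lies over `v`, not over the constant map. As `V` is contractible, `v` deforms
  -- to `x` relative to `K`, and `c` is carried along this deformation.
  obtain ⟨d, hd₀, hd₁, hd⟩ := hV.homotopicRel (f := v) (g := const x) (i := i)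
    (by rw [hv, comp_const])
  obtain ⟨e, he₀, he, hep⟩ := path_lift (p := p) 0 c (i ≫ c ≫ pathRefl E) (d ≫ pathMap r)
    (by rw [Category.assoc, Category.assoc, pathRefl_eval, Category.comp_id])
    (by rw [Category.assoc, pathMap_eval, reassoc_of% hd₀, hcv])
    (by rw [reassoc_of% hd, Category.assoc, Category.assoc, pathRefl_map, pathRefl_map,
      reassoc_of% hcv])
  refine ⟨e ≫ pathEval E 1, ?_, ?_⟩
  · rw [reassoc_of% he, pathRefl_eval, Category.comp_id, hc]
  · rw [Category.assoc, ← pathMap_eval, reassoc_of% hep, pathMap_eval, reassoc_of% hd₁, const_comp]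

instance mono_whiskerRight (i : K ⟶ L) [Mono i] (M : SSet.{v}) : Mono (i ▷ M) where
  right_cancellation f g h := by
    ext1
    · rw [← cancel_mono i]
      simpa using h =≫ fst _ _
    · simpa using h =≫ snd _ _

lemma solves_path_iff (e₀ e₁ : L ⟶ E) (γ : L ⟶ pathSpace X) :
    Solves ((∂Δ[1].ι : (∂Δ[1] : SSet.{v}) ⟶ _) ▷ L) p (boundaryOneDesc e₀ e₁)
      (MonoidalClosed.uncurry γ) ↔
    ∃ c : L ⟶ pathSpace E, c ≫ pathEval E 0 = e₀ ∧ c ≫ pathEval E 1 = e₁ ∧ c ≫ pathMap p = γ := by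
  constructor
  · rintro ⟨c, hc, hcp⟩
    have h (k : Fin 2) : MonoidalClosed.curry c ≫ pathEval E k =
        boundaryOneι L k ≫ boundaryOneDesc e₀ e₁ := by
      rw [curry_pathEval, ← hc]
      rfl
    exact ⟨MonoidalClosed.curry c, h 0, h 1, by
      rw [← MonoidalClosed.curry_natural_right, hcp, MonoidalClosed.curry_uncurry]⟩
  · rintro ⟨c, rfl, rfl, rfl⟩
    refine ⟨MonoidalClosed.uncurry c, boundaryOne_hom_ext (fun k ↦ ?_), ?_⟩
    · rw [boundaryOneι_uncurry]
      fin_cases k <;> rfl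
    · rw [MonoidalClosed.uncurry_natural_right]

lemma boundaryOneDesc_comp (e₀ e₁ : L ⟶ E) (q : E ⟶ X) :
    boundaryOneDesc e₀ e₁ ≫ q = boundaryOneDesc (e₀ ≫ q) (e₁ ≫ q) :=
  boundaryOne_hom_ext (fun k ↦ by fin_cases k <;> rfl)

lemma boundaryOne_ι_uncurry (γ : L ⟶ pathSpace X) :
    ((∂Δ[1].ι : (∂Δ[1] : SSet.{v}) ⟶ _) ▷ L) ≫ MonoidalClosed.uncurry γ =
      boundaryOneDesc (γ ≫ pathEval X 0) (γ ≫ pathEval X 1) :=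
  boundaryOne_hom_ext (fun k ↦ by
    rw [boundaryOneι_uncurry]
    fin_cases k <;> rfl)

lemma exists_boundaryOneDesc (a : (∂Δ[1] : SSet.{v}) ⊗ L ⟶ E) :
    ∃ e₀ e₁, a = boundaryOneDesc e₀ e₁ :=
  ⟨boundaryOneι L 0 ≫ a, boundaryOneι L 1 ≫ a, boundaryOne_hom_ext (fun k ↦ by
    fin_cases k <;> rfl)⟩

lemma subsingleton_π₀_iff [KanComplex X] : Subsingleton (π₀ X) ↔ ∀ x y : (Δ[0] : SSet.{v}) ⟶ X,
    ∃ γ : Δ[0] ⟶ pathSpace X, γ ≫ pathEval X 0 = x ∧ γ ≫ pathEval X 1 = y := by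
  constructor
  · intro h x y
    obtain ⟨x, rfl⟩ := exists_const_eq x
    obtain ⟨y, rfl⟩ := exists_const_eq y
    obtain ⟨γ, rfl, rfl⟩ := π₀_mk_eq_iff.1 (Subsingleton.elim (π₀.mk x) (π₀.mk y))
    exact ⟨const γ, const_comp _ _, const_comp _ _⟩
  · refine fun h ↦ ⟨fun x y ↦ ?_⟩
    obtain ⟨x, rfl⟩ := π₀.mk_surjective x
    obtain ⟨y, rfl⟩ := π₀.mk_surjective y
    obtain ⟨γ, h₀, h₁⟩ := h (const x) (const y)
    rw [eq_const_of_zero γ, const_comp] at h₀ h₁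
    exact π₀_mk_eq_iff.2 ⟨_, const_injective h₀, const_injective h₁⟩

section

variable {N M V : SSet.{v}} [KanComplex N] [KanComplex M] {φ : N ⟶ M} {r : V ⟶ M}

/-- The homotopy pullback of `φ` and `r` is the strict pullback of the fibration `mappingPathEnd φ`
along `r`, so extensions in it are the data that `solves_of_exists_extension` needs. -/
lemma solves_mappingPathEnd [Mono i] (hV : TrivialFibration (terminal.from V)) {ℓ : L _⦋0⦌}
    (hL : ContractsTo L ℓ) (hi : ∀ a : K ⟶ homotopyPullback φ r, ∃ c, i ≫ c = a)
    {a : K ⟶ mappingPathSpace φ} {b : L ⟶ M} (h : i ≫ b = a ≫ mappingPathEnd φ)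
    (hb : ∃ x : V _⦋0⦌, π₀.mk (r.app _ x) = π₀.mk (b.app _ ℓ)) :
    Solves i (mappingPathEnd φ) a b := by
  refine solves_of_exists_extension hV r hL (fun a v hav ↦ ?_) h hb
  obtain ⟨c, hc⟩ := hi (hpbMk (a ≫ hpbPath _ _) (a ≫ hpbFst _ _) v
    (by rw [Category.assoc, Category.assoc, hpbPath_eval_zero])
    (by rw [Category.assoc, hpbPath_eval_one, Category.comp_id, hav]))
  have h₁ := hc =≫ hpbPath _ _
  have h₂ := hc =≫ hpbFst _ _
  have h₃ := hc =≫ hpbSnd _ _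
  simp only [Category.assoc, hpbMk_path, hpbMk_fst, hpbMk_snd] at h₁ h₂ h₃
  refine ⟨hpbMk (c ≫ hpbPath _ _) (c ≫ hpbFst _ _) (c ≫ hpbSnd _ _ ≫ r)
    (by rw [Category.assoc, Category.assoc, hpbPath_eval_zero])
    (by rw [Category.assoc, hpbPath_eval_one, Category.comp_id]), c ≫ hpbSnd _ _,
    hpb_hom_ext ?_ ?_ ?_, h₃, by simp⟩
  · simp [h₁]
  · simp [h₂]
  · simp [reassoc_of% h₃, ← hav]

lemma ContractsTo.point : ContractsTo (Δ[0] : SSet.{v}) (stdSimplex.obj₀Equiv.symm 0) :=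
  contractsTo_stdSimplex 0

/-- Connectedness is the extension property for `∂Δ[1]`, so a connected homotopy fiber allows paths
over its component to be lifted with both ends prescribed. -/
lemma exists_path_lift_mappingPathEnd [KanComplex V] (hV : TrivialFibration (terminal.from V))
    (hW : Subsingleton (π₀ (homotopyPullback φ r))) (e₀ e₁ : (Δ[0] : SSet.{v}) ⟶ mappingPathSpace φ)
    (γ : Δ[0] ⟶ pathSpace M) (h₀ : γ ≫ pathEval M 0 = e₀ ≫ mappingPathEnd φ)
    (h₁ : γ ≫ pathEval M 1 = e₁ ≫ mappingPathEnd φ)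
    (h : ∃ x : V _⦋0⦌, ∃ y, γ ≫ pathEval M 0 = const y ∧ π₀.mk (r.app _ x) = π₀.mk y) :
    ∃ c : Δ[0] ⟶ pathSpace (mappingPathSpace φ), c ≫ pathEval _ 0 = e₀ ∧
      c ≫ pathEval _ 1 = e₁ ∧ c ≫ pathMap (mappingPathEnd φ) = γ := by
  rw [← solves_path_iff]
  refine solves_mappingPathEnd (r := r) hV ((contractsTo_stdSimplex 1).tensor .point) ?_ ?_ ?_
  · intro a
    obtain ⟨x, y, rfl⟩ := exists_boundaryOneDesc a
    obtain ⟨γ, rfl, rfl⟩ := subsingleton_π₀_iff.1 hW x y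
    exact ⟨MonoidalClosed.uncurry γ, boundaryOne_ι_uncurry _⟩
  · rw [boundaryOne_ι_uncurry, h₀, h₁, boundaryOneDesc_comp]
  · obtain ⟨x, y, hy, hxy⟩ := h
    refine ⟨x, hxy.trans (congr_arg π₀.mk ?_)⟩
    rw [← uncurry_eval] at hy
    have := ConcreteCategory.congr_hom (congr_app hy _) (stdSimplex.obj₀Equiv.symm 0)
    rw [const_app_zero] at this
    exact this.symm

/-- The coordinates in `V` of two points are joined by a path since `V` is contractible; a lift of
its image in `M` supplies the remaining coordinates of a path. -/
lemma subsingleton_π₀_homotopyPullback [KanComplex V] (hV : TrivialFibration (terminal.from V))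
    (h : ∀ (e₀ e₁ : (Δ[0] : SSet.{v}) ⟶ mappingPathSpace φ)
      (γ : Δ[0] ⟶ pathSpace M), γ ≫ pathEval M 0 = e₀ ≫ mappingPathEnd φ →
      γ ≫ pathEval M 1 = e₁ ≫ mappingPathEnd φ →
      (∃ x : V _⦋0⦌, γ ≫ pathEval M 0 = const (r.app _ x)) →
      ∃ c : Δ[0] ⟶ pathSpace (mappingPathSpace φ), c ≫ pathEval _ 0 = e₀ ∧
        c ≫ pathEval _ 1 = e₁ ∧ c ≫ pathMap (mappingPathEnd φ) = γ) :
    Subsingleton (π₀ (homotopyPullback φ r)) := by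
  rw [subsingleton_π₀_iff]
  intro x y
  obtain ⟨γ, hγ₀, hγ₁, -⟩ := hV.homotopicRel (i := ∂Δ[0].ι) (f := x ≫ hpbSnd _ _)
    (g := y ≫ hpbSnd _ _) boundary.hom_ext₀
  let e (z : (Δ[0] : SSet.{v}) ⟶ homotopyPullback φ r) : Δ[0] ⟶ mappingPathSpace φ :=
    hpbMk (z ≫ hpbPath _ _) (z ≫ hpbFst _ _) (z ≫ hpbSnd _ _ ≫ r)
    (by rw [Category.assoc, Category.assoc, hpbPath_eval_zero])
    (by rw [Category.assoc, hpbPath_eval_one, Category.comp_id])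
  obtain ⟨c, hc₀, hc₁, hc⟩ := h (e x) (e y) (γ ≫ pathMap r)
    (by rw [Category.assoc, pathMap_eval, reassoc_of% hγ₀, hpbMk_snd])
    (by rw [Category.assoc, pathMap_eval, reassoc_of% hγ₁, hpbMk_snd]) (by
      obtain ⟨v, hv⟩ := exists_const_eq (x ≫ hpbSnd φ r)
      exact ⟨v, by rw [Category.assoc, pathMap_eval, reassoc_of% hγ₀, reassoc_of% hv, const_comp]⟩)
  have hcγ : MonoidalClosed.uncurry c ≫ hpbSnd _ _ = MonoidalClosed.uncurry γ ≫ r := by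
    rw [← MonoidalClosed.uncurry_natural_right, ← MonoidalClosed.uncurry_natural_right, hc]
  let d : Δ[1] ⊗ Δ[0] ⟶ homotopyPullback φ r := hpbMk (MonoidalClosed.uncurry c ≫ hpbPath _ _)
    (MonoidalClosed.uncurry c ≫ hpbFst _ _) (MonoidalClosed.uncurry γ)
    (by rw [Category.assoc, Category.assoc, hpbPath_eval_zero])
    (by rw [Category.assoc, hpbPath_eval_one, Category.comp_id, hcγ])
  have hd (k : Fin 2) (z) (hz : γ ≫ pathEval _ k = z ≫ hpbSnd _ _)
      (hz' : c ≫ pathEval _ k = e z) : MonoidalClosed.curry d ≫ pathEval _ k = z := by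
    rw [curry_pathEval]
    refine hpb_hom_ext ?_ ?_ ?_
    · rw [Category.assoc, hpbMk_path, ← Category.assoc, uncurry_eval, hz', hpbMk_path]
    · rw [Category.assoc, hpbMk_fst, ← Category.assoc, uncurry_eval, hz', hpbMk_fst]
    · rw [Category.assoc, hpbMk_snd, uncurry_eval, hz]
  exact ⟨MonoidalClosed.curry d, hd 0 x hγ₀ hc₀, hd 1 y hγ₁ hc₁⟩

end

end SSet

/-! ### Loop spaces with contractible spaces of base points -/

namespace SSet

open Limits HomotopicalAlgebra modelCategoryQuillen

variable {K L E X Y Z : SSet.{v}} {i : K ⟶ L} {p : E ⟶ X}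

lemma pathMap_id (X : SSet.{v}) : pathMap (𝟙 X) = 𝟙 _ :=
  CategoryTheory.Functor.map_id _ _

lemma pathMap_comp (f : X ⟶ Y) (g : Y ⟶ Z) : pathMap (f ≫ g) = pathMap f ≫ pathMap g :=
  CategoryTheory.Functor.map_comp _ _ _

/-- Contractible corners carry no information. New coordinates are chosen in `X` and `Y`, their
images are joined to the old coordinates in `X'` and `Y'`, and the point is transported along the
fibration to `X' ⊗ Y'`. -/
lemma isWeakEquivalence_homotopyPullbackMap_of_contractible {X' Y' : SSet.{v}}
    [KanComplex X] [KanComplex Y] [KanComplex X'] [KanComplex Y'] [KanComplex Z]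
    {u : X ⟶ Z} {w : Y ⟶ Z} {u' : X' ⟶ Z} {w' : Y' ⟶ Z} {f : X ⟶ X'} {g : Y ⟶ Y'}
    (hu : u ≫ 𝟙 Z = f ≫ u') (hw : w ≫ 𝟙 Z = g ≫ w')
    (hX : TrivialFibration (terminal.from X)) (hY : TrivialFibration (terminal.from Y))
    (hX' : TrivialFibration (terminal.from X')) (hY' : TrivialFibration (terminal.from Y')) :
    IsWeakEquivalence (homotopyPullbackMap f g (𝟙 Z) hu hw) := by
  refine IsRelativeEquivalence.isWeakEquivalence (fun K L i _ a b h ↦ ?_)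
  have h₁ := h =≫ hpbPath _ _
  have h₂ := h =≫ hpbFst _ _
  have h₃ := h =≫ hpbSnd _ _
  simp only [Category.assoc, homotopyPullbackMap_path, homotopyPullbackMap_fst,
    homotopyPullbackMap_snd, pathMap_id, Category.comp_id] at h₁ h₂ h₃
  rw [Category.comp_id] at hu hw
  obtain ⟨x, hx⟩ := hX.exists_extension (i := i) (a ≫ hpbFst _ _)
  obtain ⟨y, hy⟩ := hY.exists_extension (i := i) (a ≫ hpbSnd _ _)
  obtain ⟨c, hc₀, hc₁, hc⟩ := hX'.homotopicRel (i := i) (f := b ≫ hpbFst _ _) (g := x ≫ f)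
    (by rw [h₂, reassoc_of% hx])
  obtain ⟨d, hd₀, hd₁, hd⟩ := hY'.homotopicRel (i := i) (f := b ≫ hpbSnd _ _) (g := y ≫ g)
    (by rw [h₃, reassoc_of% hy])
  obtain ⟨e, he₀, he, hep⟩ := path_lift (i := i)
    (p := lift (hpbFst u' w') (hpbSnd u' w')) 0 b
    (i ≫ b ≫ pathRefl _) (pathLift c d) (by simp) (by rw [pathLift_eval, hc₀, hd₀, comp_lift])
    (path_tensor_hom_ext
      (by simp only [Category.assoc, pathLift_map_fst, hc, pathRefl_map, lift_fst_assoc])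
      (by simp only [Category.assoc, pathLift_map_snd, hd, pathRefl_map, lift_snd_assoc]))
  have he₁ : e ≫ pathEval _ 1 ≫ lift (hpbFst u' w') (hpbSnd u' w') = lift (x ≫ f) (y ≫ g) := by
    rw [← pathMap_eval, reassoc_of% hep, pathLift_eval, hc₁, hd₁]
  have hx' := he₁ =≫ fst _ _
  have hy' := he₁ =≫ snd _ _
  simp only [Category.assoc, lift_fst, lift_snd] at hx' hy'
  refine ⟨hpbMk (e ≫ pathEval _ 1 ≫ hpbPath u' w') x y ?_ ?_, ?_, HomotopicRel.symm ?_⟩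
  · rw [Category.assoc, Category.assoc, hpbPath_eval_zero, reassoc_of% hx', hu]
  · rw [Category.assoc, Category.assoc, hpbPath_eval_one, reassoc_of% hy', hw]
  · refine hpb_hom_ext ?_ ?_ ?_
    · simp [reassoc_of% he, h₁]
    · simp [hx]
    · simp [hy]
  · refine ⟨e, he₀, hpb_hom_ext ?_ ?_ ?_, he⟩
    · simp
    · simp [hx']
    · simp [hy']

/-- The extension property of a path-connected space follows from the extension property of its
loop space in the previous dimension. -/
lemma exists_extension_succ [KanComplex X] (hX : Subsingleton (π₀ X)) {U V : SSet.{v}}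
    (hU : TrivialFibration (terminal.from U)) (hV : TrivialFibration (terminal.from V))
    {u : U ⟶ X} {w : V ⟶ X} {n : ℕ}
    (h : ∀ a : (∂Δ[n] : SSet.{v}) ⟶ homotopyPullback u w, ∃ c : Δ[n] ⟶ _, ∂Δ[n].ι ≫ c = a)
    (a : (∂Δ[n + 1] : SSet.{v}) ⟶ X) : ∃ c : Δ[n + 1] ⟶ X, ∂Δ[n + 1].ι ≫ c = a := by
  have : Subsingleton (π₀ (X ⊗ X)) := by
    rw [subsingleton_π₀_iff] at hX ⊢
    intro x y
    obtain ⟨c, hc₀, hc₁⟩ := hX (x ≫ fst _ _) (y ≫ fst _ _)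
    obtain ⟨d, hd₀, hd₁⟩ := hX (x ≫ snd _ _) (y ≫ snd _ _)
    exact ⟨pathLift c d, by rw [pathLift_eval, hc₀, hd₀, lift_comp_fst_snd],
      by rw [pathLift_eval, hc₁, hd₁, lift_comp_fst_snd]⟩
  suffices Solves ∂Δ[n + 1].ι (terminal.from X) a (terminal.from _) by
    obtain ⟨c, hc, -⟩ := this
    exact ⟨c, hc⟩
  have : KanComplex (⊤_ SSet.{v}) :=
    kanComplex_of_exists_extension (fun _ _ _ _ _ ↦ ⟨terminal.from _, by subsingleton⟩)
  refine solves_of_solves_const (p := terminal.from X) Set.univ (fun x ↦ ⟨x, by simp⟩)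
    (fun d _ a ha _ ↦ ?_) _ _ (by subsingleton)
  obtain ⟨x, hx⟩ : ∃ x : (U ⊗ V) _⦋0⦌, True := by
    obtain ⟨c, -⟩ := (hU.tensor hV).exists_extension (i := initial.to (Δ[0] : SSet.{v}))
      (initial.to _)
    exact ⟨c.app _ (stdSimplex.obj₀Equiv.symm 0), trivial⟩
  have hα : ∂Δ[n].ι ≫ boundary.ι 0 ≫ a = const d := by
    rw [← Category.assoc, ← boundaryToHorn_comp, Category.assoc, ha, comp_const]
  -- A null homotopy of the first face relative to its boundary is a lift against the fibration of
  -- `pathSpace X` over `X ⊗ X`. Its restriction to `U ⊗ V` is the given loop space, and `X ⊗ X` has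
  -- only one component.
  obtain ⟨α, hα₁, hα₂⟩ := solves_of_exists_extension
    (p := lift (pathEval X 0) (pathEval X 1)) (hU.tensor hV) (u ⊗ₘ w) (contractsTo_stdSimplex n)
    (fun a v hav ↦ by
      have h₀ := hav =≫ fst _ _
      have h₁ := hav =≫ snd _ _
      simp only [Category.assoc, lift_fst, lift_snd, tensorHom_fst, tensorHom_snd] at h₀ h₁
      obtain ⟨c, hc⟩ := h (hpbMk a (v ≫ fst _ _) (v ≫ snd _ _) (by simpa using h₀)
        (by simpa using h₁))
      refine ⟨c ≫ hpbPath _ _, lift (c ≫ hpbFst _ _) (c ≫ hpbSnd _ _), ?_, ?_, ?_⟩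
      · rw [reassoc_of% hc, hpbMk_path]
      · rw [comp_lift, reassoc_of% hc, reassoc_of% hc, hpbMk_fst, hpbMk_snd, lift_comp_fst_snd]
      · rw [comp_lift, Category.assoc, Category.assoc, hpbPath_eval_zero, hpbPath_eval_one]
        ext1 <;> simp)
    (a := const d ≫ pathRefl X) (b := lift (boundary.ι 0 ≫ a) (const d))
    (by
      rw [comp_lift, hα, comp_const, Category.assoc, comp_lift, pathRefl_eval, pathRefl_eval,
        comp_lift, Category.comp_id])
    ⟨x, Subsingleton.elim _ _⟩
  have hα₃ := hα₂ =≫ fst _ _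
  have hα₄ := hα₂ =≫ snd _ _
  simp only [Category.assoc, lift_fst, lift_snd] at hα₃ hα₄
  have := Solves.of_face_homotopy (p := terminal.from X) (k := 1) (k' := 0) (a := const d)
    (a' := a) (b := terminal.from _) α (by rw [ha, comp_const])
    (by subsingleton) (by rw [hα₄, comp_const]) hα₃
    (by rw [hα₁, comp_const_assoc, comp_const_assoc]) (path_hom_terminal_ext _ _)
    ⟨const d, comp_const _ _, by subsingleton⟩
  obtain ⟨c, hc, -⟩ := this
  exact ⟨c, hc, by subsingleton⟩

section

variable {N M U U' T T' V : SSet.{v}} [KanComplex N] [KanComplex M] [KanComplex U]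
  [KanComplex U'] [KanComplex T] [KanComplex T'] [KanComplex V]

lemma eq_mk_of_const_path {x y : X _⦋0⦌} [KanComplex X] (γ : (Δ[0] : SSet.{v}) ⟶ pathSpace X)
    (h₀ : γ ≫ pathEval X 0 = const x) (h₁ : γ ≫ pathEval X 1 = const y) : π₀.mk x = π₀.mk y := by
  rw [eq_const_of_zero γ, const_comp] at h₀ h₁
  exact π₀_mk_eq_iff.2 ⟨_, const_injective h₀, const_injective h₁⟩

/-- If the homotopy fiber of `φ : N ⟶ M` over the component of `V` is connected, then two points of
`N` over this component are in the same component. -/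
lemma eq_of_subsingleton_π₀_homotopyPullback {φ : N ⟶ M} {r : V ⟶ M}
    (hV : TrivialFibration (terminal.from V))
    (hW : Subsingleton (π₀ (homotopyPullback φ r))) {x y : π₀ N}
    (hx : mapπ₀ φ x ∈ Set.range (mapπ₀ r)) (hxy : mapπ₀ φ x = mapπ₀ φ y) : x = y := by
  obtain ⟨x, rfl⟩ := π₀.mk_surjective x
  obtain ⟨y, rfl⟩ := π₀.mk_surjective y
  obtain ⟨v, hv⟩ := hx
  obtain ⟨v, rfl⟩ := π₀.mk_surjective v
  obtain ⟨γ, h₀, h₁⟩ := π₀_mk_eq_iff.1 hxy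
  obtain ⟨c, hc₀, hc₁, -⟩ := exists_path_lift_mappingPathEnd (φ := φ) (r := r) hV hW
    (const x ≫ mappingPathι φ) (const y ≫ mappingPathι φ) (const γ)
    (by rw [const_comp, h₀, Category.assoc, mappingPathι_end, const_comp])
    (by rw [const_comp, h₁, Category.assoc, mappingPathι_end, const_comp])
    ⟨v, _, const_comp _ _, by rw [h₀]; exact hv⟩
  refine eq_mk_of_const_path (c ≫ pathMap (mappingPathFst φ)) ?_ ?_
  · rw [Category.assoc, pathMap_eval, reassoc_of% hc₀, mappingPathι_fst, Category.comp_id]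
  · rw [Category.assoc, pathMap_eval, reassoc_of% hc₁, mappingPathι_fst, Category.comp_id]

end

end SSet

/-! ### Homotopy fibers and maps of loop spaces -/

namespace SSet

open Limits HomotopicalAlgebra modelCategoryQuillen

variable {N M U U' T T' V : SSet.{v}}

section

variable (φ : N ⟶ M) (u : U ⟶ N) (w : U' ⟶ N)

/-- The inclusion of constant paths, on loop spaces. -/
noncomputable def hpbι : homotopyPullback u w ⟶
    homotopyPullback (u ≫ mappingPathι φ) (w ≫ mappingPathι φ) :=
  homotopyPullbackMap (𝟙 _) (𝟙 _) (mappingPathι φ) (by simp) (by simp)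

/-- The map of loop spaces given by a map which was replaced by a fibration. -/
noncomputable def hpbEnd : homotopyPullback (u ≫ mappingPathι φ) (w ≫ mappingPathι φ) ⟶
    homotopyPullback (u ≫ φ) (w ≫ φ) :=
  homotopyPullbackMap (𝟙 _) (𝟙 _) (mappingPathEnd φ) (by simp) (by simp)

@[simp] lemma hpbι_path : hpbι φ u w ≫ hpbPath _ _ = hpbPath _ _ ≫ pathMap (mappingPathι φ) :=
  homotopyPullbackMap_path ..

@[simp] lemma hpbι_fst : hpbι φ u w ≫ hpbFst _ _ = hpbFst _ _ :=
  (homotopyPullbackMap_fst ..).trans (Category.comp_id _)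

@[simp] lemma hpbι_snd : hpbι φ u w ≫ hpbSnd _ _ = hpbSnd _ _ :=
  (homotopyPullbackMap_snd ..).trans (Category.comp_id _)

@[simp] lemma hpbEnd_path : hpbEnd φ u w ≫ hpbPath _ _ =
    hpbPath _ _ ≫ pathMap (mappingPathEnd φ) :=
  homotopyPullbackMap_path ..

@[simp] lemma hpbEnd_fst : hpbEnd φ u w ≫ hpbFst _ _ = hpbFst _ _ :=
  (homotopyPullbackMap_fst ..).trans (Category.comp_id _)

@[simp] lemma hpbEnd_snd : hpbEnd φ u w ≫ hpbSnd _ _ = hpbSnd _ _ :=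
  (homotopyPullbackMap_snd ..).trans (Category.comp_id _)

section

variable {φ u w} {u₁ : T ⟶ M} {w₁ : T' ⟶ M} {a : U ⟶ T} {b : U' ⟶ T'}

/-- The outer factors will be weak equivalences, so the content is in the fibration `hpbEnd`. -/
lemma homotopyPullbackMap_eq (hu : u ≫ φ = a ≫ u₁) (hw : w ≫ φ = b ≫ w₁) :
    homotopyPullbackMap a b φ hu hw = hpbι φ u w ≫ hpbEnd φ u w ≫
      homotopyPullbackMap a b (𝟙 M) (by simpa using hu) (by simpa using hw) := by
  refine hpb_hom_ext ?_ ?_ ?_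
  · rw [homotopyPullbackMap_path, Category.assoc, Category.assoc, homotopyPullbackMap_path,
      pathMap_id, Category.comp_id, hpbEnd_path, reassoc_of% hpbι_path, ← pathMap_comp,
      mappingPathι_end]
  · rw [homotopyPullbackMap_fst, Category.assoc, Category.assoc, homotopyPullbackMap_fst,
      reassoc_of% hpbEnd_fst, reassoc_of% hpbι_fst]
  · rw [homotopyPullbackMap_snd, Category.assoc, Category.assoc, homotopyPullbackMap_snd,
      reassoc_of% hpbEnd_snd, reassoc_of% hpbι_snd]

end

variable [KanComplex N] [KanComplex M]

instance : Fibration (hpbEnd φ u w) := fibration_homotopyPullbackMap _ _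

/-- A point of the target is a path in `M` between images of points of `N`. By `h` it starts in the
component of `V`, so it lifts with both ends fixed. -/
lemma surjective_mapπ₀_hpbEnd [KanComplex V] {r : V ⟶ M} (hV : TrivialFibration (terminal.from V))
    (hW : Subsingleton (π₀ (homotopyPullback φ r)))
    (h : ∀ x : U _⦋0⦌, ∃ v : V _⦋0⦌, π₀.mk (r.app _ v) = π₀.mk ((u ≫ φ).app _ x)) :
    Function.Surjective (mapπ₀ (hpbEnd φ u w)) := by
  intro y
  obtain ⟨y, rfl⟩ := π₀.mk_surjective y
  obtain ⟨c, -, hc⟩ : Solves (initial.to (Δ[0] : SSet.{v})) (hpbEnd φ u w) (initial.to _)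
      (const y) := by
    refine solves_homotopyPullbackMap _ _ _ _ (by subsingleton) (fun _ _ _ h₀ h₁ ↦ ?_)
    obtain ⟨c, hc₀, hc₁, hc⟩ := exists_path_lift_mappingPathEnd (φ := φ) (r := r) hV hW
      (const y ≫ hpbFst _ _ ≫ u ≫ mappingPathι φ) (const y ≫ hpbSnd _ _ ≫ w ≫ mappingPathι φ)
      (const y ≫ hpbPath _ _) (by simpa only [Category.assoc] using h₀)
      (by simpa only [Category.assoc] using h₁) (by
        obtain ⟨v, hv⟩ := h ((hpbFst _ _).app _ y)
        refine ⟨v, _, ?_, hv⟩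
        rw [Category.assoc, hpbPath_eval_zero, ← const_comp, ← const_comp]
        rfl)
    exact ⟨c, hc₀, hc₁, by subsingleton, hc⟩
  refine ⟨π₀.mk (c.app _ (stdSimplex.obj₀Equiv.symm 0)), congr_arg π₀.mk ?_⟩
  have := ConcreteCategory.congr_hom (congr_app hc _) (stdSimplex.obj₀Equiv.symm 0)
  rwa [const_app_zero] at this

/-- Lifting `∂Δ[n]` here amounts to lifting the pushout-product of `∂Δ[1]` and `∂Δ[n]` against
`mappingPathEnd φ`. The prism contracts to its initial vertex, which lies over the component of `V`
by `h`. -/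
lemma trivialFibration_hpbEnd {r : V ⟶ M} (hV : TrivialFibration (terminal.from V))
    (hW : TrivialFibration (terminal.from (homotopyPullback φ r)))
    (h : ∀ x : U _⦋0⦌, ∃ v : V _⦋0⦌, π₀.mk (r.app _ v) = π₀.mk ((u ≫ φ).app _ x)) :
    TrivialFibration (hpbEnd φ u w) := by
  refine trivialFibration_of_solves (fun n a b hab ↦
    solves_homotopyPullbackMap _ _ _ _ hab (fun h₁ h₂ h₃ h₄ h₅ ↦ ?_))
  let sq := Subcomplex.unionProd.pushoutObjObj.{v} ∂Δ[1] ∂Δ[n]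
  have : Mono sq.ι := (inferInstance : Mono (Subcomplex.unionProd.{v} ∂Δ[1] ∂Δ[n]).ι)
  refine path_box sq _ _ _ _ (by simpa using h₂) (by simpa using h₃) (by simpa using h₄)
    (by simpa using h₅) (by simpa using h₁) (fun β hβ₁ hβ₂ hβ ↦ ?_)
  refine solves_mappingPathEnd (r := r) hV
    ((contractsTo_stdSimplex 1).tensor (contractsTo_stdSimplex n))
    (fun a ↦ hW.exists_extension a) hβ ?_
  obtain ⟨v, hv⟩ := h ((b ≫ hpbFst _ _).app _ (stdSimplex.obj₀Equiv.symm 0))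
  refine ⟨v, hv.trans (congr_arg π₀.mk ?_)⟩
  have := uncurry_eval (b ≫ hpbPath _ _) 0
  rw [Category.assoc, hpbPath_eval_zero] at this
  exact (ConcreteCategory.congr_hom (congr_app this _) (stdSimplex.obj₀Equiv.symm 0)).symm

variable [KanComplex U] [KanComplex U']

lemma isWeakEquivalence_hpbι : IsWeakEquivalence (hpbι φ u w) :=
  isWeakEquivalence_of_section
    (r := homotopyPullbackMap (𝟙 _) (𝟙 _) (mappingPathFst φ) (by simp) (by simp))
    ((trivialFibration_mappingPathFst φ).homotopyPullbackMap _ _) (by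
      refine hpb_hom_ext ?_ ?_ ?_
      · rw [Category.assoc, homotopyPullbackMap_path, reassoc_of% hpbι_path, ← pathMap_comp,
          mappingPathι_fst, pathMap_id, Category.comp_id, Category.id_comp]
      · rw [Category.assoc, homotopyPullbackMap_fst, Category.comp_id, hpbι_fst, Category.id_comp]
      · rw [Category.assoc, homotopyPullbackMap_snd, Category.comp_id, hpbι_snd, Category.id_comp])

variable {φ u w} {u₁ : T ⟶ M} {w₁ : T' ⟶ M} {a : U ⟶ T} {b : U' ⟶ T'}

lemma surjective_mapπ₀_homotopyPullbackMap_iff [KanComplex T] [KanComplex T'] (hu : u ≫ φ = a ≫ u₁) (hw : w ≫ φ = b ≫ w₁)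
    (hU : TrivialFibration (terminal.from U)) (hU' : TrivialFibration (terminal.from U'))
    (hT : TrivialFibration (terminal.from T)) (hT' : TrivialFibration (terminal.from T')) :
    Function.Surjective (mapπ₀ (homotopyPullbackMap a b φ hu hw)) ↔
      Function.Surjective (mapπ₀ (hpbEnd φ u w)) := by
  have h₁ := (isWeakEquivalence_homotopyPullbackMap_of_contractible (by simpa using hu)
    (by simpa using hw) hU hU' hT hT').1
  have h₂ := (isWeakEquivalence_hpbι φ u w).1
  rw [homotopyPullbackMap_eq, mapπ₀_comp, mapπ₀_comp, Function.Surjective.of_comp_iff _ h₂.2,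
    Function.Surjective.of_comp_iff' h₁]

/-- If the homotopy fiber of `φ : N ⟶ M` over the component of `V` is contractible, then `φ`
induces a weak equivalence on the loop spaces at the points of this component. -/
lemma isWeakEquivalence_homotopyPullbackMap [KanComplex T] [KanComplex T']
    (hu : u ≫ φ = a ≫ u₁) (hw : w ≫ φ = b ≫ w₁)
    (hU : TrivialFibration (terminal.from U)) (hU' : TrivialFibration (terminal.from U'))
    (hT : TrivialFibration (terminal.from T)) (hT' : TrivialFibration (terminal.from T'))
    {r : V ⟶ M} (hV : TrivialFibration (terminal.from V))
    (hW : TrivialFibration (terminal.from (homotopyPullback φ r)))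
    (h : ∀ x : U _⦋0⦌, ∃ v : V _⦋0⦌, π₀.mk (r.app _ v) = π₀.mk ((u ≫ φ).app _ x)) :
    IsWeakEquivalence (homotopyPullbackMap a b φ hu hw) := by
  rw [homotopyPullbackMap_eq]
  exact (isWeakEquivalence_hpbι φ u w).comp
    ((trivialFibration_hpbEnd _ _ _ hV hW h).isWeakEquivalence.comp
      (isWeakEquivalence_homotopyPullbackMap_of_contractible _ _ hU hU' hT hT'))

/-- The converse of `surjective_mapπ₀_hpbEnd`: `hu` and `hw` allow the two ends of a path lifting
problem to be moved to points of `U` and `U'`, where the problem becomes a lift of a vertex along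
`hpbEnd`. -/
lemma subsingleton_π₀_of_surjective_hpbEnd [KanComplex V] {r : V ⟶ M} (hV : TrivialFibration (terminal.from V))
    (hs : Function.Surjective (mapπ₀ (hpbEnd φ u w)))
    (hu : ∀ x : π₀ N, mapπ₀ φ x ∈ Set.range (mapπ₀ r) → x ∈ Set.range (mapπ₀ u))
    (hw : ∀ x : π₀ N, mapπ₀ φ x ∈ Set.range (mapπ₀ r) → x ∈ Set.range (mapπ₀ w)) :
    Subsingleton (π₀ (homotopyPullback φ r)) := by
  refine subsingleton_π₀_homotopyPullback hV (fun e₀ e₁ γ hγ₀ hγ₁ ⟨v, hv⟩ ↦ ?_)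
  obtain ⟨x₀, rfl⟩ := exists_const_eq e₀
  obtain ⟨x₁, rfl⟩ := exists_const_eq e₁
  obtain ⟨γ, rfl⟩ := exists_const_eq γ
  have hs' := (isWeakEquivalence_mappingPathι φ).1.2
  have aux (x) (hx : mapπ₀ (mappingPathEnd φ) (π₀.mk x) ∈ Set.range (mapπ₀ r)) :
      ∃ y, π₀.mk ((mappingPathι φ).app _ y) = π₀.mk x ∧
        mapπ₀ φ (π₀.mk y) ∈ Set.range (mapπ₀ r) := by
    obtain ⟨y, hy⟩ := hs' (π₀.mk x)
    obtain ⟨y, rfl⟩ := π₀.mk_surjective y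
    refine ⟨y, hy, ?_⟩
    rwa [← hy, ← mapπ₀_comp_apply, mappingPathι_end] at hx
  rw [const_comp, const_comp] at hγ₀ hγ₁
  rw [const_comp] at hv
  replace hγ₀ := const_injective hγ₀
  replace hγ₁ := const_injective hγ₁
  replace hv := const_injective hv
  obtain ⟨y₀, hy₀, hy₀'⟩ := aux x₀ ⟨π₀.mk v, by
    rw [mapπ₀_mk, mapπ₀_mk, ← hv]
    exact congr_arg _ hγ₀⟩
  obtain ⟨y₁, hy₁, hy₁'⟩ := aux x₁ ⟨π₀.mk v, by
    rw [mapπ₀_mk, mapπ₀_mk, ← hv]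
    exact (π₀_mk_eq_iff.2 ⟨γ, rfl, rfl⟩).trans (congr_arg _ hγ₁)⟩
  obtain ⟨z₀, hz₀⟩ := hu _ hy₀'
  obtain ⟨z₁, hz₁⟩ := hw _ hy₁'
  obtain ⟨z₀, rfl⟩ := π₀.mk_surjective z₀
  obtain ⟨z₁, rfl⟩ := π₀.mk_surjective z₁
  have hz₀' : π₀.mk ((u ≫ mappingPathι φ).app _ z₀) = π₀.mk x₀ := by
    rw [← hy₀, ← mapπ₀_mk, mapπ₀_comp_apply, hz₀, mapπ₀_mk]
  have hz₁' : π₀.mk ((w ≫ mappingPathι φ).app _ z₁) = π₀.mk x₁ := by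
    rw [← hy₁, ← mapπ₀_mk, mapπ₀_comp_apply, hz₁, mapπ₀_mk]
  obtain ⟨δ₀, hδ₀, hδ₀'⟩ := π₀_mk_eq_iff.1 hz₀'
  obtain ⟨δ₁, hδ₁, hδ₁'⟩ := π₀_mk_eq_iff.1 hz₁'
  rw [← solves_path_iff]
  -- The ends are moved along `δ₀` and `δ₁`; the path in `M` is replaced accordingly.
  obtain ⟨a', b', ha', hb', h⟩ := exists_solves_of_path_extension (p := mappingPathEnd φ)
    (i := (∂Δ[1].ι : (∂Δ[1] : SSet.{v}) ⟶ _) ▷ Δ[0]) (𝟙 _)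
    (boundaryOneDesc (const x₀) (const x₁)) (MonoidalClosed.uncurry (const γ)) (by
      rw [boundaryOne_ι_uncurry, boundaryOneDesc_comp]
      simp [hγ₀, hγ₁]) (boundaryOneDesc (const δ₀) (const δ₁)) (by
      rw [boundaryOneDesc_comp, const_comp, const_comp, hδ₀', hδ₁', Category.id_comp])
  apply h
  rw [boundaryOneDesc_comp, const_comp, const_comp, hδ₀, hδ₁, Category.id_comp] at ha'
  subst ha'
  obtain ⟨γ', rfl⟩ : ∃ γ' : (Δ[0] : SSet.{v}) ⟶ pathSpace M, b' = MonoidalClosed.uncurry γ' :=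
    ⟨MonoidalClosed.curry b', by simp⟩
  rw [solves_path_iff]
  have h₀ := boundaryOneι _ 0 ≫= hb'
  have h₁ := boundaryOneι _ 1 ≫= hb'
  rw [boundaryOneι_uncurry, boundaryOneDesc_comp] at h₀ h₁
  rw [boundaryOneι_zero_desc] at h₀
  rw [boundaryOneι_one_desc] at h₁
  obtain ⟨c, hc⟩ := exists_lift_vertex hs (hpbMk γ' (const z₀) (const z₁)
    (by rw [h₀, ← const_comp, Category.assoc, Category.assoc, mappingPathι_end])
    (by rw [h₁, ← const_comp, Category.assoc, Category.assoc, mappingPathι_end]))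
  have hc₀ := hc =≫ hpbPath _ _
  have hc₁ := hc =≫ hpbFst _ _
  have hc₂ := hc =≫ hpbSnd _ _
  rw [Category.assoc, hpbEnd_path, hpbMk_path] at hc₀
  rw [Category.assoc, hpbEnd_fst, hpbMk_fst] at hc₁
  rw [Category.assoc, hpbEnd_snd, hpbMk_snd] at hc₂
  refine ⟨c ≫ hpbPath _ _, ?_, ?_, by rw [Category.assoc, hc₀]⟩
  · rw [Category.assoc, hpbPath_eval_zero, reassoc_of% hc₁, const_comp]
  · rw [Category.assoc, hpbPath_eval_one, reassoc_of% hc₂, const_comp]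

end

end SSet

namespace SSet

open Limits

lemma TrivialFibration.subsingleton_π₀ {X : SSet.{v}} [KanComplex X]
    (hX : TrivialFibration (terminal.from X)) : Subsingleton (π₀ X) :=
  subsingleton_π₀_iff.2 (fun x y ↦ by
    obtain ⟨γ, h₀, h₁, -⟩ := hX.homotopicRel (i := ∂Δ[0].ι) (f := x) (g := y) boundary.hom_ext₀
    exact ⟨γ, h₀, h₁⟩)

lemma TrivialFibration.nonempty {X : SSet.{v}} (hX : TrivialFibration (terminal.from X)) :
    Nonempty (X _⦋0⦌) := by
  obtain ⟨c, -⟩ := hX.exists_extension (i := initial.to (Δ[0] : SSet.{v})) (initial.to _)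
  exact ⟨c.app _ (stdSimplex.obj₀Equiv.symm 0)⟩

end SSet

namespace CategoryTheory.SimplicialCategory

open SSet Limits

variable {C : Type u} [Category.{v} C] [SimplicialCategory C]

/-! ### Null maps -/

lemma mapπ₀_mapPre_cls {A B Y : C} (f : A ⟶ B) (g : B ⟶ Y) :
    mapπ₀ (mapPre f Y) (HoCat.cls g) = HoCat.cls (f ≫ g) := by
  rw [HoCat.cls, mapπ₀_mk, mapPre_app]
  rfl

lemma mapπ₀_mapPost_cls {A Y Y' : C} (f : A ⟶ Y) (g : Y ⟶ Y') :
    mapπ₀ (mapPost A g) (HoCat.cls f) = HoCat.cls (f ≫ g) := by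
  rw [HoCat.cls, mapπ₀_mk, mapPost_app]
  rfl

lemma cls_comp_congr {X Y Z : C} {f f' : X ⟶ Y} {g g' : Y ⟶ Z} (hf : HoCat.cls f = HoCat.cls f')
    (hg : HoCat.cls g = HoCat.cls g') : HoCat.cls (f ≫ g) = HoCat.cls (f' ≫ g') := by
  rw [← mapπ₀_mapPre_cls, hg, mapπ₀_mapPre_cls, ← mapπ₀_mapPost_cls, hf, mapπ₀_mapPost_cls]

/-- A homotopy class is null if it factors through a homotopy zero object. -/
def IsNull {X Y : C} (a : π₀ (sHom X Y)) : Prop :=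
  ∃ (Z : C) (g : X ⟶ Z) (h : Z ⟶ Y), IsHomotopyZero Z ∧ HoCat.cls (g ≫ h) = a

lemma IsNull.mapPre {A B Y : C} (f : A ⟶ B) {b : π₀ (sHom B Y)} (hb : IsNull b) :
    IsNull (mapπ₀ (mapPre f Y) b) := by
  obtain ⟨Z, g, h, hZ, rfl⟩ := hb
  exact ⟨Z, f ≫ g, h, hZ, by rw [mapπ₀_mapPre_cls, Category.assoc]⟩

variable [∀ X Y : C, KanComplex (sHom X Y)]

section

variable {Z : C} (hZ : IsHomotopyZero Z)

include hZ

lemma IsHomotopyZero.trivialFibration_from (X : C) : TrivialFibration (terminal.from (sHom Z X)) :=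
  (hZ.from_zero X).trivialFibration

lemma IsHomotopyZero.trivialFibration_to (X : C) : TrivialFibration (terminal.from (sHom X Z)) :=
  (hZ.to_zero X).trivialFibration

lemma IsHomotopyZero.nonempty_from (X : C) : Nonempty (Z ⟶ X) :=
  (hZ.trivialFibration_from X).nonempty.map (homEquiv' _ _).symm

lemma IsHomotopyZero.nonempty_to (X : C) : Nonempty (X ⟶ Z) :=
  (hZ.trivialFibration_to X).nonempty.map (homEquiv' _ _).symm

lemma IsHomotopyZero.subsingleton_from (X : C) : Subsingleton (π₀ (sHom Z X)) :=
  (hZ.trivialFibration_from X).subsingleton_π₀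

lemma IsHomotopyZero.subsingleton_to (X : C) : Subsingleton (π₀ (sHom X Z)) :=
  (hZ.trivialFibration_to X).subsingleton_π₀

lemma IsHomotopyZero.exists_isNull (X Y : C) : ∃ a : π₀ (sHom X Y), IsNull a := by
  obtain ⟨g⟩ := hZ.nonempty_to X
  obtain ⟨h⟩ := hZ.nonempty_from Y
  exact ⟨_, Z, g, h, hZ, rfl⟩

end

/-- Two factorizations are compared through any map between the two zero objects. -/
lemma IsNull.eq {X Y : C} {a a' : π₀ (sHom X Y)} (ha : IsNull a) (ha' : IsNull a') : a = a' := by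
  obtain ⟨Z, g, h, hZ, rfl⟩ := ha
  obtain ⟨Z', g', h', hZ', rfl⟩ := ha'
  obtain ⟨k⟩ := hZ.nonempty_from Z'
  have := hZ.subsingleton_from Y
  have := hZ'.subsingleton_to X
  rw [cls_comp_congr rfl (Subsingleton.elim (HoCat.cls h) (HoCat.cls (k ≫ h'))),
    ← Category.assoc]
  exact cls_comp_congr (Subsingleton.elim _ _) rfl

/-- The null component is thus the component of the contractible space `Map(Z, Y)`, in the form
required by the results on homotopy fibers. -/
lemma isNull_iff_mem_range_mapPre {A Z : C} (Y : C) (hZ : IsHomotopyZero Z) (j : A ⟶ Z)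
    (a : π₀ (sHom A Y)) : IsNull a ↔ a ∈ Set.range (mapπ₀ (mapPre j Y)) := by
  constructor
  · intro ha
    obtain ⟨h⟩ := hZ.nonempty_from Y
    exact ⟨HoCat.cls h, by rw [mapπ₀_mapPre_cls]; exact IsNull.eq ⟨Z, j, h, hZ, rfl⟩ ha⟩
  · rintro ⟨b, rfl⟩
    obtain ⟨h, rfl⟩ := HoCat.cls_surjective b
    exact ⟨Z, j, h, hZ, (mapπ₀_mapPre_cls ..).symm⟩

lemma isNull_iff_mem_range_mapPost (A : C) {Y Z : C} (hZ : IsHomotopyZero Z) (p : Z ⟶ Y)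
    (a : π₀ (sHom A Y)) : IsNull a ↔ a ∈ Set.range (mapπ₀ (mapPost A p)) := by
  constructor
  · intro ha
    obtain ⟨g⟩ := hZ.nonempty_to A
    exact ⟨HoCat.cls g, by rw [mapπ₀_mapPost_cls]; exact IsNull.eq ⟨Z, g, p, hZ, rfl⟩ ha⟩
  · rintro ⟨b, rfl⟩
    obtain ⟨g, rfl⟩ := HoCat.cls_surjective b
    exact ⟨Z, g, p, hZ, (mapπ₀_mapPost_cls ..).symm⟩

/-! ### Naturality of the comparison maps of squares -/

section

omit [∀ X Y : C, KanComplex (sHom X Y)]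

variable {X Y Z W : C} {i : X ⟶ Y} {j : X ⟶ Z} {p : Y ⟶ W} {q : Z ⟶ W}

/-- The map of spaces of cones `holim (Map(B, Y) ⟶ Map(B, W) ⟵ Map(B, Z))` given by `f : A ⟶ B`. -/
noncomputable def coneMap {A B : C} (f : A ⟶ B) (p : Y ⟶ W) (q : Z ⟶ W) :
    homotopyPullback (mapPost B p) (mapPost B q) ⟶ homotopyPullback (mapPost A p) (mapPost A q) :=
  homotopyPullbackMap (mapPre f Y) (mapPre f Z) (mapPre f W)
    (eHom_whisker_exchange ..) (eHom_whisker_exchange ..)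

/-- The map of spaces of cocones `holim (Map(Y, T) ⟶ Map(X, T) ⟵ Map(Z, T))` given by
`g : T ⟶ T'`. -/
noncomputable def coconeMap {T T' : C} (g : T ⟶ T') (i : X ⟶ Y) (j : X ⟶ Z) :
    homotopyPullback (mapPre i T) (mapPre j T) ⟶ homotopyPullback (mapPre i T') (mapPre j T') :=
  homotopyPullbackMap (mapPost Y g) (mapPost Z g) (mapPost X g)
    (eHom_whisker_exchange ..).symm (eHom_whisker_exchange ..).symm

namespace HoSquare

lemma toMap_coneMap (h : HoSquare i j p q) {A B : C} (f : A ⟶ B) :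
    h.toMap B ≫ coneMap f p q = mapPre f X ≫ h.toMap A := by
  refine hpb_hom_ext ?_ ?_ ?_
  · rw [Category.assoc, Category.assoc, coneMap, homotopyPullbackMap_path, toMap, toMap,
      homotopyPullbackLift_path, ← Category.assoc, homotopyPullbackLift_path,
      ← MonoidalClosed.curry_natural_right, ← MonoidalClosed.curry_natural_left]
    congr 1
    simp only [Category.assoc]
    erw [eComp_eHomWhiskerRight]
    rfl
  · rw [Category.assoc, Category.assoc, coneMap, homotopyPullbackMap_fst, toMap, toMap,
      homotopyPullbackLift_fst, ← Category.assoc, homotopyPullbackLift_fst]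
    exact eHom_whisker_exchange ..
  · rw [Category.assoc, Category.assoc, coneMap, homotopyPullbackMap_snd, toMap, toMap,
      homotopyPullbackLift_snd, ← Category.assoc, homotopyPullbackLift_snd]
    exact eHom_whisker_exchange ..

lemma fromMap_coconeMap (h : HoSquare i j p q) {T T' : C} (g : T ⟶ T') :
    h.fromMap T ≫ coconeMap g i j = mapPost W g ≫ h.fromMap T' := by
  refine hpb_hom_ext ?_ ?_ ?_
  · rw [Category.assoc, Category.assoc, coconeMap, homotopyPullbackMap_path, fromMap, fromMap,
      homotopyPullbackLift_path, ← Category.assoc, homotopyPullbackLift_path,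
      ← MonoidalClosed.curry_natural_right, ← MonoidalClosed.curry_natural_left]
    congr 1
    simp only [Category.assoc]
    erw [eComp_eHomWhiskerLeft]
    rfl
  · rw [Category.assoc, Category.assoc, coconeMap, homotopyPullbackMap_fst, fromMap, fromMap,
      homotopyPullbackLift_fst, ← Category.assoc, homotopyPullbackLift_fst]
    exact (eHom_whisker_exchange ..).symm
  · rw [Category.assoc, Category.assoc, coconeMap, homotopyPullbackMap_snd, fromMap, fromMap,
      homotopyPullbackLift_snd, ← Category.assoc, homotopyPullbackLift_snd]
    exact (eHom_whisker_exchange ..).symm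

end HoSquare

end

end CategoryTheory.SimplicialCategory

namespace CategoryTheory.SimplicialCategory

open SSet Limits

variable {C : Type u} [Category.{v} C] [SimplicialCategory C]

/-! ### Suspensions and loop objects -/

lemma mapPre_comp {X Y Z : C} (f : X ⟶ Y) (g : Y ⟶ Z) (T : C) :
    mapPre (f ≫ g) T = mapPre g T ≫ mapPre f T := eHomWhiskerRight_comp ..

lemma mapPost_comp (T : C) {X Y Z : C} (f : X ⟶ Y) (g : Y ⟶ Z) :
    mapPost T (f ≫ g) = mapPost T f ≫ mapPost T g := eHomWhiskerLeft_comp ..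

/-- A Yoneda argument: the relation for the identity of `B'` is pushed forward along a map `B' ⟶ Y`.
-/
lemma IsSuspension.mapπ₀_fromMap {A B A' B' Z₁ Z₂ : C} {f : A ⟶ B} {g : A' ⟶ B'} {i : B ⟶ Z₁}
    {j : B ⟶ Z₂} {p : Z₁ ⟶ A'} {q : Z₂ ⟶ A'} {h : HoSquare (f ≫ i) (f ≫ j) p q}
    {p' : Z₁ ⟶ B'} {q' : Z₂ ⟶ B'} {h' : HoSquare i j p' q'}
    (hg : mapπ₀ (h.fromMap B') (HoCat.cls g) =
      mapπ₀ (precompCocones f i j B') (mapπ₀ (h'.fromMap B') (HoCat.cls (𝟙 B'))))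
    {Y : C} (b : π₀ (sHom B' Y)) :
    mapπ₀ (h.fromMap Y) (mapπ₀ (mapPre g Y) b) =
      mapπ₀ (precompCocones f i j Y) (mapπ₀ (h'.fromMap Y) b) := by
  obtain ⟨y, rfl⟩ := HoCat.cls_surjective b
  have comm : precompCocones f i j B' ≫ coconeMap y (f ≫ i) (f ≫ j) =
      coconeMap y i j ≫ precompCocones f i j Y := by
    refine hpb_hom_ext ?_ ?_ ?_
    · rw [Category.assoc, Category.assoc, coconeMap, homotopyPullbackMap_path, precompCocones,
        ← Category.assoc, homotopyPullbackMap_path, precompCocones, homotopyPullbackMap_path,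
        coconeMap, ← Category.assoc, homotopyPullbackMap_path, Category.assoc, Category.assoc,
        ← pathMap_comp, ← pathMap_comp, eHom_whisker_exchange]
    · rw [Category.assoc, Category.assoc, coconeMap, homotopyPullbackMap_fst, precompCocones,
        ← Category.assoc, homotopyPullbackMap_fst, precompCocones, homotopyPullbackMap_fst,
        Category.comp_id, Category.comp_id, coconeMap, homotopyPullbackMap_fst]
    · rw [Category.assoc, Category.assoc, coconeMap, homotopyPullbackMap_snd, precompCocones,
        ← Category.assoc, homotopyPullbackMap_snd, precompCocones, homotopyPullbackMap_snd,
        Category.comp_id, Category.comp_id, coconeMap, homotopyPullbackMap_snd]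
  rw [mapπ₀_mapPre_cls, ← mapπ₀_mapPost_cls, ← mapπ₀_comp_apply, ← HoSquare.fromMap_coconeMap,
    mapπ₀_comp_apply, hg, ← mapπ₀_comp_apply, comm, mapπ₀_comp_apply, ← mapπ₀_comp_apply (h'.fromMap B'),
    HoSquare.fromMap_coconeMap, mapπ₀_comp_apply, mapπ₀_mapPost_cls, Category.id_comp]

section

variable {A Z₁ Z₂ Y O₁ O₂ : C} (i : A ⟶ Z₁) (j : A ⟶ Z₂) (p : O₁ ⟶ Y) (q : O₂ ⟶ Y)

/-- The space of paths from a composition `A ⟶ Z₁ ⟶ O₁ ⟶ Y` to a composition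
`A ⟶ Z₂ ⟶ O₂ ⟶ Y`. -/
noncomputable abbrev pathsThrough : SSet.{v} :=
  homotopyPullback (mapPost Z₁ p ≫ mapPre i Y) (mapPost Z₂ q ≫ mapPre j Y)

/-- The map from `pathsThrough` to the space of cocones. -/
noncomputable def toCocones : pathsThrough i j p q ⟶ homotopyPullback (mapPre i Y) (mapPre j Y) :=
  homotopyPullbackMap (mapPost Z₁ p) (mapPost Z₂ q) (𝟙 _) (by simp) (by simp)

/-- The map from `pathsThrough` to the space of cones. -/
noncomputable def toCones : pathsThrough i j p q ⟶ homotopyPullback (mapPost A p) (mapPost A q) :=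
  homotopyPullbackMap (mapPre i O₁) (mapPre j O₂) (𝟙 _)
    (by rw [Category.comp_id, eHom_whisker_exchange])
    (by rw [Category.comp_id, eHom_whisker_exchange])

variable {i j} in
/-- Precomposition on spaces of paths. -/
noncomputable def pathsThroughMap {A' : C} (f : A' ⟶ A) :
    pathsThrough i j p q ⟶ pathsThrough (f ≫ i) (f ≫ j) p q :=
  homotopyPullbackMap (𝟙 _) (𝟙 _) (mapPre f Y) (by simp) (by simp)

lemma pathsThroughMap_toCocones {A' : C} (f : A' ⟶ A) :
    pathsThroughMap p q f ≫ toCocones (f ≫ i) (f ≫ j) p q =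
      toCocones i j p q ≫ precompCocones f i j Y := by
  refine hpb_hom_ext ?_ ?_ ?_
  · rw [Category.assoc, Category.assoc, toCocones, homotopyPullbackMap_path, pathsThroughMap,
      ← Category.assoc, homotopyPullbackMap_path, precompCocones, homotopyPullbackMap_path,
      toCocones, ← Category.assoc, homotopyPullbackMap_path, pathMap_id, pathMap_id,
      Category.comp_id, Category.comp_id]
  · rw [Category.assoc, Category.assoc, toCocones, homotopyPullbackMap_fst, pathsThroughMap,
      ← Category.assoc, homotopyPullbackMap_fst, precompCocones, homotopyPullbackMap_fst,
      toCocones, ← Category.assoc, homotopyPullbackMap_fst,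
      Category.comp_id, Category.comp_id]
  · rw [Category.assoc, Category.assoc, toCocones, homotopyPullbackMap_snd, pathsThroughMap,
      ← Category.assoc, homotopyPullbackMap_snd, precompCocones, homotopyPullbackMap_snd,
      toCocones, ← Category.assoc, homotopyPullbackMap_snd,
      Category.comp_id, Category.comp_id]

lemma pathsThroughMap_toCones {A' : C} (f : A' ⟶ A) :
    pathsThroughMap p q f ≫ toCones (f ≫ i) (f ≫ j) p q = toCones i j p q ≫ coneMap f p q := by
  refine hpb_hom_ext ?_ ?_ ?_
  · rw [Category.assoc, Category.assoc, toCones, homotopyPullbackMap_path, pathsThroughMap,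
      ← Category.assoc, homotopyPullbackMap_path, coneMap, homotopyPullbackMap_path,
      toCones, ← Category.assoc, homotopyPullbackMap_path, pathMap_id, pathMap_id,
      Category.comp_id, Category.comp_id]
  · rw [Category.assoc, Category.assoc, toCones, homotopyPullbackMap_fst, pathsThroughMap,
      ← Category.assoc, homotopyPullbackMap_fst, coneMap, homotopyPullbackMap_fst,
      toCones, ← Category.assoc, homotopyPullbackMap_fst,
      Category.comp_id, mapPre_comp, Category.assoc]
  · rw [Category.assoc, Category.assoc, toCones, homotopyPullbackMap_snd, pathsThroughMap,
      ← Category.assoc, homotopyPullbackMap_snd, coneMap, homotopyPullbackMap_snd,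
      toCones, ← Category.assoc, homotopyPullbackMap_snd,
      Category.comp_id, mapPre_comp, Category.assoc]

variable [∀ X Y : C, KanComplex (sHom X Y)]

/-- Cocones, cones and `pathsThrough` are all models of the loop space of `Map(A, Y)` at null maps;
they differ only in their contractible corners. -/
lemma isWeakEquivalence_toCocones (hZ₁ : IsHomotopyZero Z₁) (hZ₂ : IsHomotopyZero Z₂)
    (hO₁ : IsHomotopyZero O₁) (hO₂ : IsHomotopyZero O₂) :
    IsWeakEquivalence (toCocones i j p q) :=
  isWeakEquivalence_homotopyPullbackMap_of_contractible _ _ (hO₁.trivialFibration_to _)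
    (hO₂.trivialFibration_to _) (hZ₁.trivialFibration_from _) (hZ₂.trivialFibration_from _)

lemma isWeakEquivalence_toCones (hO₁ : IsHomotopyZero O₁) (hO₂ : IsHomotopyZero O₂) :
    IsWeakEquivalence (toCones i j p q) :=
  isWeakEquivalence_homotopyPullbackMap_of_contractible _ _ (hO₁.trivialFibration_to _)
    (hO₂.trivialFibration_to _) (hO₁.trivialFibration_to _) (hO₂.trivialFibration_to _)

end

/-! ### The bijection between `[ΣA, Y]` and `[A, ΩY]` -/

section

variable {A Z₁ Z₂ A' Y O₁ O₂ Ω : C} {i : A ⟶ Z₁} {j : A ⟶ Z₂} {p : Z₁ ⟶ A'} {q : Z₂ ⟶ A'}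
  (h : HoSquare i j p q) {i' : Ω ⟶ O₁} {j' : Ω ⟶ O₂} {p' : O₁ ⟶ Y} {q' : O₂ ⟶ Y}
  (k : HoSquare i' j' p' q')

/-- The relation between homotopy classes of maps `ΣA ⟶ Y` and `A ⟶ ΩY`. -/
def SuspensionLoop (a' : π₀ (sHom A' Y)) (a : π₀ (sHom A Ω)) : Prop :=
  ∃ x : π₀ (pathsThrough i j p' q'), mapπ₀ (toCocones i j p' q') x = mapπ₀ (h.fromMap Y) a' ∧
    mapπ₀ (toCones i j p' q') x = mapπ₀ (k.toMap A) a

/-- The product of paths in mapping spaces. -/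
noncomputable def compPaths (K : SSet.{v}) (A O Y : C) (α : K ⟶ pathSpace (sHom A O))
    (β : K ⟶ pathSpace (sHom O Y)) : K ⟶ pathSpace (sHom A Y) :=
  pathLift α β ≫ pathMap (sHomComp A O Y)

lemma compPaths_eval {K : SSet.{v}} {A O Y : C} (α : K ⟶ pathSpace (sHom A O))
    (β : K ⟶ pathSpace (sHom O Y)) (k : Fin 2) : compPaths K A O Y α β ≫ pathEval _ k =
      lift (α ≫ pathEval _ k) (β ≫ pathEval _ k) ≫ sHomComp A O Y := by
  rw [compPaths, Category.assoc, pathMap_eval, ← Category.assoc, pathLift_eval]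

lemma comp_pathLift {K L X Y : SSet.{v}} (g : L ⟶ K) (α : K ⟶ pathSpace X) (β : K ⟶ pathSpace Y) :
    g ≫ pathLift α β = pathLift (g ≫ α) (g ≫ β) := by
  rw [pathLift, ← MonoidalClosed.curry_natural_left, comp_lift,
    ← MonoidalClosed.uncurry_natural_left, ← MonoidalClosed.uncurry_natural_left, pathLift]

lemma comp_compPaths {K L : SSet.{v}} {A O Y : C} (g : L ⟶ K) (α : K ⟶ pathSpace (sHom A O))
    (β : K ⟶ pathSpace (sHom O Y)) :
    g ≫ compPaths K A O Y α β = compPaths L A O Y (g ≫ α) (g ≫ β) := by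
  rw [compPaths, ← Category.assoc, comp_pathLift, compPaths]

lemma comp_pathMap_const {K X Y : SSet.{v}} (α : K ⟶ pathSpace X) (y : Y _⦋0⦌) :
    α ≫ pathMap (const y) = const y ≫ pathRefl Y := by
  apply MonoidalClosed.uncurry_injective
  rw [MonoidalClosed.uncurry_natural_right, comp_const, MonoidalClosed.uncurry_natural_left,
    pathRefl, MonoidalClosed.uncurry_curry, whiskerLeft_snd, comp_const]

lemma compPaths_refl_right {K : SSet.{v}} {A O Y : C} (α : K ⟶ pathSpace (sHom A O)) (y : O ⟶ Y) :
    compPaths K A O Y α (const (homEquiv' O Y y) ≫ pathRefl _) = α ≫ pathMap (mapPost A y) := by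
  rw [mapPost_eq, pathMap_comp, compPaths, ← Category.assoc]
  congr 1
  refine path_tensor_hom_ext ?_ ?_
  · rw [pathLift_map_fst, Category.assoc, ← pathMap_comp, lift_fst, pathMap_id, Category.comp_id]
  · rw [pathLift_map_snd, Category.assoc, ← pathMap_comp, lift_snd, comp_pathMap_const]

lemma compPaths_refl_left {K : SSet.{v}} {A O Y : C} (β : K ⟶ pathSpace (sHom O Y)) (a : A ⟶ O) :
    compPaths K A O Y (const (homEquiv' A O a) ≫ pathRefl _) β = β ≫ pathMap (mapPre a Y) := by
  rw [mapPre_eq, pathMap_comp, compPaths, ← Category.assoc]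
  congr 1
  refine path_tensor_hom_ext ?_ ?_
  · rw [pathLift_map_fst, Category.assoc, ← pathMap_comp, lift_fst, comp_pathMap_const]
  · rw [pathLift_map_snd, Category.assoc, ← pathMap_comp, lift_snd, pathMap_id, Category.comp_id]

variable [∀ X Y : C, KanComplex (sHom X Y)]

section

variable (hZ₁ : IsHomotopyZero Z₁) (hZ₂ : IsHomotopyZero Z₂)
    (hO₁ : IsHomotopyZero O₁) (hO₂ : IsHomotopyZero O₂)
    (hh : h.IsHomotopyPushout) (hk : k.IsHomotopyPullback)

include hO₁ hO₂

include hh in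
lemma SuspensionLoop.exists_left (a : π₀ (sHom A Ω)) : ∃ a', SuspensionLoop h k a' a := by
  obtain ⟨x, hx⟩ := (isWeakEquivalence_toCones i j p' q' hO₁ hO₂).1.2 (mapπ₀ (k.toMap A) a)
  obtain ⟨a', ha'⟩ := (hh Y).1.2 (mapπ₀ (toCocones i j p' q') x)
  exact ⟨a', x, ha'.symm, hx⟩

include hZ₁ hZ₂ hk in
lemma SuspensionLoop.exists_right (a' : π₀ (sHom A' Y)) : ∃ a, SuspensionLoop h k a' a := by
  obtain ⟨x, hx⟩ := (isWeakEquivalence_toCocones i j p' q' hZ₁ hZ₂ hO₁ hO₂).1.2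
    (mapπ₀ (h.fromMap Y) a')
  obtain ⟨a, ha⟩ := (hk A).1.2 (mapπ₀ (toCones i j p' q') x)
  exact ⟨a, x, hx, ha.symm⟩

variable {h k}

include hh in
lemma SuspensionLoop.left_unique {a : π₀ (sHom A Ω)} {a' a'' : π₀ (sHom A' Y)}
    (h₁ : SuspensionLoop h k a' a) (h₂ : SuspensionLoop h k a'' a) : a' = a'' := by
  obtain ⟨x, hx, hx'⟩ := h₁
  obtain ⟨y, hy, hy'⟩ := h₂
  obtain rfl := (isWeakEquivalence_toCones i j p' q' hO₁ hO₂).1.1 (hx'.trans hy'.symm)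
  exact (hh Y).1.1 (hx.symm.trans hy)

include hZ₁ hZ₂ hk in
lemma SuspensionLoop.right_unique {a b : π₀ (sHom A Ω)} {a' : π₀ (sHom A' Y)}
    (h₁ : SuspensionLoop h k a' a) (h₂ : SuspensionLoop h k a' b) : a = b := by
  obtain ⟨x, hx, hx'⟩ := h₁
  obtain ⟨y, hy, hy'⟩ := h₂
  obtain rfl := (isWeakEquivalence_toCocones i j p' q' hZ₁ hZ₂ hO₁ hO₂).1.1 (hx.trans hy.symm)
  exact (hk A).1.1 (hx'.symm.trans hy')

end

/-- The class of a point. -/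
def pointClass {X : SSet.{v}} (x : (Δ[0] : SSet.{v}) ⟶ X) : π₀ X :=
  π₀.mk (x.app _ (stdSimplex.obj₀Equiv.symm 0))

lemma mapπ₀_pointClass {X Y : SSet.{v}} (x : (Δ[0] : SSet.{v}) ⟶ X) (f : X ⟶ Y) :
    mapπ₀ f (pointClass x) = pointClass (x ≫ f) := rfl

lemma subsingleton_π₀_pathSpace {X : SSet.{v}} [KanComplex X] (hX : Subsingleton (π₀ X)) :
    Subsingleton (π₀ (pathSpace X)) :=
  ⟨fun _ _ ↦ (trivialFibration_pathEval X 0).isWeakEquivalence.1.1 (Subsingleton.elim _ _)⟩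

lemma exists_path_homEquiv' {X Y : C} (hXY : Subsingleton (π₀ (sHom X Y))) (f g : X ⟶ Y) :
    ∃ γ : pathSpace (sHom X Y) _⦋0⦌, (pathEval _ 0).app _ γ = homEquiv' X Y f ∧
      (pathEval _ 1).app _ γ = homEquiv' X Y g :=
  π₀_mk_eq_iff.1 (Subsingleton.elim _ _)

/-- The related pair comes from a loop that factors through a zero object `O`: the product of a path
`α` in `Map(A, O)` and a path `β` in `Map(O, Y)`. Both path spaces are connected. Deforming `β` to a
constant path turns the cocone into one that factors through `O`; deforming `α` does the same for
the cone. -/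
lemma SuspensionLoop.exists_isNull (hZ₁ : IsHomotopyZero Z₁) (hh : h.IsHomotopyPushout)
    (hk : k.IsHomotopyPullback) : ∃ a' a, IsNull a' ∧ IsNull a ∧ SuspensionLoop h k a' a := by
  obtain ⟨O, hO⟩ : ∃ O : C, IsHomotopyZero O := ⟨_, hZ₁⟩
  obtain ⟨a₁⟩ := hO.nonempty_to Z₁
  obtain ⟨a₂⟩ := hO.nonempty_to Z₂
  obtain ⟨b₁⟩ := hO.nonempty_from O₁
  obtain ⟨b₂⟩ := hO.nonempty_from O₂
  obtain ⟨y⟩ := hO.nonempty_from Y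
  obtain ⟨t⟩ := hO.nonempty_to A
  obtain ⟨α, hα₀, hα₁⟩ := exists_path_homEquiv' (hO.subsingleton_to A) (i ≫ a₁) (j ≫ a₂)
  obtain ⟨β, hβ₀, hβ₁⟩ := exists_path_homEquiv' (hO.subsingleton_from Y) (b₁ ≫ p') (b₂ ≫ q')
  let x : (Δ[0] : SSet.{v}) ⟶ pathsThrough i j p' q' :=
    hpbMk (compPaths _ A O Y (const α) (const β)) (const (homEquiv' _ _ (a₁ ≫ b₁)))
      (const (homEquiv' _ _ (a₂ ≫ b₂)))
      (by
        rw [compPaths_eval, const_comp, const_comp, hα₀, hβ₀, const_comp_assoc, const_comp,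
          mapPost_app, mapPre_app]
        refine (const_comp (Y := sHom A O ⊗ sHom O Y)
          (homEquiv' _ _ (i ≫ a₁), homEquiv' _ _ (b₁ ≫ p')) _).trans ?_
        rw [← comp_homEquiv', Category.assoc, Category.assoc])
      (by
        rw [compPaths_eval, const_comp, const_comp, hα₁, hβ₁, const_comp_assoc, const_comp,
          mapPost_app, mapPre_app]
        refine (const_comp (Y := sHom A O ⊗ sHom O Y)
          (homEquiv' _ _ (j ≫ a₂), homEquiv' _ _ (b₂ ≫ q')) _).trans ?_
        rw [← comp_homEquiv', Category.assoc, Category.assoc])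
  let Φ : pathSpace (sHom O Y) ⟶ homotopyPullback (mapPre i Y) (mapPre j Y) :=
    hpbMk (compPaths _ A O Y (const α) (𝟙 _)) (pathEval _ 0 ≫ mapPre a₁ Y)
      (pathEval _ 1 ≫ mapPre a₂ Y)
      (by
        rw [compPaths_eval, const_comp, hα₀, Category.id_comp, Category.assoc, ← mapPre_comp,
          mapPre_eq, ← Category.assoc, comp_lift, comp_const, Category.comp_id])
      (by
        rw [compPaths_eval, const_comp, hα₁, Category.id_comp, Category.assoc, ← mapPre_comp,
          mapPre_eq, ← Category.assoc, comp_lift, comp_const, Category.comp_id])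
  let Ψ : pathSpace (sHom A O) ⟶ homotopyPullback (mapPost A p') (mapPost A q') :=
    hpbMk (compPaths _ A O Y (𝟙 _) (const β)) (pathEval _ 0 ≫ mapPost A b₁)
      (pathEval _ 1 ≫ mapPost A b₂)
      (by
        rw [compPaths_eval, const_comp, hβ₀, Category.id_comp, Category.assoc, ← mapPost_comp,
          mapPost_eq, ← Category.assoc, comp_lift, comp_const, Category.comp_id])
      (by
        rw [compPaths_eval, const_comp, hβ₁, Category.id_comp, Category.assoc, ← mapPost_comp,
          mapPost_eq, ← Category.assoc, comp_lift, comp_const, Category.comp_id])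
  let z : (Δ[0] : SSet.{v}) ⟶ homotopyPullback (mapPre i O) (mapPre j O) :=
    hpbMk (const α) (const (homEquiv' _ _ a₁)) (const (homEquiv' _ _ a₂))
      (by rw [const_comp, const_comp, mapPre_app, hα₀])
      (by rw [const_comp, const_comp, mapPre_app, hα₁])
  let w : (Δ[0] : SSet.{v}) ⟶ homotopyPullback (mapPost O p') (mapPost O q') :=
    hpbMk (const β) (const (homEquiv' _ _ b₁)) (const (homEquiv' _ _ b₂))
      (by rw [const_comp, const_comp, mapPost_app, hβ₀])
      (by rw [const_comp, const_comp, mapPost_app, hβ₁])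
  have hx : x ≫ toCocones i j p' q' = const β ≫ Φ := by
    refine hpb_hom_ext ?_ ?_ ?_
    · rw [Category.assoc, Category.assoc, toCocones, homotopyPullbackMap_path, hpbMk_path,
        hpbMk_path_assoc, comp_compPaths, comp_const, Category.comp_id, pathMap_id,
        Category.comp_id]
    · rw [Category.assoc, Category.assoc, toCocones, homotopyPullbackMap_fst, hpbMk_fst,
        hpbMk_fst_assoc, const_comp, const_comp_assoc, const_comp, hβ₀, mapPost_app, mapPre_app,
        Category.assoc]
    · rw [Category.assoc, Category.assoc, toCocones, homotopyPullbackMap_snd, hpbMk_snd,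
        hpbMk_snd_assoc, const_comp, const_comp_assoc, const_comp, hβ₁, mapPost_app, mapPre_app,
        Category.assoc]
  have hx' : x ≫ toCones i j p' q' = const α ≫ Ψ := by
    refine hpb_hom_ext ?_ ?_ ?_
    · rw [Category.assoc, Category.assoc, toCones, homotopyPullbackMap_path, hpbMk_path,
        hpbMk_path_assoc, comp_compPaths, comp_const, Category.comp_id, pathMap_id,
        Category.comp_id]
    · rw [Category.assoc, Category.assoc, toCones, homotopyPullbackMap_fst, hpbMk_fst,
        hpbMk_fst_assoc, const_comp, const_comp_assoc, const_comp, hα₀, mapPost_app, mapPre_app,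
        Category.assoc]
    · rw [Category.assoc, Category.assoc, toCones, homotopyPullbackMap_snd, hpbMk_snd,
        hpbMk_snd_assoc, const_comp, const_comp_assoc, const_comp, hα₁, mapPost_app, mapPre_app,
        Category.assoc]
  have hz : (const (homEquiv' O Y y) ≫ pathRefl _) ≫ Φ = z ≫ coconeMap y i j := by
    refine hpb_hom_ext ?_ ?_ ?_
    · rw [Category.assoc, Category.assoc, Category.assoc, coconeMap, homotopyPullbackMap_path, hpbMk_path,
        hpbMk_path_assoc, comp_compPaths, comp_compPaths, comp_const, comp_const, Category.comp_id,
        compPaths_refl_right]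
    · rw [Category.assoc, Category.assoc, Category.assoc, coconeMap, homotopyPullbackMap_fst, hpbMk_fst,
        hpbMk_fst_assoc, pathRefl_eval_assoc, const_comp, const_comp, mapPre_app,
        mapPost_app]
    · rw [Category.assoc, Category.assoc, Category.assoc, coconeMap, homotopyPullbackMap_snd, hpbMk_snd,
        hpbMk_snd_assoc, pathRefl_eval_assoc, const_comp, const_comp, mapPre_app,
        mapPost_app]
  have hw : (const (homEquiv' A O t) ≫ pathRefl _) ≫ Ψ = w ≫ coneMap t p' q' := by
    refine hpb_hom_ext ?_ ?_ ?_
    · rw [Category.assoc, Category.assoc, Category.assoc, coneMap, homotopyPullbackMap_path, hpbMk_path,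
        hpbMk_path_assoc, comp_compPaths, comp_compPaths, comp_const, comp_const, Category.comp_id,
        compPaths_refl_left]
    · rw [Category.assoc, Category.assoc, Category.assoc, coneMap, homotopyPullbackMap_fst, hpbMk_fst,
        hpbMk_fst_assoc, pathRefl_eval_assoc, const_comp, const_comp, mapPre_app,
        mapPost_app]
    · rw [Category.assoc, Category.assoc, Category.assoc, coneMap, homotopyPullbackMap_snd, hpbMk_snd,
        hpbMk_snd_assoc, pathRefl_eval_assoc, const_comp, const_comp, mapPre_app,
        mapPost_app]
  obtain ⟨e, he⟩ := (hh O).1.2 (pointClass z)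
  obtain ⟨c, hc⟩ := (hk O).1.2 (pointClass w)
  obtain ⟨e, rfl⟩ := HoCat.cls_surjective e
  obtain ⟨c, rfl⟩ := HoCat.cls_surjective c
  refine ⟨HoCat.cls (e ≫ y), HoCat.cls (t ≫ c), ⟨O, e, y, hO, rfl⟩, ⟨O, t, c, hO, rfl⟩,
    pointClass x, ?_, ?_⟩
  -- The path `β` is replaced by the constant path at `y`, after which the cocone is the image of
  -- `z` under `y`.
  · have := subsingleton_π₀_pathSpace (hO.subsingleton_from Y)
    rw [mapπ₀_pointClass, hx, ← mapπ₀_pointClass,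
      Subsingleton.elim (pointClass (const β)) (pointClass (const (homEquiv' O Y y) ≫ pathRefl _)),
      mapπ₀_pointClass, hz, ← mapπ₀_pointClass, ← he, ← mapπ₀_comp_apply,
      HoSquare.fromMap_coconeMap, mapπ₀_comp_apply, mapπ₀_mapPost_cls]
  · have := subsingleton_π₀_pathSpace (hO.subsingleton_to A)
    rw [mapπ₀_pointClass, hx', ← mapπ₀_pointClass,
      Subsingleton.elim (pointClass (const α)) (pointClass (const (homEquiv' A O t) ≫ pathRefl _)),
      mapπ₀_pointClass, hw, ← mapπ₀_pointClass, ← hc, ← mapπ₀_comp_apply,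
      HoSquare.toMap_coneMap, mapπ₀_comp_apply, mapπ₀_mapPre_cls]

-- The relation is bijective and null classes are unique, so a single related pair of null classes
-- suffices.
variable {h k} in
lemma SuspensionLoop.isNull_iff (hZ₁ : IsHomotopyZero Z₁) (hZ₂ : IsHomotopyZero Z₂)
    (hO₁ : IsHomotopyZero O₁) (hO₂ : IsHomotopyZero O₂) (hh : h.IsHomotopyPushout)
    (hk : k.IsHomotopyPullback) {a' : π₀ (sHom A' Y)} {a : π₀ (sHom A Ω)}
    (ha : SuspensionLoop h k a' a) : IsNull a' ↔ IsNull a := by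
  obtain ⟨b', b, hb', hb, H⟩ := SuspensionLoop.exists_isNull h k hZ₁ hh hk
  constructor
  · intro ha'
    obtain rfl := ha'.eq hb'
    rwa [ha.right_unique hZ₁ hZ₂ hO₁ hO₂ hk H]
  · intro ha'
    obtain rfl := ha'.eq hb
    rwa [ha.left_unique hO₁ hO₂ hh H]

end

end CategoryTheory.SimplicialCategory

namespace CategoryTheory.SimplicialCategory

open SSet Limits

variable {C : Type u} [Category.{v} C] [SimplicialCategory C]

/-! ### Maps into an object: trivial kernels and surjectivity on homotopy classes -/

/-- Precomposition with `f` detects null maps to `Y`. -/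
def ReflectsNull {A B : C} (f : A ⟶ B) (Y : C) : Prop :=
  ∀ b : π₀ (sHom B Y), IsNull (mapπ₀ (mapPre f Y) b) → IsNull b

/-- Every map `A ⟶ Y` extends along `f : A ⟶ B` up to homotopy. -/
def HoExtends {A B : C} (f : A ⟶ B) (Y : C) : Prop :=
  Function.Surjective (mapπ₀ (mapPre f Y))

section

lemma comp_cls_left {X Y Z : C} (f : X ⟶ Y) (b : π₀ (sHom Y Z)) :
    HoCat.comp (HoCat.cls f) b = mapπ₀ (mapPre f Z) b := by
  obtain ⟨g, rfl⟩ := HoCat.cls_surjective b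
  rw [HoCat.comp_cls, mapπ₀_mapPre_cls]

lemma IsNull.comp_left {X Y Z : C} (a : π₀ (sHom X Y)) {b : π₀ (sHom Y Z)} (hb : IsNull b) :
    IsNull (HoCat.comp a b) := by
  obtain ⟨f, rfl⟩ := HoCat.cls_surjective a
  rw [comp_cls_left]
  exact hb.mapPre f

lemma reflectsNull_iff {A B : C} (f : A ⟶ B) (Y : C) :
    ReflectsNull f Y ↔ ∀ b : HoCat.of B ⟶ HoCat.of Y,
      IsNull (X := A) (Y := Y) (HoCat.map f ≫ b) → IsNull (X := B) (Y := Y) b := by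
  refine forall_congr' (fun b ↦ ?_)
  rw [← comp_cls_left]
  rfl

lemma hoExtends_iff {A B : C} (f : A ⟶ B) (Y : C) :
    HoExtends f Y ↔ ∀ a : HoCat.of A ⟶ HoCat.of Y, ∃ b : HoCat.of B ⟶ HoCat.of Y,
      HoCat.map f ≫ b = a := by
  refine forall_congr' (fun a ↦ exists_congr (fun b ↦ ?_))
  rw [← comp_cls_left]
  rfl

lemma ReflectsNull.of_hoIsomorphic {A B A' B' : C} {f : A ⟶ B} {g : A' ⟶ B'}
    (e : HoIsomorphic f g) {Y : C} (hf : ReflectsNull f Y) : ReflectsNull g Y := by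
  obtain ⟨e⟩ := e
  rw [reflectsNull_iff] at hf ⊢
  intro b hb
  have h₁ := hf (e.hom.right ≫ b) (by
    rw [show HoCat.map f ≫ e.hom.right ≫ b = e.hom.left ≫ HoCat.map g ≫ b from
      (Arrow.w_assoc e.hom b).symm]
    exact hb.comp_left (X := A) (Y := A') (Z := Y) _)
  have h₂ := h₁.comp_left (X := B') (Y := B) (Z := Y) e.inv.right
  have h₃ : e.inv.right ≫ e.hom.right ≫ b = b := by
    rw [← Category.assoc, Arrow.inv_hom_id_right]
    exact Category.id_comp _
  exact h₃ ▸ h₂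

lemma HoExtends.of_hoIsomorphic {A B A' B' : C} {f : A ⟶ B} {g : A' ⟶ B'}
    (e : HoIsomorphic f g) {Y : C} (hf : HoExtends f Y) : HoExtends g Y := by
  obtain ⟨e⟩ := e
  rw [hoExtends_iff] at hf ⊢
  intro a
  obtain ⟨b, hb⟩ := hf (e.hom.left ≫ a)
  refine ⟨e.inv.right ≫ b, ?_⟩
  have h₁ : HoCat.map g ≫ e.inv.right ≫ b = e.inv.left ≫ HoCat.map f ≫ b :=
    (Arrow.w_assoc e.inv b).symm
  rw [h₁, hb, ← Category.assoc, Arrow.inv_hom_id_left]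
  exact Category.id_comp _

end

variable [∀ X Y : C, KanComplex (sHom X Y)]

section

variable {A B Z Y O₁ O₂ Ω : C} {f : A ⟶ B} {j : A ⟶ Z} {i' : Ω ⟶ O₁} {j' : Ω ⟶ O₂}
  {p' : O₁ ⟶ Y} {q' : O₂ ⟶ Y} {k : HoSquare i' j' p' q'}

/-- A class with null restriction has the same restriction as a null class, and a connected homotopy
fiber over the null component forces the two to agree. -/
lemma ReflectsNull.of_subsingleton (hZ : IsHomotopyZero Z)
    (hW : Subsingleton (π₀ (homotopyPullback (mapPre f Y) (mapPre j Y)))) : ReflectsNull f Y := by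
  intro b hb
  obtain ⟨b₀, hb₀⟩ := hZ.exists_isNull B Y
  rw [eq_of_subsingleton_π₀_homotopyPullback (hZ.trivialFibration_from Y) hW
    ((isNull_iff_mem_range_mapPre Y hZ j _).1 hb) (hb.eq (hb₀.mapPre f))]
  exact hb₀

omit [∀ X Y : C, KanComplex (sHom X Y)] in
lemma surjective_mapπ₀_coneMap_iff (hk : k.IsHomotopyPullback) :
    Function.Surjective (mapπ₀ (coneMap f p' q')) ↔ HoExtends f Ω := by
  have h := congr_arg mapπ₀ (k.toMap_coneMap f)
  rw [mapπ₀_comp, mapπ₀_comp] at h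
  rw [← Function.Surjective.of_comp_iff _ (hk B).1.2, HoExtends,
    ← Function.Surjective.of_comp_iff' (hk A).1, h]

variable (hO₁ : IsHomotopyZero O₁) (hO₂ : IsHomotopyZero O₂) (hk : k.IsHomotopyPullback)

-- Mapping spaces into `Ω` are loop spaces of mapping spaces into `Y`, and `hpbEnd` models
-- precomposition with `f` on them.
include hO₁ hO₂ hk in
lemma hoExtends_iff_surjective_hpbEnd :
    HoExtends f Ω ↔
      Function.Surjective (mapπ₀ (hpbEnd (mapPre f Y) (mapPost B p') (mapPost B q'))) := by
  rw [← surjective_mapπ₀_coneMap_iff hk, coneMap]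
  exact surjective_mapπ₀_homotopyPullbackMap_iff _ _ (hO₁.trivialFibration_to B)
    (hO₂.trivialFibration_to B) (hO₁.trivialFibration_to A) (hO₂.trivialFibration_to A)

lemma exists_mk_mapPre_eq (hZ : IsHomotopyZero Z) (hO₁ : IsHomotopyZero O₁) (j : A ⟶ Z)
    (x : sHom B O₁ _⦋0⦌) : ∃ v : sHom Z Y _⦋0⦌, π₀.mk ((mapPre j Y).app _ v) =
      π₀.mk ((mapPost B p' ≫ mapPre f Y).app _ x) := by
  have h₁ : IsNull (mapπ₀ (mapPre f Y) (mapπ₀ (mapPost B p') (π₀.mk x))) :=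
    ((isNull_iff_mem_range_mapPost B hO₁ p' _).2 ⟨_, rfl⟩).mapPre f
  obtain ⟨v, hv⟩ := (isNull_iff_mem_range_mapPre Y hZ j _).1 h₁
  obtain ⟨v, rfl⟩ := π₀.mk_surjective v
  exact ⟨v, hv⟩

include hO₁ hO₂ hk in
lemma HoExtends.of_subsingleton (hZ : IsHomotopyZero Z)
    (hW : Subsingleton (π₀ (homotopyPullback (mapPre f Y) (mapPre j Y)))) : HoExtends f Ω := by
  rw [hoExtends_iff_surjective_hpbEnd hO₁ hO₂ hk]
  exact surjective_mapπ₀_hpbEnd _ _ _ (hZ.trivialFibration_from Y) hW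
    (exists_mk_mapPre_eq hZ hO₁ j)

-- A trivial kernel puts every component of `Map(B, Y)` over the null component in the image of
-- `Map(B, O₁)` and of `Map(B, O₂)`; surjectivity on loops then connects the fiber.
include hO₁ hO₂ hk in
lemma subsingleton_of_reflectsNull_of_hoExtends (hZ : IsHomotopyZero Z) (j : A ⟶ Z)
    (h₁ : ReflectsNull f Y) (h₂ : HoExtends f Ω) :
    Subsingleton (π₀ (homotopyPullback (mapPre f Y) (mapPre j Y))) := by
  rw [hoExtends_iff_surjective_hpbEnd hO₁ hO₂ hk] at h₂
  refine subsingleton_π₀_of_surjective_hpbEnd (hZ.trivialFibration_from Y) h₂ (fun x hx ↦ ?_)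
    (fun x hx ↦ ?_)
  · exact (isNull_iff_mem_range_mapPost B hO₁ p' x).1
      (h₁ x ((isNull_iff_mem_range_mapPre Y hZ j _).2 hx))
  · exact (isNull_iff_mem_range_mapPost B hO₂ q' x).1
      (h₁ x ((isNull_iff_mem_range_mapPre Y hZ j _).2 hx))

end

/-! ### Exactness at the maps out of a cofiber -/

section

variable {A B Q Y : C} {f : A ⟶ B}

omit [∀ X Y : C, KanComplex (sHom X Y)] in
lemma subsingleton_homotopyPullback_iff {Z : C} {j : A ⟶ Z} {p : B ⟶ Q} {q : Z ⟶ Q}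
    {h : HoSquare f j p q} (hh : h.IsHomotopyPushout) (Y : C) : Subsingleton (π₀ (sHom Q Y)) ↔
      Subsingleton (π₀ (homotopyPullback (mapPre f Y) (mapPre j Y))) :=
  (Equiv.ofBijective _ (hh Y).1).subsingleton_congr

/-- `Ω` is a loop object of `Y`. -/
def IsLoop (Ω Y : C) : Prop :=
  ∃ (O₁ O₂ : C) (i : Ω ⟶ O₁) (j : Ω ⟶ O₂) (p : O₁ ⟶ Y) (q : O₂ ⟶ Y) (k : HoSquare i j p q),
    IsHomotopyZero O₁ ∧ IsHomotopyZero O₂ ∧ k.IsHomotopyPullback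

lemma IsCofiber.reflectsNull (hQ : IsCofiber f Q) (h : Subsingleton (π₀ (sHom Q Y))) :
    ReflectsNull f Y := by
  obtain ⟨Z, j, p, q, c, hZ, hc⟩ := hQ
  exact .of_subsingleton hZ ((subsingleton_homotopyPullback_iff hc Y).1 h)

lemma IsCofiber.hoExtends (hQ : IsCofiber f Q) (h : Subsingleton (π₀ (sHom Q Y))) {Ω : C}
    (hΩ : IsLoop Ω Y) : HoExtends f Ω := by
  obtain ⟨Z, j, p, q, c, hZ, hc⟩ := hQ
  obtain ⟨O₁, O₂, i', j', p', q', k, hO₁, hO₂, hk⟩ := hΩ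
  exact .of_subsingleton hO₁ hO₂ hk hZ ((subsingleton_homotopyPullback_iff hc Y).1 h)

lemma IsCofiber.subsingleton (hQ : IsCofiber f Q) (h₁ : ReflectsNull f Y) {Ω : C}
    (hΩ : IsLoop Ω Y) (h₂ : HoExtends f Ω) : Subsingleton (π₀ (sHom Q Y)) := by
  obtain ⟨Z, j, p, q, c, hZ, hc⟩ := hQ
  obtain ⟨O₁, O₂, i', j', p', q', k, hO₁, hO₂, hk⟩ := hΩ
  exact (subsingleton_homotopyPullback_iff hc Y).2
    (subsingleton_of_reflectsNull_of_hoExtends hO₁ hO₂ hk hZ j h₁ h₂)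

end

/-! ### Suspensions of maps and loop objects -/

section

variable {A B A' B' Z₁ Z₂ Y O₁ O₂ Ω : C} {f : A ⟶ B} {g : A' ⟶ B'} {i : B ⟶ Z₁}
    {j : B ⟶ Z₂} {p : Z₁ ⟶ A'} {q : Z₂ ⟶ A'} {h : HoSquare (f ≫ i) (f ≫ j) p q}
    {p' : Z₁ ⟶ B'} {q' : Z₂ ⟶ B'} {h' : HoSquare i j p' q'}
    {i' : Ω ⟶ O₁} {j' : Ω ⟶ O₂} {p'' : O₁ ⟶ Y} {q'' : O₂ ⟶ Y} {k : HoSquare i' j' p'' q''}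

-- Naturality of the bijection `[ΣA, Y] ≅ [A, ΩY]` in `A`, obtained by precomposing the intermediate
-- path with `f`.
omit [∀ X Y : C, KanComplex (sHom X Y)] in
lemma SuspensionLoop.map (hg : mapπ₀ (h.fromMap B') (HoCat.cls g) =
      mapπ₀ (precompCocones f i j B') (mapπ₀ (h'.fromMap B') (HoCat.cls (𝟙 B'))))
    {b' : π₀ (sHom B' Y)} {b : π₀ (sHom B Ω)} (hb : SuspensionLoop h' k b' b) :
    SuspensionLoop h k (mapπ₀ (mapPre g Y) b') (mapπ₀ (mapPre f Ω) b) := by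
  obtain ⟨x, hx, hx'⟩ := hb
  refine ⟨mapπ₀ (pathsThroughMap p'' q'' f) x, ?_, ?_⟩
  · rw [← mapπ₀_comp_apply, pathsThroughMap_toCocones, mapπ₀_comp_apply, hx,
      IsSuspension.mapπ₀_fromMap hg]
  · rw [← mapπ₀_comp_apply, pathsThroughMap_toCones, mapπ₀_comp_apply, hx', ← mapπ₀_comp_apply,
      HoSquare.toMap_coneMap, mapπ₀_comp_apply]

end

section

variable {A B A' B' Ω Y : C} {f : A ⟶ B} {g : A' ⟶ B'}

lemma IsSuspension.reflectsNull_iff (hg : IsSuspension f g) (hΩ : IsLoop Ω Y) :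
    ReflectsNull g Y ↔ ReflectsNull f Ω := by
  obtain ⟨Z₁, Z₂, i, j, p, q, h, p', q', h', hZ₁, hZ₂, hh, hh', hg⟩ := hg
  obtain ⟨O₁, O₂, i', j', p'', q'', k, hO₁, hO₂, hk⟩ := hΩ
  constructor
  · intro H b hb
    obtain ⟨b', hb'⟩ := SuspensionLoop.exists_left h' k hO₁ hO₂ hh' b
    rw [← hb'.isNull_iff hZ₁ hZ₂ hO₁ hO₂ hh' hk]
    exact H b' (((hb'.map hg (h := h)).isNull_iff hZ₁ hZ₂ hO₁ hO₂ hh hk).2 hb)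
  · intro H b' hb
    obtain ⟨b, hb'⟩ := SuspensionLoop.exists_right h' k hZ₁ hZ₂ hO₁ hO₂ hk b'
    rw [hb'.isNull_iff hZ₁ hZ₂ hO₁ hO₂ hh' hk]
    exact H b (((hb'.map hg (h := h)).isNull_iff hZ₁ hZ₂ hO₁ hO₂ hh hk).1 hb)

lemma IsSuspension.hoExtends_iff (hg : IsSuspension f g) (hΩ : IsLoop Ω Y) :
    HoExtends g Y ↔ HoExtends f Ω := by
  obtain ⟨Z₁, Z₂, i, j, p, q, h, p', q', h', hZ₁, hZ₂, hh, hh', hg⟩ := hg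
  obtain ⟨O₁, O₂, i', j', p'', q'', k, hO₁, hO₂, hk⟩ := hΩ
  constructor
  · intro H a
    obtain ⟨a', ha'⟩ := SuspensionLoop.exists_left h k hO₁ hO₂ hh a
    obtain ⟨b', rfl⟩ := H a'
    obtain ⟨b, hb'⟩ := SuspensionLoop.exists_right h' k hZ₁ hZ₂ hO₁ hO₂ hk b'
    exact ⟨b, (hb'.map hg (h := h)).right_unique hZ₁ hZ₂ hO₁ hO₂ hk ha'⟩
  · intro H a'
    obtain ⟨a, ha'⟩ := SuspensionLoop.exists_right h k hZ₁ hZ₂ hO₁ hO₂ hk a'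
    obtain ⟨b, rfl⟩ := H a
    obtain ⟨b', hb'⟩ := SuspensionLoop.exists_left h' k hO₁ hO₂ hh' b
    exact ⟨b', (hb'.map hg (h := h)).left_unique hO₁ hO₂ hh ha'⟩

end

end CategoryTheory.SimplicialCategory

namespace SSet

open Limits

lemma subsingleton_π₀_homotopyPullback_of_isWeakEquivalence {N M V : SSet.{v}} [KanComplex N]
    [KanComplex M] [KanComplex V] {φ : N ⟶ M} {r : V ⟶ M} (hφ : IsWeakEquivalence φ)
    (hV : TrivialFibration (terminal.from V)) : Subsingleton (π₀ (homotopyPullback φ r)) := by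
  refine subsingleton_π₀_homotopyPullback hV (fun e₀ e₁ γ h₀ h₁ _ ↦ ?_)
  rw [← solves_path_iff]
  refine (trivialFibration_mappingPathEnd hφ).solves ?_
  rw [boundaryOne_ι_uncurry, h₀, h₁, boundaryOneDesc_comp]

end SSet

namespace CategoryTheory.SimplicialCategory

open SSet Limits

variable {C : Type u} [Category.{v} C] [SimplicialCategory C] [∀ X Y : C, KanComplex (sHom X Y)]

/-! ### Local objects of stable categories -/

namespace IsStable

variable (hC : IsStable C)

include hC

lemma exists_isLoop (Y : C) : ∃ Ω : C, IsLoop Ω Y := by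
  obtain ⟨Z, hZ⟩ := hC.exists_zero
  obtain ⟨p⟩ := hZ.nonempty_from Y
  obtain ⟨Ω, i, j, k, hk⟩ := hC.exists_pullback p p hZ
  exact ⟨Ω, Z, Z, i, j, p, p, k, hZ, hZ, hk⟩

/-- The suspension of `Y` works, because stability makes its pushout square a pullback square. This
delooping is what reaches the non-null components. -/
lemma exists_isLoop_of (Y : C) : ∃ Y' : C, IsLoop Y Y' := by
  obtain ⟨Z, hZ⟩ := hC.exists_zero
  obtain ⟨i⟩ := hZ.nonempty_to Y
  obtain ⟨Y', p, q, k, hk⟩ := hC.exists_pushout i i hZ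
  exact ⟨Y', Z, Z, i, i, p, q, k, hZ, hZ, (hC.pushout_iff_pullback k hZ).1 hk⟩

lemma exists_isCofiber {A B : C} (f : A ⟶ B) : ∃ Q : C, IsCofiber f Q := by
  obtain ⟨Z, hZ⟩ := hC.exists_zero
  obtain ⟨j⟩ := hZ.nonempty_to A
  obtain ⟨Q, p, q, h, hh⟩ := hC.exists_pushout f j hZ
  exact ⟨Q, Z, j, p, q, h, hZ, hh⟩

end IsStable

/-- The class `S` is orthogonal to `Y` on homotopy classes: maps to `Y` are detected on the
sources of the maps in `S`, and maps to loop objects of `Y` extend along the maps in `S`. -/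
def IsOrthogonal (S : MorphismProperty C) (Y : C) : Prop :=
  ∀ ⦃A B : C⦄ (f : A ⟶ B), S f → ReflectsNull f Y ∧ ∀ Ω : C, IsLoop Ω Y → HoExtends f Ω

namespace IsOrthogonal

variable {S : MorphismProperty C} {Y Ω : C}

lemma subsingleton (hC : IsStable C) (hY : IsOrthogonal S Y) {A B Q : C} {f : A ⟶ B} (hf : S f)
    (hQ : IsCofiber f Q) : Subsingleton (π₀ (sHom Q Y)) := by
  obtain ⟨Ω, hΩ⟩ := hC.exists_isLoop Y
  exact hQ.subsingleton (hY f hf).1 hΩ ((hY f hf).2 Ω hΩ)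

lemma of_subsingleton
    (h : ∀ ⦃A B : C⦄ (f : A ⟶ B), S f → ∃ Q, IsCofiber f Q ∧ Subsingleton (π₀ (sHom Q Y))) :
    IsOrthogonal S Y := by
  intro A B f hf
  obtain ⟨Q, hQ, hQY⟩ := h f hf
  exact ⟨hQ.reflectsNull hQY, fun Ω hΩ ↦ hQ.hoExtends hQY hΩ⟩

/-- The conditions on `f` at `Ω` are those on its suspension at `Y`, which is isomorphic in `hC` to
a member of `S`. -/
lemma loop (hS : IsShiftStable S) (hΩ : IsLoop Ω Y) (hY : IsOrthogonal S Y) :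
    IsOrthogonal S Ω := by
  intro A B f hf
  obtain ⟨A₁, B₁, A₂, B₂, g, g', hg, hg', e⟩ := hS.suspension f hf
  exact ⟨(hg.reflectsNull_iff hΩ).1 ((hY g' hg').1.of_hoIsomorphic e), fun Ω₂ hΩ₂ ↦
    (hg.hoExtends_iff hΩ₂).1 (((hY g' hg').2 Ω hΩ).of_hoIsomorphic e)⟩

/-- Dually, desuspensions turn the conditions at `Ω` into conditions at `Y`. Passing through the
cofiber yields them for every loop object of `Y`, not only for `Ω`. -/
lemma of_loop (hC : IsStable C) (hS : IsShiftStable S) (hΩ : IsLoop Ω Y)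
    (hY : IsOrthogonal S Ω) : IsOrthogonal S Y := by
  refine of_subsingleton (fun A B f hf ↦ ?_)
  obtain ⟨A₁, B₁, A₂, B₂, g, g', hg, hg', e⟩ := hS.desuspension f hf
  obtain ⟨Q, hQ⟩ := hC.exists_isCofiber f
  obtain ⟨Ω₂, hΩ₂⟩ := hC.exists_isLoop Ω
  exact ⟨Q, hQ, hQ.subsingleton ((hg.reflectsNull_iff hΩ).2 ((hY g' hg').1.of_hoIsomorphic e)) hΩ
    ((hg.hoExtends_iff hΩ₂).2 (((hY g' hg').2 Ω₂ hΩ₂).of_hoIsomorphic e))⟩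

/-- Induction on the dimension of the sphere to be filled, with `Y` varying: a sphere in the
connected space `Map(Q, Y)` is filled using spheres of one dimension less in its loop space `Map(Q,
Ω)`, and `Ω` is again orthogonal. -/
lemma trivialFibration (hC : IsStable C) (hS : IsShiftStable S) (hY : IsOrthogonal S Y)
    {A B Q : C} {f : A ⟶ B} (hf : S f) (hQ : IsCofiber f Q) :
    TrivialFibration (terminal.from (sHom Q Y)) := by
  rw [trivialFibration_terminal_iff]
  intro n
  induction n generalizing Y with
  | zero =>
    intro a
    obtain ⟨Z, hZ⟩ := hC.exists_zero
    obtain ⟨g⟩ := hZ.nonempty_to Q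
    obtain ⟨h⟩ := hZ.nonempty_from Y
    exact ⟨const (homEquiv' _ _ (g ≫ h)), boundary.hom_ext₀⟩
  | succ n hn =>
    obtain ⟨Ω, hΩ⟩ := hC.exists_isLoop Y
    have := hn (hY.loop hS hΩ)
    obtain ⟨O₁, O₂, i, j, p, q, k, hO₁, hO₂, hk⟩ := hΩ
    exact exists_extension_succ (hY.subsingleton hC hf hQ) (hO₁.trivialFibration_to Q)
      (hO₂.trivialFibration_to Q) ((exists_extension_iff_of_isWeakEquivalence (hk Q) _).1 this)

lemma isLocal (hC : IsStable C) (hS : IsShiftStable S) (hY : IsOrthogonal S Y) :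
    IsLocal S Y := by
  intro A B f hf
  obtain ⟨Y', hY'⟩ := hC.exists_isLoop_of Y
  have hS' := hY.of_loop hC hS hY'
  obtain ⟨O₁, O₂, i, j, p, q, k, hO₁, hO₂, hk⟩ := hY'
  obtain ⟨Q, hQ⟩ := hC.exists_isCofiber f
  have hQ' := hS'.trivialFibration hC hS hf hQ
  obtain ⟨Z, j', p', q', h, hZ, hh⟩ := hQ
  rw [trivialFibration_terminal_iff_of_isWeakEquivalence (hh Y')] at hQ'
  -- The fiber of precomposition with `f` on maps to `Y'` is contractible over the null component,
  -- and the loops in question are based there.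
  have hf' : IsWeakEquivalence (coneMap f p q) :=
    isWeakEquivalence_homotopyPullbackMap _ _ (hO₁.trivialFibration_to B)
      (hO₂.trivialFibration_to B) (hO₁.trivialFibration_to A) (hO₂.trivialFibration_to A)
      (hZ.trivialFibration_from Y') hQ' (exists_mk_mapPre_eq hZ hO₁ j')
  refine .of_comp_right (hk A) ?_
  rw [← k.toMap_coneMap f]
  exact .comp (hk B) hf'

end IsOrthogonal

lemma IsCofiber.subsingleton_of_isWeakEquivalence {A B Q Y : C} {f : A ⟶ B} (hQ : IsCofiber f Q)
    (hf : IsWeakEquivalence (mapPre f Y)) : Subsingleton (π₀ (sHom Q Y)) := by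
  obtain ⟨Z, j, p, q, h, hZ, hh⟩ := hQ
  exact (subsingleton_homotopyPullback_iff hh Y).2
    (subsingleton_π₀_homotopyPullback_of_isWeakEquivalence hf (hZ.trivialFibration_from Y))

/-- The null class is always present, so only uniqueness matters. -/
lemma IsStable.nonempty_unique_iff (hC : IsStable C) (X Y : C) :
    Nonempty (Unique (HoCat.of X ⟶ HoCat.of Y)) ↔ Subsingleton (π₀ (sHom X Y)) := by
  obtain ⟨Z, hZ⟩ := hC.exists_zero
  obtain ⟨a, -⟩ := hZ.exists_isNull X Y
  exact (unique_iff_subsingleton_and_nonempty _).trans (and_iff_left ⟨a⟩)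

end CategoryTheory.SimplicialCategory

theorem mainTheorem5 {C : Type u} [Category.{v} C] [SimplicialCategory C]
    [∀ X Y : C, SSet.KanComplex (sHom X Y)]
    (hC : IsStable C) (S : MorphismProperty C) (hS : IsShiftStable S)
    (cof : ∀ ⦃A B : C⦄ (f : A ⟶ B), S f → C)
    (hcof : ∀ ⦃A B : C⦄ (f : A ⟶ B) (hf : S f), IsCofiber f (cof f hf))
    (Y : C) :
    IsLocal S Y ↔
      ∀ ⦃A B : C⦄ (f : A ⟶ B) (hf : S f),
        Nonempty (Unique (HoCat.of (cof f hf) ⟶ HoCat.of Y)) := by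
  simp only [hC.nonempty_unique_iff]
  exact ⟨fun h A B f hf ↦ (hcof f hf).subsingleton_of_isWeakEquivalence (h f hf), fun h ↦
    (IsOrthogonal.of_subsingleton (fun A B f hf ↦ ⟨_, hcof f hf, h f hf⟩)).isLocal hC hS⟩
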